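/- Let $V$ be a finite-dimensional complex vector space, $G\subset \mathrm{GL}(V)$ a finite subgroup and $N=G\cap \mathrm{SL}(V)$, and assume that every irreducible character of $N$ is the restriction of an irreducible character of $G$. *Notation.* Let $\Gamma$ be $G$ or $N$. Fix orthogonal primitive idempotents $e_i\in\mathbb C\Gamma$ ($i\in Q_{\Gamma,0}$) such that the $S_i=\mathbb C\Gamma e_i$ form a complete set of representatives of the irreducible representations of $\Gamma$. The McKay quiver $Q_\Gamma$ has vertex set $Q_{\Gamma,0}$ and $a_{i,j}=\dim\mathrm{Hom}_\Gamma(S_j,V\otimes S_i)$ arrows from $i$ to $j$. Let $\wedge V*\Gamma$ be the skew group algebra over the exterior algebra and $\Lambda(\Gamma)=e(\wedge V*\Gamma)e$, $e=\sum_i e_i$, its basic algebra. A *realization* of $Q_\Gamma$ is an algebra homomorphism $\varphi_\Gamma:\mathbb CQ_\Gamma\to\Lambda(\Gamma)$ that sends the trivial path at $i$ to $e_i$ and the arrows from $i$ to $j$ bijectively to a basis of $e_j(V*\Gamma)e_i$. A set $\rho$ of elements, each a linear combination of paths of length $2$ with a common source and a common target, *presents* $\Lambda(\Gamma)$ (via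 $\varphi_\Gamma$) if $\varphi_\Gamma$ is surjective and its kernel is the two-sided ideal $(\rho)$, so $\Lambda(\Gamma)\cong\mathbb CQ_\Gamma/(\rho)$; these are the quadratic relations that come from the relations $vw+wv=0$ of $\wedge V$. Given realizations of $Q_G$ and $Q_N$, a morphism of quivers $\pi:Q_G\to Q_N$ is *given by restriction* if there are isomorphisms of $N$-representations $S_{\pi(a)}\cong S_a|_N$ (for all $a\in Q_{G,0}$) under which, for each arrow $\alpha:a\to b$ of $Q_G$, the $G$-map $S_b\to V\otimes S_a$ defined by $\alpha$ is equal to the $N$-map $S_{\pi(b)}\to V\otimes S_{\pi(a)}$ defined by $\pi(\alpha)$. $\pi$ is a *regular covering with group $K$* if it is surjective on vertices, restricts to bijections from the arrows starting (ending) at each vertex $a$ to those starting (ending) at $\pi(a)$, and $K$ acts on $Q_G$ by automorphisms over $Q_N$, freely and transitively on the vertices of each fibre. A *lifting* $L:\mathbb CQ_N\to\mathbb CQ_G$ is the linear map that, for some choice of a vertex $s(i)$ over each vertex $i$, sends each path with source $i$ to the path over it with source $s(i)$. For sets of relations $\rho_G,\rho_N$, a regular covering $\pi$ is a *morphism of quivers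 with relations* $(Q_G,\rho_G)\to(Q_N,\rho_N)$ (in the sense of Green) if 1. $\rho_G=\{L(x)\mid L \text{ a lifting},\ x\in\rho_N\}$; 2. for all $x\in\rho_G$ and $i',j'\in Q_{N,0}$ there are $i,j\in Q_{G,0}$ with $\pi(i)=i'$, $\pi(j)=j'$ and $\bar\pi(e_jxe_i)=e_{j'}\bar\pi(x)e_{i'}$, where $\bar\pi:\mathbb CQ_G\to\mathbb CQ_N$ is the linear map induced by $\pi$. **Theorem.** For all choices of the idempotents for $G$ and $N$, there are realizations of $Q_G$ and $Q_N$ and a morphism $\pi:Q_G\to Q_N$ given by restriction. For all such realizations and all such $\pi$: (a) there is a set $\rho_N$ of quadratic relations presenting $\Lambda(N)$ such that every lift $L(x)$, $x\in\rho_N$, is a combination of paths with a common source and a common target; (b) for each such $\rho_N$ there is a set $\rho_G$ of quadratic relations presenting $\Lambda(G)$ such that $\pi$ is a regular covering with group $G/N$ and a morphism of quivers with relations $(Q_G,\rho_G)\to(Q_N,\rho_N)$. -/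

import Mathlib

noncomputable section

/-! ### Path algebras

`α : i ⟶ j` is an arrow from `i` to `j`. In the path algebra paths are multiplied from right to
left: `p * q` is "first `q`, then `p`" if `q` ends where `p` starts, and `0` otherwise. -/

/-- A path of a quiver together with its end points. -/
structure QuiverPath (Q : Type*) [Quiver Q] where
  src : Q
  tgt : Q
  path : Quiver.Path src tgt

namespace QuiverPath

variable {Q Q' : Type*} [Quiver Q] [Quiver Q']

/-- The image of a path under a morphism of quivers. -/
def map (π : Q ⥤q Q') (p : QuiverPath Q) : QuiverPath Q' :=
  ⟨π.obj p.src, π.obj p.tgt, π.mapPath p.path⟩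

/-- `p.after q h` is the path "first `q`, then `p`". -/
def after (p q : QuiverPath Q) (h : p.src = q.tgt) : QuiverPath Q :=
  ⟨q.src, p.tgt, q.path.comp (p.path.cast h rfl)⟩

theorem after_assoc (p q r : QuiverPath Q) (h₁ : p.src = q.tgt) (h₂ : q.src = r.tgt) :
    (p.after q h₁).after r h₂ = p.after (q.after r h₂) h₁ := by
  obtain ⟨a, b, p⟩ := p
  obtain ⟨c, d, q⟩ := q
  obtain ⟨e, f, r⟩ := r
  dsimp only at h₁ h₂
  subst h₁
  subst h₂
  simp [after, Quiver.Path.comp_assoc]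

end QuiverPath

/-- The path algebra `ℂQ`: the vector space with basis the paths of `Q` (trivial paths included). -/
def PathAlgebra (Q : Type*) [Quiver Q] : Type _ := QuiverPath Q →₀ ℂ

namespace PathAlgebra

variable {Q Q' : Type*} [Quiver Q] [Quiver Q']

instance : AddCommGroup (PathAlgebra Q) := inferInstanceAs (AddCommGroup (QuiverPath Q →₀ ℂ))

instance : Module ℂ (PathAlgebra Q) := inferInstanceAs (Module ℂ (QuiverPath Q →₀ ℂ))

/-- A path as an element of the path algebra. -/
def ofPath (p : QuiverPath Q) : PathAlgebra Q := Finsupp.single p (1 : ℂ)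

/-- The trivial path `e_i`. -/
def vertex (i : Q) : PathAlgebra Q := ofPath ⟨i, i, Quiver.Path.nil⟩

/-- An arrow as an element of the path algebra. -/
def arrow {i j : Q} (α : i ⟶ j) : PathAlgebra Q := ofPath ⟨i, j, α.toPath⟩

/-- The finite set of paths that occur in `x` with a nonzero coefficient. -/
def support (x : PathAlgebra Q) : Finset (QuiverPath Q) := Finsupp.support x

open Classical in
/-- The product of two paths in the path algebra. -/
def pathMul (p q : QuiverPath Q) : PathAlgebra Q :=
  if h : p.src = q.tgt then ofPath (p.after q h) else 0

/-- The multiplication of the path algebra, as a bilinear map. -/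
def mulHom : PathAlgebra Q →ₗ[ℂ] PathAlgebra Q →ₗ[ℂ] PathAlgebra Q :=
  Finsupp.linearCombination ℂ fun p =>
    (Finsupp.linearCombination ℂ fun q => pathMul p q : (QuiverPath Q →₀ ℂ) →ₗ[ℂ] PathAlgebra Q)

instance : Mul (PathAlgebra Q) := ⟨fun x y => mulHom x y⟩

theorem mul_def (x y : PathAlgebra Q) : x * y = mulHom x y := rfl

theorem ofPath_mul_ofPath (p q : QuiverPath Q) : ofPath p * ofPath q = pathMul p q := by
  rw [mul_def, mulHom, ofPath, ofPath]
  erw [Finsupp.linearCombination_single, one_smul, Finsupp.linearCombination_single, one_smul]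

theorem induction {P : PathAlgebra Q → Prop} (x : PathAlgebra Q) (zero : P 0)
    (add : ∀ x y, P x → P y → P (x + y)) (path : ∀ (c : ℂ) p, P (c • ofPath p)) : P x := by
  refine Finsupp.induction_linear (motive := P) x zero add fun p c => ?_
  have h : (Finsupp.single p c : QuiverPath Q →₀ ℂ) = c • Finsupp.single p (1 : ℂ) := by simp
  rw [h]
  exact path c p

theorem ofPath_assoc (p q r : QuiverPath Q) :
    ofPath p * ofPath q * ofPath r = ofPath p * (ofPath q * ofPath r) := by
  rw [ofPath_mul_ofPath, ofPath_mul_ofPath]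
  by_cases h₁ : p.src = q.tgt <;> by_cases h₂ : q.src = r.tgt
  · have h₃ : (p.after q h₁).src = r.tgt := h₂
    have h₄ : p.src = (q.after r h₂).tgt := h₁
    rw [pathMul, dif_pos h₁, pathMul, dif_pos h₂, ofPath_mul_ofPath, ofPath_mul_ofPath, pathMul,
      dif_pos h₃, pathMul, dif_pos h₄]
    exact congrArg ofPath (QuiverPath.after_assoc p q r h₁ h₂)
  · have h₃ : ¬ (p.after q h₁).src = r.tgt := h₂
    rw [pathMul, dif_pos h₁, pathMul, dif_neg h₂, ofPath_mul_ofPath, pathMul, dif_neg h₃, mul_def,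
      map_zero]
  · have h₄ : ¬ p.src = (q.after r h₂).tgt := h₁
    rw [pathMul, dif_neg h₁, pathMul, dif_pos h₂, ofPath_mul_ofPath, pathMul, dif_neg h₄, mul_def,
      map_zero, LinearMap.zero_apply]
  · rw [pathMul, dif_neg h₁, pathMul, dif_neg h₂]
    simp only [mul_def, map_zero, LinearMap.zero_apply]

instance : NonUnitalRing (PathAlgebra Q) where
  __ := (inferInstance : AddCommGroup (PathAlgebra Q))
  mul x y := x * y
  left_distrib x y z := by simp only [mul_def, map_add]
  right_distrib x y z := by simp only [mul_def, map_add, LinearMap.add_apply]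
  zero_mul x := by simp only [mul_def, map_zero, LinearMap.zero_apply]
  mul_zero x := by simp only [mul_def, map_zero]
  mul_assoc x y z := by
    induction x using induction with
    | zero => simp only [mul_def, map_zero, LinearMap.zero_apply]
    | add x x' hx hx' => simp only [mul_def, map_add, LinearMap.add_apply] at hx hx' ⊢; rw [hx, hx']
    | path a p =>
      induction y using induction with
      | zero => simp only [mul_def, map_zero, LinearMap.zero_apply]
      | add x x' hx hx' =>
        simp only [mul_def, map_add, LinearMap.add_apply] at hx hx' ⊢; rw [hx, hx']
      | path b q =>
        induction z using induction with
        | zero => simp only [mul_def, map_zero]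
        | add x x' hx hx' => simp only [mul_def, map_add] at hx hx' ⊢; rw [hx, hx']
        | path c r =>
          have h := ofPath_assoc p q r
          simp only [mul_def, map_smul, LinearMap.smul_apply] at h ⊢
          rw [h]

/-- The linear map `ℂQ → ℂQ'` induced by a morphism of quivers `π : Q → Q'`. -/
def map (π : Q ⥤q Q') : PathAlgebra Q →ₗ[ℂ] PathAlgebra Q' :=
  Finsupp.lmapDomain ℂ ℂ (QuiverPath.map π)

/-- `x ∈ e_j ℂQ e_i` for some vertices `i`, `j`: all paths in `x` have the same source and the same
target. -/
def IsUniform (x : PathAlgebra Q) : Prop :=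
  ∃ i j : Q, ∀ p ∈ x.support, p.src = i ∧ p.tgt = j

/-- `x` is a linear combination of paths of length `2`. -/
def IsQuadratic (x : PathAlgebra Q) : Prop :=
  ∀ p ∈ x.support, p.path.length = 2

end PathAlgebra

/-! ### Regular coverings and morphisms of quivers with relations -/

section Coverings

variable {Q Q' : Type*} [Quiver Q] [Quiver Q']

/-- `π : Q → Q'` is a regular covering with group `K`: it is surjective on vertices, bijective from
the arrows starting (ending) at a vertex `i` to those starting (ending) at `π i`, and `K` acts on
`Q` by automorphisms over `Q'`, freely and transitively on the vertices of each fibre. -/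
structure IsRegularCovering (K : Type*) [Group K] (π : Q ⥤q Q') : Prop where
  isCovering : π.IsCovering
  surjective : Function.Surjective π.obj
  exists_action : ∃ T : K → (Q ⥤q Q),
    T 1 = 𝟭q Q ∧ (∀ g h, T (g * h) = T h ⋙q T g) ∧ (∀ g, T g ⋙q π = π) ∧
    ∀ a b, π.obj a = π.obj b → ∃! g, (T g).obj a = b

/-- `L : ℂQ' → ℂQ` is a lifting along the covering `π : Q → Q'`: for some choice `s i` of a vertex
over each vertex `i` of `Q'`, it is the linear map sending each path `p` with source `i` to the path
of `Q` over `p` with source `s i`. -/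
def IsLifting (π : Q ⥤q Q') (L : PathAlgebra Q' →ₗ[ℂ] PathAlgebra Q) : Prop :=
  ∃ s : Q' → Q, (∀ i, π.obj (s i) = i) ∧
    ∀ p : QuiverPath Q', ∃ q : QuiverPath Q,
      q.src = s p.src ∧ q.map π = p ∧ L (PathAlgebra.ofPath p) = PathAlgebra.ofPath q

/-- The regular covering `π : Q → Q'` with group `K` is a morphism of quivers with relations
`(Q, ρ) → (Q', ρ')` in the sense of Green. -/
structure IsMorphismOfQuiversWithRelations (K : Type*) [Group K] (π : Q ⥤q Q')
    (ρ : Set (PathAlgebra Q)) (ρ' : Set (PathAlgebra Q')) : Prop where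
  isRegularCovering : IsRegularCovering K π
  relations_eq : ρ = {y | ∃ L, IsLifting π L ∧ ∃ x ∈ ρ', L x = y}
  map_component : ∀ x ∈ ρ, ∀ i' j' : Q', ∃ i j : Q, π.obj i = i' ∧ π.obj j = j' ∧
    PathAlgebra.map π (PathAlgebra.vertex j * x * PathAlgebra.vertex i) =
      PathAlgebra.vertex j' * PathAlgebra.map π x * PathAlgebra.vertex i'

/-- Every lift along `π` of an element of `ρ'` has all its paths ending at one and the same vertex
(and starting at one and the same vertex). -/
def LiftsUniformly (π : Q ⥤q Q') (ρ' : Set (PathAlgebra Q')) : Prop :=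
  ∀ x ∈ ρ', ∀ L, IsLifting π L → (L x).IsUniform

end Coverings

/-! ### The skew group algebra `⋀V * Γ`

`Γ` is a group acting linearly on the complex vector space `V`. -/

section Skew

variable (V : Type*) [AddCommGroup V] [Module ℂ V]
variable (Γ : Type*) [Group Γ] [DistribMulAction Γ V] [SMulCommClass Γ ℂ V]

/-- The action of `Γ` on the exterior algebra `⋀V` by algebra automorphisms extending the action
on `V`. -/
instance exteriorAction : MulSemiringAction Γ (ExteriorAlgebra ℂ V) where
  smul g x := ExteriorAlgebra.map (DistribSMul.toLinearMap ℂ V g) x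
  one_smul x := by
    change ExteriorAlgebra.map (DistribSMul.toLinearMap ℂ V (1 : Γ)) x = x
    have h : DistribSMul.toLinearMap ℂ V (1 : Γ) = LinearMap.id := by ext v; simp
    rw [h, ExteriorAlgebra.map_id]; rfl
  mul_smul g g' x := by
    change ExteriorAlgebra.map (DistribSMul.toLinearMap ℂ V (g * g')) x =
      ExteriorAlgebra.map (DistribSMul.toLinearMap ℂ V g)
        (ExteriorAlgebra.map (DistribSMul.toLinearMap ℂ V g') x)
    have h : DistribSMul.toLinearMap ℂ V (g * g') =
        DistribSMul.toLinearMap ℂ V g ∘ₗ DistribSMul.toLinearMap ℂ V g' := by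
      ext v; simp [mul_smul]
    rw [h, ← ExteriorAlgebra.map_comp_map]; rfl
  smul_zero g := map_zero _
  smul_add g := map_add _
  smul_one g := map_one _
  smul_mul g := map_mul _

theorem exteriorAction_def (g : Γ) (x : ExteriorAlgebra ℂ V) :
    g • x = ExteriorAlgebra.map (DistribSMul.toLinearMap ℂ V g) x := rfl

instance exteriorAction_smulCommClass : SMulCommClass Γ ℂ (ExteriorAlgebra ℂ V) where
  smul_comm g c x := by simp only [exteriorAction_def, map_smul]

/-- The skew group algebra `⋀V * Γ`: finite sums of elements `x g` with `x ∈ ⋀V`, `g ∈ Γ`, and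
`(x g) (y h) = x g(y) gh`. -/
abbrev SkewExterior : Type _ := SkewMonoidAlgebra (ExteriorAlgebra ℂ V) Γ

variable {Γ}

/-- The inclusion `ℂΓ → ⋀V * Γ`. -/
def groupAlgebraHom : MonoidAlgebra ℂ Γ →ₐ[ℂ] SkewExterior V Γ :=
  MonoidAlgebra.lift ℂ (SkewExterior V Γ) Γ (SkewMonoidAlgebra.of (ExteriorAlgebra ℂ V) Γ)

variable (Γ) in
/-- The subspace `V * Γ` of `⋀V * Γ`. -/
def degreeOne : Submodule ℂ (SkewExterior V Γ) :=
  Submodule.span ℂ {x | ∃ (g : Γ) (v : V), x = SkewMonoidAlgebra.single g (ExteriorAlgebra.ι ℂ v)}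

end Skew

/-! ### McKay quivers and basic algebras -/

section McKay

variable {Γ : Type*} [Group Γ]

/-- The left ideal `ℂΓ a` as a representation of `Γ`. -/
def leftIdealRep (a : MonoidAlgebra ℂ Γ) :
    Representation ℂ Γ (Submodule.span (MonoidAlgebra ℂ Γ) {a}) :=
  Representation.ofModule' _

/-- `e` is a family of orthogonal primitive idempotents of `ℂΓ` such that the representations
`ℂΓ e_i` form a complete set of representatives of the irreducible representations of `Γ`. -/
structure IsBasicSystem {I : Type*} (e : I → MonoidAlgebra ℂ Γ) : Prop where
  orthogonal : OrthogonalIdempotents e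
  irreducible : ∀ i, (leftIdealRep (e i)).IsIrreducible
  eq_of_equiv : ∀ i j, Nonempty ((leftIdealRep (e i)).Equiv (leftIdealRep (e j))) → i = j
  complete : ∀ (n : ℕ) (ρ : Representation ℂ Γ (Fin n → ℂ)), ρ.IsIrreducible →
    ∃ i, Nonempty (ρ.Equiv (leftIdealRep (e i)))

/-- `χ` is the character of an irreducible finite-dimensional complex representation of `Γ`. -/
def IsIrreducibleCharacter (χ : Γ → ℂ) : Prop :=
  ∃ (n : ℕ) (ρ : Representation ℂ Γ (Fin n → ℂ)), ρ.IsIrreducible ∧ ρ.character = χ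

variable (V : Type*) [AddCommGroup V] [Module ℂ V]
variable [DistribMulAction Γ V] [SMulCommClass Γ ℂ V]
variable {I : Type*} (e : I → MonoidAlgebra ℂ Γ)

/-- The vertices of the McKay quiver of `Γ` (acting on `V`): the vertex `i` stands for the
irreducible representation `S_i = ℂΓ e_i`. -/
@[nolint unusedArguments]
def McKayQuiver (_V : Type*) {I : Type*} (_e : I → MonoidAlgebra ℂ Γ) : Type _ := I

/-- The multiplicity `a_{i,j}` of `S_j` in `V ⊗ S_i`, that is, `dim Hom_Γ (S_j, V ⊗ S_i)`. -/
def mcKayMultiplicity (i j : I) : ℕ :=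
  Module.finrank ℂ (Representation.IntertwiningMap (leftIdealRep (e j))
    ((Representation.ofDistribMulAction ℂ Γ V).tprod (leftIdealRep (e i))))

/-- The McKay quiver has `a_{i,j}` arrows from `i` to `j`. -/
instance : Quiver (McKayQuiver V e) where
  Hom i j := Fin (mcKayMultiplicity V e i j)

variable [Fintype I]

/-- The basic algebra `Λ(Γ) = e (⋀V * Γ) e` with `e = ∑ e_i`, as a (non-unital) subalgebra of
`⋀V * Γ`. -/
def basicAlgebra : NonUnitalSubalgebra ℂ (SkewExterior V Γ) where
  carrier := {x | ∃ y, x = groupAlgebraHom V (∑ i, e i) * y * groupAlgebraHom V (∑ i, e i)}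
  zero_mem' := ⟨0, by simp⟩
  add_mem' := by
    rintro _ _ ⟨x, rfl⟩ ⟨y, rfl⟩
    exact ⟨x + y, by rw [mul_add, add_mul]⟩
  mul_mem' := by
    rintro _ _ ⟨x, rfl⟩ ⟨y, rfl⟩
    exact ⟨x * groupAlgebraHom V (∑ i, e i) * groupAlgebraHom V (∑ i, e i) * y,
      by simp only [mul_assoc]⟩
  smul_mem' := by
    rintro c _ ⟨x, rfl⟩
    exact ⟨c • x, by rw [mul_smul_comm, smul_mul_assoc]⟩

/-- The subspace `e_j (V * Γ) e_i` of `⋀V * Γ`. -/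
def arrowSpace (i j : I) : Submodule ℂ (SkewExterior V Γ) :=
  (degreeOne V Γ).map
    (LinearMap.mulLeft ℂ (groupAlgebraHom V (e j)) ∘ₗ LinearMap.mulRight ℂ (groupAlgebraHom V (e i)))

/-- An algebra homomorphism `ℂQ_Γ → Λ(Γ)` from the path algebra of the McKay quiver to the basic
algebra, sending the trivial path at `i` to `e_i` and the arrows from `i` to `j` bijectively to a
basis of `e_j (V * Γ) e_i`. -/
structure ArrowRealization where
  toHom : PathAlgebra (McKayQuiver V e) →ₙₐ[ℂ] basicAlgebra V e
  map_vertex : ∀ i : McKayQuiver V e,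
    (toHom (PathAlgebra.vertex i) : SkewExterior V Γ) = groupAlgebraHom V (e i)
  linearIndependent : ∀ i j : McKayQuiver V e, LinearIndependent ℂ
    fun α : i ⟶ j => (toHom (PathAlgebra.arrow α) : SkewExterior V Γ)
  span_eq : ∀ i j : McKayQuiver V e, Submodule.span ℂ
    (Set.range fun α : i ⟶ j => (toHom (PathAlgebra.arrow α) : SkewExterior V Γ)) =
      arrowSpace V e i j

variable {V e} in
/-- `ρ` is a set of quadratic relations (each one in some `e_j ℂQ_Γ e_i`) presenting the basic
algebra: `ℂQ_Γ → Λ(Γ)` is surjective with kernel the two-sided ideal `(ρ)`, so that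
`Λ(Γ) ≅ ℂQ_Γ / (ρ)`. As arrows are realized in `V * Γ`, these are the quadratic relations between
arrows that hold in `⋀V * Γ` because of `v w + w v = 0`. -/
structure ArrowRealization.IsPresentedBy (φ : ArrowRealization V e)
    (ρ : Set (PathAlgebra (McKayQuiver V e))) : Prop where
  surjective : Function.Surjective φ.toHom
  quadratic : ∀ x ∈ ρ, x.IsUniform ∧ x.IsQuadratic
  ker_eq : ∀ x, φ.toHom x = 0 ↔ x ∈ TwoSidedIdeal.span ρ

end McKay

/-! ### The covering map given by restriction to a subgroup -/

section Restriction

variable {V : Type*} [AddCommGroup V] [Module ℂ V]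
variable {Γ : Type*} [Group Γ] [DistribMulAction Γ V] [SMulCommClass Γ ℂ V]

/-- The inclusion `⋀V * N → ⋀V * Γ` for a subgroup `N` of `Γ`. -/
def skewInclusion (N : Subgroup Γ) : SkewExterior V N →+* SkewExterior V Γ :=
  SkewMonoidAlgebra.mapDomainRingHom (f := N.subtype) fun _ _ => rfl

variable {I J : Type*} [Fintype I] [Fintype J]
variable {N : Subgroup Γ} {e : I → MonoidAlgebra ℂ Γ} {f : J → MonoidAlgebra ℂ N}

/-- The morphism of quivers `π : Q_Γ → Q_N` is given by restriction of representations from `Γ` to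
`N`. There are isomorphisms of representations of `N`, `ℂN f_{π a} → ℂΓ e_a`, `x ↦ x u_a`, for all
vertices `a` of `Q_Γ`; and under these identifications an arrow `α : a ⟶ b` and the arrow `π α` are
the same map: right multiplication by (the element of `V * Γ` realizing) `α` is a map
`ℂΓ e_b → (V * Γ) e_a` of representations of `Γ`, right multiplication by `π α` is a map
`ℂN f_{π b} → (V * N) f_{π a}` of representations of `N`, and the square formed with `u_b` and `u_a`
commutes. -/
def IsRestrictionMap (φ : ArrowRealization V e) (ψ : ArrowRealization V f)
    (π : McKayQuiver V e ⥤q McKayQuiver V f) : Prop :=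
  ∃ u : McKayQuiver V e → MonoidAlgebra ℂ Γ,
    (∀ a, MonoidAlgebra.mapDomainRingHom ℂ N.subtype (f (π.obj a)) * u a = u a) ∧
    (∀ a, Set.BijOn (fun x => MonoidAlgebra.mapDomainRingHom ℂ N.subtype x * u a)
      (Submodule.span (MonoidAlgebra ℂ N) {f (π.obj a)} : Set (MonoidAlgebra ℂ N))
      (Submodule.span (MonoidAlgebra ℂ Γ) {e a} : Set (MonoidAlgebra ℂ Γ))) ∧
    ∀ (a b : McKayQuiver V e) (α : a ⟶ b),
      skewInclusion N (ψ.toHom (PathAlgebra.arrow (π.map α)) : SkewExterior V N) *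
          groupAlgebraHom V (u a) =
        groupAlgebraHom V (u b) * (φ.toHom (PathAlgebra.arrow α) : SkewExterior V Γ)

end Restriction

/-- The subgroup `N = G ∩ SL(V)` of a subgroup `G` of `GL(V)`. -/
def specialSubgroup {V : Type*} [AddCommGroup V] [Module ℂ V] (G : Subgroup (V ≃ₗ[ℂ] V)) :
    Subgroup G :=
  (LinearEquiv.det.comp G.subtype).ker

instance {V : Type*} [AddCommGroup V] [Module ℂ V] (G : Subgroup (V ≃ₗ[ℂ] V)) :
    (specialSubgroup G).Normal :=
  MonoidHom.normal_ker _

end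

/-! Write `N` for the special subgroup. The determinant embeds `G ⧸ N` in `ℂˣ`, so this finite group
is abelian, its characters separate its elements, and it is isomorphic to its dual group. A
character `χ` of `G ⧸ N` acts on `ℂG` and on `⋀V * G` by the automorphisms `twist χ` and `skewTwist
χ`, which scale `g` by `χ g` and fix everything supported on `N`. All isomorphisms `S_j ≅ S_a|_N`
are right multiplications by elements `u_a = f_j u_a e_a` of `ℂG` (`IsRestriction`).

Vertices: the sum of all twists is a multiple of the projection `ℂG → ℂN`. If `S_j` extends to `G`,
it follows that each irreducible representation of `G` containing `S_j` over `N` is a twist of the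
extension (`IsRestriction.exists_twist`). Hence all `S_a` restrict irreducibly, and the fibres of
restriction are torsors under the dual group of `G ⧸ N`.

Arrows: by Frobenius reciprocity `Hom_N(S_j, V ⊗ S_{π a})` is the direct sum of the `Hom_G(S_b, V ⊗
S_a)` over the `b` above `j`; in the group algebra this is the fact that `f_j` is a sum of elements
`u_b t` (`subgroupHom_mem_span`). So `π` is bijective on the arrows leaving a vertex. Twisting
carries arrows to arrows over the same arrow, which makes the dual group a group of deck
transformations and gives bijectivity on incoming arrows. Compatible realizations exist because the
arrow spaces of `N` have bases adapted to these decompositions, and twisting shows that one basis is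
adapted for every `a` in a fibre.

Relations: `Λ(Γ)` is quadratic for every finite `Γ` (`ArrowRealization.mem_span_of_val_eq_zero`).
Multiplying the identities for arrows gives `ψ(π x) u_a = u_c φ(x)` for every combination `x` of
paths from `a` to `c`, so `x` is a relation for `G` exactly when `π x` is one for `N`
(`val_map_eq_zero_iff`). Splitting the lift of a relation of `N` by end points therefore gives
relations again, which yields a suitable `ρ_N`. The set of all lifts of `ρ_N` generates the
relations of `G`, because liftings are multiplicative up to a change of section
(`lift_mem_of_mem_span`). -/

noncomputable section

/-! ### Basic systems of idempotents: Schur's lemma and semisimplicity of the group algebra. -/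

section GroupAlgebra

variable {Γ : Type*} [Group Γ]

theorem leftIdealRep_apply_coe (a : MonoidAlgebra ℂ Γ) (g : Γ)
    (x : Submodule.span (MonoidAlgebra ℂ Γ) {a}) :
    ((leftIdealRep a g x : Submodule.span (MonoidAlgebra ℂ Γ) {a}) : MonoidAlgebra ℂ Γ) =
      MonoidAlgebra.single g 1 * (x : MonoidAlgebra ℂ Γ) := rfl

theorem mem_span_idempotent_iff {R : Type*} [Ring R] {a : R} (ha : IsIdempotentElem a) {x : R} :
    x ∈ Submodule.span R {a} ↔ x * a = x := by
  rw [Submodule.mem_span_singleton]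
  constructor
  · rintro ⟨y, rfl⟩
    rw [smul_eq_mul, mul_assoc, ha.eq]
  · intro h
    exact ⟨x, h⟩

/-- A simple module over a group algebra as an irreducible representation on some `ℂ ^ n`. -/
theorem exists_irreducible_equiv_ofModule' (L : Type*) [AddCommGroup L] [Module ℂ L]
    [Module (MonoidAlgebra ℂ Γ) L] [IsScalarTower ℂ (MonoidAlgebra ℂ Γ) L]
    [FiniteDimensional ℂ L] [IsSimpleModule (MonoidAlgebra ℂ Γ) L] :
    ∃ (n : ℕ) (ρ : Representation ℂ Γ (Fin n → ℂ)), ρ.IsIrreducible ∧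
      Nonempty (ρ.Equiv (Representation.ofModule' (k := ℂ) (G := Γ) L)) := by
  let b := (Module.finBasis ℂ L).equivFun
  let ρ : Representation ℂ Γ (Fin (Module.finrank ℂ L) → ℂ) :=
    { toFun := fun g => b.toLinearMap ∘ₗ Representation.ofModule' (k := ℂ) L g ∘ₗ b.symm.toLinearMap
      map_one' := by ext; simp
      map_mul' := fun g h => by
        refine LinearMap.ext fun x => ?_
        simp [map_mul] }
  have hρ : ∀ g x, ρ g x = b (Representation.ofModule' (k := ℂ) L g (b.symm x)) := fun _ _ => rfl
  have e : ρ.Equiv (Representation.ofModule' (k := ℂ) (G := Γ) L) :=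
    .mk b.symm fun g => by ext x; simp [hρ]
  refine ⟨_, ρ, ?_, ⟨e⟩⟩
  rw [Representation.irreducible_iff_isSimpleModule_asModule]
  let E : ρ.asModule ≃ₗ[MonoidAlgebra ℂ Γ] L :=
    { (ρ.asModuleEquiv.toAddEquiv.trans b.symm.toAddEquiv) with
      map_smul' := fun r x => by
        change b.symm (ρ.asAlgebraHom r (ρ.asModuleEquiv x)) = r • b.symm (ρ.asModuleEquiv x)
        generalize ρ.asModuleEquiv x = y
        induction r using MonoidAlgebra.induction_linear with
        | zero => simp
        | add r s hr hs => simp only [map_add, LinearMap.add_apply, hr, hs, add_smul]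
        | single g c =>
          have h : (MonoidAlgebra.single g c : MonoidAlgebra ℂ Γ) = c • MonoidAlgebra.single g 1 := by
            simp
          rw [Representation.asAlgebraHom_single, LinearMap.smul_apply, map_smul, hρ,
            LinearEquiv.symm_apply_apply, h, smul_assoc]
          rfl }
  exact IsSimpleModule.congr E

end GroupAlgebra

namespace IsBasicSystem

variable {Γ : Type*} [Group Γ] {I : Type*} {e : I → MonoidAlgebra ℂ Γ}

theorem idem (he : IsBasicSystem e) (i : I) : e i * e i = e i := (he.orthogonal.idem i).eq

theorem ne_zero (he : IsBasicSystem e) (i : I) : e i ≠ 0 := by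
  intro h
  have hn := (he.irreducible i).toNontrivial
  obtain ⟨x, y, hxy⟩ := hn
  apply hxy
  have hs : Subsingleton (Submodule.span (MonoidAlgebra ℂ Γ) {e i}) := by
    rw [h, Submodule.span_zero_singleton]
    infer_instance
  ext z
  have hz : z = 0 := Subsingleton.elim _ _
  rw [hz]
  exact ⟨fun _ => y.toSubmodule.zero_mem, fun _ => x.toSubmodule.zero_mem⟩

/-- The left ideal `ℂΓ e_i` is generated by each of its nonzero elements. -/
theorem exists_mul_eq (he : IsBasicSystem e) {i : I} {y : MonoidAlgebra ℂ Γ} (hy : y * e i = y)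
    (hy0 : y ≠ 0) : ∃ z, z * y = e i := by
  have := he.irreducible i
  let S : Subrepresentation (leftIdealRep (e i)) :=
    { toSubmodule := ((Submodule.span (MonoidAlgebra ℂ Γ) {y}).comap
        (Submodule.span (MonoidAlgebra ℂ Γ) {e i}).subtype).restrictScalars ℂ
      apply_mem_toSubmodule := fun g v hv => by
        simp only [Submodule.restrictScalars_mem, Submodule.mem_comap, Submodule.subtype_apply,
          leftIdealRep_apply_coe] at hv ⊢
        exact Submodule.smul_mem _ _ hv }
  have hS : S = ⊤ := by
    refine (eq_bot_or_eq_top S).resolve_left fun h => hy0 ?_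
    have hm : (⟨y, (mem_span_idempotent_iff (he.idem i)).2 hy⟩ :
        Submodule.span (MonoidAlgebra ℂ Γ) {e i}) ∈ S.toSubmodule :=
      Submodule.mem_span_singleton_self y
    rw [h] at hm
    exact congrArg Subtype.val ((Submodule.mem_bot ℂ).1 hm)
  have hm : (⟨e i, Submodule.mem_span_singleton_self _⟩ :
      Submodule.span (MonoidAlgebra ℂ Γ) {e i}) ∈ S.toSubmodule := by
    rw [hS]; exact Submodule.mem_top
  exact Submodule.mem_span_singleton.1 hm

theorem isSimpleModule (he : IsBasicSystem e) (i : I) :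
    IsSimpleModule (MonoidAlgebra ℂ Γ) (Submodule.span (MonoidAlgebra ℂ Γ) {e i}) := by
  rw [isSimpleModule_iff_toSpanSingleton_surjective]
  refine ⟨⟨⟨⟨e i, Submodule.mem_span_singleton_self _⟩, 0, fun h =>
    he.ne_zero i (congrArg Subtype.val h)⟩⟩, ?_⟩
  rintro ⟨y, hy⟩ hy0 ⟨x, hx⟩
  obtain ⟨z, hz⟩ := he.exists_mul_eq ((mem_span_idempotent_iff (he.idem i)).1 hy)
    fun h => hy0 (Subtype.ext h)
  refine ⟨x * z, Subtype.ext ?_⟩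
  change x * z * y = x
  rw [mul_assoc, hz, (mem_span_idempotent_iff (he.idem i)).1 hx]

/-- Schur's lemma for non-isomorphic irreducible representations. -/
theorem mul_mul_eq_zero (he : IsBasicSystem e) {i j : I} (hij : i ≠ j) (x : MonoidAlgebra ℂ Γ) :
    e i * x * e j = 0 := by
  by_contra hy
  apply hij
  apply he.eq_of_equiv
  have hyj : e i * x * e j * e j = e i * x * e j := by rw [mul_assoc, he.idem]
  obtain ⟨z, hz⟩ := he.exists_mul_eq hyj hy
  let F : Submodule.span (MonoidAlgebra ℂ Γ) {e i} →ₗ[ℂ] Submodule.span (MonoidAlgebra ℂ Γ) {e j} :=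
    { toFun := fun w => ⟨(w : MonoidAlgebra ℂ Γ) * (e i * x * e j),
        (mem_span_idempotent_iff (he.idem j)).2 (by rw [mul_assoc, hyj])⟩
      map_add' := fun v w => Subtype.ext (add_mul _ _ _)
      map_smul' := fun c w => Subtype.ext (smul_mul_assoc _ _ _) }
  have hF : ∀ w, (F w : MonoidAlgebra ℂ Γ) = w * (e i * x * e j) := fun _ => rfl
  have hinj : Function.Injective F := by
    rw [injective_iff_map_eq_zero]
    rintro ⟨w, hw⟩ h0
    by_contra hw0
    obtain ⟨v, hv⟩ := he.exists_mul_eq ((mem_span_idempotent_iff (he.idem i)).1 hw)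
      fun h => hw0 (Subtype.ext h)
    apply hy
    have h1 : w * (e i * x * e j) = 0 := congrArg Subtype.val h0
    calc e i * x * e j = e i * (e i * x * e j) := by simp only [← mul_assoc, he.idem]
      _ = v * (w * (e i * x * e j)) := by rw [← hv, mul_assoc]
      _ = 0 := by rw [h1, mul_zero]
  have hsurj : Function.Surjective F := by
    rintro ⟨w, hw⟩
    refine ⟨⟨w * z * e i, (mem_span_idempotent_iff (he.idem i)).2
      (by rw [mul_assoc, he.idem])⟩, Subtype.ext ?_⟩
    rw [hF]
    calc w * z * e i * (e i * x * e j) = w * (z * (e i * e i * x * e j)) := by simp only [mul_assoc]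
      _ = w := by rw [he.idem, hz, (mem_span_idempotent_iff (he.idem j)).1 hw]
  exact ⟨.mk (LinearEquiv.ofBijective F ⟨hinj, hsurj⟩) fun g => by
    refine LinearMap.ext fun w => Subtype.ext ?_
    change MonoidAlgebra.single g 1 * (w : MonoidAlgebra ℂ Γ) * (e i * x * e j) =
      MonoidAlgebra.single g 1 * ((w : MonoidAlgebra ℂ Γ) * (e i * x * e j))
    rw [mul_assoc]⟩

/-- Schur's lemma for endomorphisms. -/
theorem exists_mul_mul_eq_smul [Finite Γ] (he : IsBasicSystem e) (i : I) (x : MonoidAlgebra ℂ Γ) :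
    ∃ c : ℂ, e i * x * e i = c • e i := by
  have hfin : FiniteDimensional ℂ (MonoidAlgebra ℂ Γ) := inferInstance
  have hfi : FiniteDimensional ℂ (Submodule.span (MonoidAlgebra ℂ Γ) {e i}) :=
    inferInstanceAs (FiniteDimensional ℂ
      ((Submodule.span (MonoidAlgebra ℂ Γ) {e i}).restrictScalars ℂ))
  have hnt : Nontrivial (Submodule.span (MonoidAlgebra ℂ Γ) {e i}) :=
    ⟨⟨e i, Submodule.mem_span_singleton_self _⟩, 0, fun h =>
      he.ne_zero i (congrArg Subtype.val h)⟩
  let F : Module.End ℂ (Submodule.span (MonoidAlgebra ℂ Γ) {e i}) :=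
    { toFun := fun w => ⟨(w : MonoidAlgebra ℂ Γ) * (e i * x * e i),
        (mem_span_idempotent_iff (he.idem i)).2 (by simp only [mul_assoc, he.idem])⟩
      map_add' := fun v w => Subtype.ext (add_mul _ _ _)
      map_smul' := fun c w => Subtype.ext (smul_mul_assoc _ _ _) }
  -- `F` commutes with left multiplication, and any eigenvector `w` generates `ℂΓ e_i`, so the
  -- eigenvalue equation for `w` carries over to `e i`.
  obtain ⟨c, hc⟩ := Module.End.exists_eigenvalue F
  obtain ⟨⟨w, hw⟩, hw1, hw0⟩ := hc.exists_hasEigenvector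
  refine ⟨c, ?_⟩
  have hwc : w * (e i * x * e i) = c • w := congrArg Subtype.val (Module.End.mem_eigenspace_iff.1 hw1)
  obtain ⟨z, hz⟩ := he.exists_mul_eq ((mem_span_idempotent_iff (he.idem i)).1 hw)
    fun h => hw0 (Subtype.ext h)
  calc e i * x * e i = e i * (e i * x * e i) := by simp only [← mul_assoc, he.idem]
    _ = z * (w * (e i * x * e i)) := by rw [← hz, mul_assoc]
    _ = c • e i := by rw [hwc, mul_smul_comm, hz]

/-- The idempotents `e_i` generate `ℂΓ` as a two-sided ideal. -/
theorem one_mem_span [Finite Γ] (he : IsBasicSystem e) :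
    (1 : MonoidAlgebra ℂ Γ) ∈ Submodule.span ℂ {x | ∃ i s t, x = s * e i * t} := by
  let J : Submodule (MonoidAlgebra ℂ Γ) (MonoidAlgebra ℂ Γ) :=
    { Submodule.span ℂ {x : MonoidAlgebra ℂ Γ | ∃ i s t, x = s * e i * t} with
      smul_mem' := fun r x hx => by
        change r * x ∈ Submodule.span ℂ _
        refine Submodule.span_induction ?_ ?_ ?_ ?_ (show x ∈ Submodule.span ℂ _ from hx)
        · rintro _ ⟨i, s, t, rfl⟩
          exact Submodule.subset_span ⟨i, r * s, t, by simp only [mul_assoc]⟩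
        · simp
        · intro a b _ _ ha hb
          rw [mul_add]; exact add_mem ha hb
        · intro c a _ ha
          rw [mul_smul_comm]; exact Submodule.smul_mem _ _ ha }
  suffices h : J = ⊤ by
    have : (1 : MonoidAlgebra ℂ Γ) ∈ J := by rw [h]; trivial
    exact this
  -- Maschke's theorem: `ℂΓ` is the sum of its simple left ideals, so it is enough to treat the
  -- elements of one of these.
  have : NeZero (Nat.card Γ : ℂ) := ⟨Nat.cast_ne_zero.2 Nat.card_pos.ne'⟩
  rw [eq_top_iff, ← IsSemisimpleModule.sSup_simples_eq_top (MonoidAlgebra ℂ Γ) (MonoidAlgebra ℂ Γ)]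
  refine sSup_le fun L hL x hx => ?_
  have hL' : IsSimpleModule (MonoidAlgebra ℂ Γ) L := hL
  have hfin : FiniteDimensional ℂ (MonoidAlgebra ℂ Γ) := inferInstance
  have hfi : FiniteDimensional ℂ L := inferInstanceAs (FiniteDimensional ℂ (L.restrictScalars ℂ))
  obtain ⟨n, ρ, hρ, ⟨E⟩⟩ := exists_irreducible_equiv_ofModule' (Γ := Γ) L
  obtain ⟨i, ⟨E'⟩⟩ := he.complete n ρ hρ
  let F := E.symm.trans E'
  have hF : ∀ (r : MonoidAlgebra ℂ Γ) y, ((F.symm (r • y) : L) : MonoidAlgebra ℂ Γ) =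
      r * (F.symm y : L) := by
    intro r y
    induction r using MonoidAlgebra.induction_linear with
    | zero => simp
    | add r s hr hs => simp only [map_add, add_smul, Submodule.coe_add, hr, hs, add_mul]
    | single g c =>
      have h : (MonoidAlgebra.single g c : MonoidAlgebra ℂ Γ) = c • MonoidAlgebra.single g 1 := by
        simp
      have h2 := F.symm.toIntertwiningMap.isIntertwining _ _ g y
      rw [h, smul_assoc, map_smul, smul_mul_assoc]
      exact congrArg (fun z : L => c • (z : MonoidAlgebra ℂ Γ)) h2
  -- With `y` the preimage of `e i`, linearity gives `x = (F x) y` and `y = e i * y`, so that `x =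
  -- (F x) * e i * y`.
  have hx1 : F ⟨x, hx⟩ = (F ⟨x, hx⟩ : MonoidAlgebra ℂ Γ) •
      (⟨e i, Submodule.mem_span_singleton_self _⟩ : Submodule.span (MonoidAlgebra ℂ Γ) {e i}) :=
    Subtype.ext ((mem_span_idempotent_iff (he.idem i)).1 (F ⟨x, hx⟩).2).symm
  have hx2 := congrArg (fun z => (F.symm z : MonoidAlgebra ℂ Γ)) hx1
  simp only [Representation.Equiv.symm_apply_apply, hF] at hx2
  have hy := hF (e i) ⟨e i, Submodule.mem_span_singleton_self _⟩
  rw [show e i • (⟨e i, Submodule.mem_span_singleton_self _⟩ :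
    Submodule.span (MonoidAlgebra ℂ Γ) {e i}) = ⟨e i, Submodule.mem_span_singleton_self _⟩ from
    Subtype.ext (he.idem i)] at hy
  rw [hy, ← mul_assoc] at hx2
  exact Submodule.subset_span ⟨i, _, _, hx2⟩

/-- `1 = ∑ s_m t_m` with `s_m ∈ ℂΓ e_i` and `t_m ∈ e_i ℂΓ`, where `i` depends on `m`. -/
theorem exists_one_eq_sum [Finite Γ] (he : IsBasicSystem e) :
    ∃ (n : ℕ) (l : Fin n → I) (s t : Fin n → MonoidAlgebra ℂ Γ),
      (∀ m, s m * e (l m) = s m) ∧ (∀ m, e (l m) * t m = t m) ∧ 1 = ∑ m, s m * t m := by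
  obtain ⟨n, c, g, h⟩ := Submodule.mem_span_set'.1 he.one_mem_span
  choose l s t hst using fun m => (g m).2
  refine ⟨n, l, fun m => c m • (s m * e (l m)), fun m => e (l m) * t m, fun m => ?_, fun m => ?_, ?_⟩
  · rw [smul_mul_assoc, mul_assoc, he.idem]
  · rw [← mul_assoc, he.idem]
  · rw [← h]
    refine Finset.sum_congr rfl fun m _ => ?_
    rw [hst, smul_mul_assoc, ← mul_assoc (s m * _), mul_assoc (s m) (e _) (e _), he.idem]

end IsBasicSystem
end

/-! ### Path algebras: gradings, local units, ideals. -/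

noncomputable section

namespace PathAlgebra

variable {Q Q' : Type*} [Quiver Q] [Quiver Q']

theorem smul_mul (c : ℂ) (x y : PathAlgebra Q) : c • x * y = c • (x * y) := by
  simp only [mul_def, map_smul, LinearMap.smul_apply]

theorem mul_smul (c : ℂ) (x y : PathAlgebra Q) : x * c • y = c • (x * y) := by
  simp only [mul_def, map_smul]

instance : SMulCommClass ℂ (PathAlgebra Q) (PathAlgebra Q) := ⟨fun c x y => (mul_smul c x y).symm⟩

theorem ofPath_mul_of_eq {p q : QuiverPath Q} (h : p.src = q.tgt) :
    ofPath p * ofPath q = ofPath (p.after q h) := by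
  rw [ofPath_mul_ofPath, pathMul, dif_pos h]

theorem ofPath_mul_of_ne {p q : QuiverPath Q} (h : p.src ≠ q.tgt) : ofPath p * ofPath q = 0 := by
  rw [ofPath_mul_ofPath, pathMul, dif_neg h]

theorem ofPath_mul_comp {a b c : Q} (q : Quiver.Path b c) (p : Quiver.Path a b) :
    ofPath ⟨b, c, q⟩ * ofPath ⟨a, b, p⟩ = ofPath ⟨a, c, p.comp q⟩ :=
  ofPath_mul_of_eq rfl

theorem ofPath_cons {a b c : Q} (p : Quiver.Path a b) (α : b ⟶ c) :
    ofPath ⟨a, c, p.cons α⟩ = arrow α * ofPath ⟨a, b, p⟩ :=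
  (ofPath_mul_comp α.toPath p).symm

theorem vertex_mul_ofPath (p : QuiverPath Q) : vertex p.tgt * ofPath p = ofPath p :=
  ofPath_mul_comp Quiver.Path.nil p.path

theorem ofPath_mul_vertex (p : QuiverPath Q) : ofPath p * vertex p.src = ofPath p :=
  (ofPath_mul_comp p.path Quiver.Path.nil).trans (by rw [Quiver.Path.nil_comp])

theorem vertex_mul_ofPath_of_ne {p : QuiverPath Q} {j : Q} (h : p.tgt ≠ j) :
    vertex j * ofPath p = 0 :=
  ofPath_mul_of_ne (Ne.symm h)

theorem ofPath_mul_vertex_of_ne {p : QuiverPath Q} {i : Q} (h : p.src ≠ i) :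
    ofPath p * vertex i = 0 :=
  ofPath_mul_of_ne h

/-- The span of the paths with a given property. -/
def pathSpace (P : QuiverPath Q → Prop) : Submodule ℂ (PathAlgebra Q) :=
  (Finsupp.supported ℂ ℂ {p | P p} : Submodule ℂ (QuiverPath Q →₀ ℂ))

theorem mem_pathSpace {P : QuiverPath Q → Prop} {x : PathAlgebra Q} :
    x ∈ pathSpace P ↔ ∀ p ∈ x.support, P p := Iff.rfl

theorem ofPath_mem_pathSpace {P : QuiverPath Q → Prop} {p : QuiverPath Q} (h : P p) :
    ofPath p ∈ pathSpace P :=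
  Finsupp.single_mem_supported ℂ (1 : ℂ) h

theorem pathSpace_eq_span (P : QuiverPath Q → Prop) :
    pathSpace P = Submodule.span ℂ (ofPath '' {p | P p}) :=
  Finsupp.supported_eq_span_single ℂ _

theorem pathSpace_induction {P : QuiverPath Q → Prop} {C : PathAlgebra Q → Prop}
    {x : PathAlgebra Q} (hx : x ∈ pathSpace P) (zero : C 0) (add : ∀ x y, C x → C y → C (x + y))
    (path : ∀ (c : ℂ) p, P p → C (c • ofPath p)) : C x := by
  rw [pathSpace_eq_span] at hx
  induction hx using Submodule.closure_induction with
  | zero => exact zero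
  | add x y _ _ hx hy => exact add x y hx hy
  | smul_mem c x hx =>
    obtain ⟨p, hp, rfl⟩ := hx
    exact path c p hp

theorem mul_mem_pathSpace {P P' P'' : QuiverPath Q → Prop}
    (h : ∀ p q, P p → P' q → ∀ h : p.src = q.tgt, P'' (p.after q h)) {x y : PathAlgebra Q}
    (hx : x ∈ pathSpace P) (hy : y ∈ pathSpace P') : x * y ∈ pathSpace P'' := by
  refine pathSpace_induction (C := fun x => x * y ∈ pathSpace P'') hx ?_ ?_ ?_
  · rw [zero_mul]; exact zero_mem _
  · intro a b ha hb
    rw [add_mul]; exact add_mem ha hb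
  intro c p hp
  rw [smul_mul]
  refine Submodule.smul_mem _ _ ?_
  refine pathSpace_induction (C := fun y => ofPath p * y ∈ pathSpace P'') hy ?_ ?_ ?_
  · rw [mul_zero]; exact zero_mem _
  · intro a b ha hb
    rw [mul_add]; exact add_mem ha hb
  intro d q hq
  rw [mul_smul]
  refine Submodule.smul_mem _ _ ?_
  by_cases h' : p.src = q.tgt
  · rw [ofPath_mul_of_eq h']
    exact ofPath_mem_pathSpace (h p q hp hq h')
  · rw [ofPath_mul_of_ne h']; exact zero_mem _

/-- The paths of length `n` from `i` to `j`. -/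
def IsPathFrom (n : ℕ) (i j : Q) (p : QuiverPath Q) : Prop :=
  p.src = i ∧ p.tgt = j ∧ p.path.length = n

theorem mul_mem_isPathFrom {m n : ℕ} {i j k : Q} {x y : PathAlgebra Q}
    (hx : x ∈ pathSpace (IsPathFrom m j k)) (hy : y ∈ pathSpace (IsPathFrom n i j)) :
    x * y ∈ pathSpace (IsPathFrom (m + n) i k) := by
  refine mul_mem_pathSpace ?_ hx hy
  rintro ⟨a, b, p⟩ ⟨c, d, q⟩ ⟨h₁, h₂, h₃⟩ ⟨h₄, h₅, h₆⟩ h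
  dsimp only at h h₁ h₂ h₃ h₄ h₅ h₆
  subst h₁ h₂ h₄ h
  exact ⟨rfl, rfl, (Quiver.Path.length_comp _ _).trans (by
    rw [Quiver.Path.cast_rfl_rfl, add_comm]; exact congrArg₂ (· + ·) h₃ h₆)⟩

theorem isUniform_of_mem {n : ℕ} {i j : Q} {x : PathAlgebra Q}
    (hx : x ∈ pathSpace (IsPathFrom n i j)) : x.IsUniform :=
  ⟨i, j, fun _ hp => ⟨(hx hp).1, (hx hp).2.1⟩⟩

theorem isQuadratic_of_mem {i j : Q} {x : PathAlgebra Q}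
    (hx : x ∈ pathSpace (IsPathFrom 2 i j)) : x.IsQuadratic :=
  fun _ hp => (hx hp).2.2

theorem vertex_mem (i : Q) : vertex i ∈ pathSpace (IsPathFrom 0 i i) :=
  ofPath_mem_pathSpace ⟨rfl, rfl, rfl⟩

theorem arrow_mem {i j : Q} (α : i ⟶ j) : arrow α ∈ pathSpace (IsPathFrom 1 i j) :=
  ofPath_mem_pathSpace ⟨rfl, rfl, rfl⟩

theorem vertex_mul_of_mem {i j : Q} {x : PathAlgebra Q}
    (hx : x ∈ pathSpace fun p => p.src = i ∧ p.tgt = j) : vertex j * x = x := by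
  refine pathSpace_induction (C := fun x => vertex j * x = x) hx (mul_zero _) ?_ ?_
  · intro a b ha hb
    rw [mul_add, ha, hb]
  · rintro c p ⟨_, rfl⟩
    rw [mul_smul, vertex_mul_ofPath]

theorem mul_vertex_of_mem {i j : Q} {x : PathAlgebra Q}
    (hx : x ∈ pathSpace fun p => p.src = i ∧ p.tgt = j) : x * vertex i = x := by
  refine pathSpace_induction (C := fun x => x * vertex i = x) hx (zero_mul _) ?_ ?_
  · intro a b ha hb
    rw [add_mul, ha, hb]
  · rintro c p ⟨rfl, _⟩
    rw [smul_mul, ofPath_mul_vertex]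

theorem vertex_mul_mul_vertex_mem (i j : Q) (x : PathAlgebra Q) :
    vertex j * x * vertex i ∈ pathSpace fun p => p.src = i ∧ p.tgt = j := by
  have h1 : vertex j * x ∈ pathSpace fun p => p.tgt = j := by
    refine mul_mem_pathSpace (P' := fun _ => True) ?_ (vertex_mem j) fun _ _ => trivial
    rintro p q ⟨_, h, _⟩ _ _
    exact h
  refine mul_mem_pathSpace ?_ h1 (vertex_mem i)
  rintro p q h ⟨h', _⟩ _
  exact ⟨h', h⟩

theorem sum_vertex_mul [Fintype Q] (x : PathAlgebra Q) : ∑ j, vertex j * x = x := by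
  classical
  induction x using induction with
  | zero => simp
  | add x y hx hy => simp only [mul_add, Finset.sum_add_distrib, hx, hy]
  | path c p =>
    rw [Finset.sum_eq_single p.tgt]
    · rw [mul_smul, vertex_mul_ofPath]
    · intro j _ hj
      rw [mul_smul, vertex_mul_ofPath_of_ne hj.symm, smul_zero]
    · simp

theorem sum_mul_vertex [Fintype Q] (x : PathAlgebra Q) : ∑ i, x * vertex i = x := by
  classical
  induction x using induction with
  | zero => simp
  | add x y hx hy => simp only [add_mul, Finset.sum_add_distrib, hx, hy]
  | path c p =>
    rw [Finset.sum_eq_single p.src]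
    · rw [smul_mul, ofPath_mul_vertex]
    · intro j _ hj
      rw [smul_mul, ofPath_mul_vertex_of_ne hj.symm, smul_zero]
    · simp

theorem sum_vertex_mul_mul_vertex [Fintype Q] (x : PathAlgebra Q) :
    ∑ i, ∑ j, vertex j * x * vertex i = x := by
  simp only [← Finset.sum_mul, sum_mul_vertex]
  rw [Finset.sum_mul, sum_vertex_mul]

/-- An ideal of a non-unital ring need not be a subspace. Here it is one, since finitely many
vertices form a system of local units: `c • x = ∑ (c • e_j) x`. -/
theorem smul_mem_twoSidedIdeal [Fintype Q] (I : TwoSidedIdeal (PathAlgebra Q)) (c : ℂ)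
    {x : PathAlgebra Q} (hx : x ∈ I) : c • x ∈ I := by
  rw [← sum_vertex_mul x, Finset.smul_sum]
  refine sum_mem fun j _ => ?_
  rw [← smul_mul]
  exact I.mul_mem_left _ _ hx

/-- A two-sided ideal of the path algebra as a subspace. -/
def idealSubmodule [Fintype Q] (I : TwoSidedIdeal (PathAlgebra Q)) :
    Submodule ℂ (PathAlgebra Q) where
  carrier := {x | x ∈ I}
  zero_mem' := I.zero_mem
  add_mem' := I.add_mem
  smul_mem' c _ hx := smul_mem_twoSidedIdeal I c hx

/-- Left multiplication of `ℂQ` on `ℂQ / I`. -/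
def quotientAction [Fintype Q] (I : TwoSidedIdeal (PathAlgebra Q)) :
    PathAlgebra Q →ₙₐ[ℂ] Module.End ℂ (PathAlgebra Q ⧸ idealSubmodule I) where
  toFun x := (idealSubmodule I).mapQ (idealSubmodule I) (LinearMap.mulLeft ℂ x)
    fun _ hy => I.mul_mem_left _ _ hy
  map_smul' c x := by
    refine Submodule.linearMap_qext _ (LinearMap.ext fun y => ?_)
    exact congrArg Submodule.Quotient.mk (smul_mul c x y)
  map_zero' := by
    refine Submodule.linearMap_qext _ (LinearMap.ext fun y => ?_)
    exact congrArg Submodule.Quotient.mk (zero_mul y)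
  map_add' x y := by
    refine Submodule.linearMap_qext _ (LinearMap.ext fun z => ?_)
    exact congrArg Submodule.Quotient.mk (add_mul x y z)
  map_mul' x y := by
    refine Submodule.linearMap_qext _ (LinearMap.ext fun z => ?_)
    exact congrArg Submodule.Quotient.mk (mul_assoc x y z)

theorem quotientAction_mk [Fintype Q] (I : TwoSidedIdeal (PathAlgebra Q)) (x y : PathAlgebra Q) :
    quotientAction I x (Submodule.Quotient.mk y) = Submodule.Quotient.mk (x * y) := rfl

/-- The action on `ℂQ / I` detects `I`, although there is no unit to evaluate at: `x = ∑ x e_i`, and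
`x` acts on the class of `e_i` as `x e_i`. -/
theorem quotientAction_eq_zero_iff [Fintype Q] (I : TwoSidedIdeal (PathAlgebra Q))
    (x : PathAlgebra Q) : quotientAction I x = 0 ↔ x ∈ I := by
  constructor
  · intro h
    rw [← sum_mul_vertex x]
    refine sum_mem fun i _ => ?_
    have h1 := LinearMap.congr_fun h (Submodule.Quotient.mk (vertex i))
    rw [quotientAction_mk, LinearMap.zero_apply, Submodule.Quotient.mk_eq_zero] at h1
    exact h1
  · intro h
    refine Submodule.linearMap_qext _ (LinearMap.ext fun y => ?_)
    change Submodule.Quotient.mk (x * y) = 0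
    rw [Submodule.Quotient.mk_eq_zero]
    exact I.mul_mem_right _ _ h

end PathAlgebra
end

/-! ### The skew group algebra in degrees zero and one. -/

noncomputable section

set_option linter.unusedSectionVars false

section SkewBasics

variable (V : Type*) [AddCommGroup V] [Module ℂ V]
variable {Γ : Type*} [Group Γ] [DistribMulAction Γ V] [SMulCommClass Γ ℂ V]

variable (Γ) in
/-- The inclusion `V → ⋀V * Γ`. -/
def vecHom : V →ₗ[ℂ] SkewExterior V Γ :=
  SkewMonoidAlgebra.lsingle ℂ (1 : Γ) ∘ₗ ExteriorAlgebra.ι ℂ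

theorem vecHom_apply (v : V) :
    vecHom V Γ v = SkewMonoidAlgebra.single (1 : Γ) (ExteriorAlgebra.ι ℂ v) := rfl

theorem groupAlgebraHom_single (g : Γ) (c : ℂ) :
    groupAlgebraHom V (MonoidAlgebra.single g c) =
      SkewMonoidAlgebra.single g (algebraMap ℂ (ExteriorAlgebra ℂ V) c) := by
  rw [groupAlgebraHom, MonoidAlgebra.lift_single, SkewMonoidAlgebra.of_apply,
    SkewMonoidAlgebra.smul_single, Algebra.algebraMap_eq_smul_one]

theorem groupAlgebraHom_single_one (g : Γ) :
    groupAlgebraHom V (MonoidAlgebra.single g 1) = SkewMonoidAlgebra.single g 1 := by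
  rw [groupAlgebraHom_single, map_one]

theorem vecHom_mul_single (v : V) (g : Γ) :
    vecHom V Γ v * groupAlgebraHom V (MonoidAlgebra.single g 1) =
      SkewMonoidAlgebra.single g (ExteriorAlgebra.ι ℂ v) := by
  rw [vecHom_apply, groupAlgebraHom_single_one, SkewMonoidAlgebra.single_mul_single, one_mul,
    smul_one, mul_one]

theorem smul_ι (g : Γ) (v : V) :
    g • ExteriorAlgebra.ι ℂ v = ExteriorAlgebra.ι ℂ (g • v) := by
  rw [exteriorAction_def, ExteriorAlgebra.map_apply_ι]
  rfl

theorem single_mul_vecHom (g : Γ) (v : V) :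
    groupAlgebraHom V (MonoidAlgebra.single g 1) * vecHom V Γ v =
      vecHom V Γ (g • v) * groupAlgebraHom V (MonoidAlgebra.single g 1) := by
  rw [vecHom_mul_single, vecHom_apply, groupAlgebraHom_single_one,
    SkewMonoidAlgebra.single_mul_single, one_mul, mul_one, smul_ι]

theorem vecHom_mul_self (v : V) : vecHom V Γ v * vecHom V Γ v = 0 := by
  rw [vecHom_apply, SkewMonoidAlgebra.single_mul_single, one_smul, ExteriorAlgebra.ι_sq_zero,
    SkewMonoidAlgebra.single_zero]

/-- The projection of `⋀V` onto its scalars, applied to each coefficient, recovers the element of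
`ℂΓ`. -/
theorem groupAlgebraHom_injective : Function.Injective (groupAlgebraHom V (Γ := Γ)) := by
  rw [injective_iff_map_eq_zero]
  intro x hx
  have key : ∀ y : MonoidAlgebra ℂ Γ, ∀ g,
      ExteriorAlgebra.algebraMapInv ((groupAlgebraHom V y).coeff g) = y.coeff g := by
    intro y g
    induction y using MonoidAlgebra.induction_linear with
    | zero => simp
    | add a b ha hb => simp [ha, hb]
    | single k c =>
      classical
      rw [groupAlgebraHom_single, SkewMonoidAlgebra.coeff_single, MonoidAlgebra.coeff_single]
      simp only [Finsupp.single_apply]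
      split_ifs
      · exact ExteriorAlgebra.algebraMap_leftInverse V c
      · simp
  ext g
  rw [← key, hx]
  simp

/-- `⋀V * Γ` is generated by `V` and `ℂΓ`. -/
theorem SkewExterior.induction {C : SkewExterior V Γ → Prop}
    (group : ∀ x, C (groupAlgebraHom V x)) (vec : ∀ v, C (vecHom V Γ v))
    (add : ∀ x y, C x → C y → C (x + y)) (mul : ∀ x y, C x → C y → C (x * y))
    (x : SkewExterior V Γ) : C x := by
  have h1 : ∀ w : ExteriorAlgebra ℂ V, C (SkewMonoidAlgebra.single (1 : Γ) w) := by
    intro w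
    induction w using ExteriorAlgebra.induction with
    | algebraMap r => rw [← groupAlgebraHom_single]; exact group _
    | ι v => exact vec v
    | mul a b ha hb =>
      have := mul _ _ ha hb
      rwa [SkewMonoidAlgebra.single_mul_single, one_smul, one_mul] at this
    | add a b ha hb => rw [SkewMonoidAlgebra.single_add]; exact add _ _ ha hb
  induction x using SkewMonoidAlgebra.induction_on with
  | zero => simpa using group 0
  | single g w =>
    have := mul _ _ (h1 w) (group (MonoidAlgebra.single g 1))
    rwa [groupAlgebraHom_single_one, SkewMonoidAlgebra.single_mul_single, one_smul, one_mul,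
      mul_one] at this
  | add a b ha hb => exact add _ _ ha hb

variable {V}

theorem single_mul_mem_degreeOne (g : Γ) {x : SkewExterior V Γ} (hx : x ∈ degreeOne V Γ) :
    groupAlgebraHom V (MonoidAlgebra.single g 1) * x ∈ degreeOne V Γ := by
  induction hx using Submodule.span_induction with
  | mem x hx =>
    obtain ⟨k, v, rfl⟩ := hx
    refine Submodule.subset_span ⟨g * k, g • v, ?_⟩
    rw [groupAlgebraHom_single_one, SkewMonoidAlgebra.single_mul_single, one_mul, smul_ι]
  | zero => rw [mul_zero]; exact zero_mem _
  | add x y _ _ hx hy => rw [mul_add]; exact add_mem hx hy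
  | smul c x _ hx => rw [mul_smul_comm]; exact Submodule.smul_mem _ _ hx

theorem mul_single_mem_degreeOne (g : Γ) {x : SkewExterior V Γ} (hx : x ∈ degreeOne V Γ) :
    x * groupAlgebraHom V (MonoidAlgebra.single g 1) ∈ degreeOne V Γ := by
  induction hx using Submodule.span_induction with
  | mem x hx =>
    obtain ⟨k, v, rfl⟩ := hx
    refine Submodule.subset_span ⟨k * g, v, ?_⟩
    rw [groupAlgebraHom_single_one, SkewMonoidAlgebra.single_mul_single, smul_one, mul_one]
  | zero => rw [zero_mul]; exact zero_mem _
  | add x y _ _ hx hy => rw [add_mul]; exact add_mem hx hy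
  | smul c x _ hx => rw [smul_mul_assoc]; exact Submodule.smul_mem _ _ hx

theorem groupAlgebraHom_mul_mem_degreeOne (r : MonoidAlgebra ℂ Γ) {x : SkewExterior V Γ}
    (hx : x ∈ degreeOne V Γ) : groupAlgebraHom V r * x ∈ degreeOne V Γ := by
  induction r using MonoidAlgebra.induction_linear with
  | zero => rw [map_zero, zero_mul]; exact zero_mem _
  | add a b ha hb => rw [map_add, add_mul]; exact add_mem ha hb
  | single g c =>
    rw [show (MonoidAlgebra.single g c : MonoidAlgebra ℂ Γ) = c • MonoidAlgebra.single g 1 by simp,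
      map_smul, smul_mul_assoc]
    exact Submodule.smul_mem _ _ (single_mul_mem_degreeOne g hx)

theorem mul_groupAlgebraHom_mem_degreeOne (r : MonoidAlgebra ℂ Γ) {x : SkewExterior V Γ}
    (hx : x ∈ degreeOne V Γ) : x * groupAlgebraHom V r ∈ degreeOne V Γ := by
  induction r using MonoidAlgebra.induction_linear with
  | zero => rw [map_zero, mul_zero]; exact zero_mem _
  | add a b ha hb => rw [map_add, mul_add]; exact add_mem ha hb
  | single g c =>
    rw [show (MonoidAlgebra.single g c : MonoidAlgebra ℂ Γ) = c • MonoidAlgebra.single g 1 by simp,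
      map_smul, mul_smul_comm]
    exact Submodule.smul_mem _ _ (mul_single_mem_degreeOne g hx)

theorem vecHom_mem_degreeOne (v : V) : vecHom V Γ v ∈ degreeOne V Γ :=
  Submodule.subset_span ⟨1, v, rfl⟩

theorem degreeOne_induction {C : SkewExterior V Γ → Prop} {x : SkewExterior V Γ}
    (hx : x ∈ degreeOne V Γ) (zero : C 0) (add : ∀ x y, C x → C y → C (x + y))
    (vec : ∀ v r, C (vecHom V Γ v * groupAlgebraHom V r)) : C x := by
  induction hx using Submodule.closure_induction with
  | zero => exact zero
  | add x y _ _ hx hy => exact add x y hx hy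
  | smul_mem c x hx =>
    obtain ⟨k, v, rfl⟩ := hx
    rw [← vecHom_mul_single, ← mul_smul_comm, ← map_smul]
    exact vec _ _

end SkewBasics

section ArrowSpace

variable {V : Type*} [AddCommGroup V] [Module ℂ V]
variable {Γ : Type*} [Group Γ] [DistribMulAction Γ V] [SMulCommClass Γ ℂ V]
variable {I : Type*} {e : I → MonoidAlgebra ℂ Γ}

theorem mem_arrowSpace_iff (he : IsBasicSystem e) {i j : I} {x : SkewExterior V Γ} :
    x ∈ arrowSpace V e i j ↔ x ∈ degreeOne V Γ ∧ groupAlgebraHom V (e j) * x = x ∧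
      x * groupAlgebraHom V (e i) = x := by
  have hi : ∀ i, groupAlgebraHom V (e i) * groupAlgebraHom V (e i) = groupAlgebraHom V (e i) :=
    fun i => by rw [← map_mul, he.idem]
  constructor
  · rintro ⟨y, hy, rfl⟩
    refine ⟨?_, ?_, ?_⟩
    · exact groupAlgebraHom_mul_mem_degreeOne _ (mul_groupAlgebraHom_mem_degreeOne _ hy)
    · simp only [LinearMap.comp_apply, LinearMap.mulLeft_apply, LinearMap.mulRight_apply,
        ← mul_assoc, hi]
    · simp only [LinearMap.comp_apply, LinearMap.mulLeft_apply, LinearMap.mulRight_apply,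
        mul_assoc, hi]
  · rintro ⟨h, h1, h2⟩
    exact ⟨x, h, by
      simp only [LinearMap.comp_apply, LinearMap.mulLeft_apply, LinearMap.mulRight_apply, h2, h1]⟩

end ArrowSpace

namespace ArrowRealization

open PathAlgebra

variable {V : Type*} [AddCommGroup V] [Module ℂ V]
variable {Γ : Type*} [Group Γ] [DistribMulAction Γ V] [SMulCommClass Γ ℂ V]
variable {I : Type*} [Fintype I] {e : I → MonoidAlgebra ℂ Γ}

/-- A realization as a linear map to `⋀V * Γ`. -/
def val (φ : ArrowRealization V e) : PathAlgebra (McKayQuiver V e) →ₗ[ℂ] SkewExterior V Γ where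
  toFun x := φ.toHom x
  map_add' x y := by rw [map_add]; rfl
  map_smul' c x := by rw [map_smul]; rfl

theorem coe_toHom (φ : ArrowRealization V e) (x : PathAlgebra (McKayQuiver V e)) :
    (φ.toHom x : SkewExterior V Γ) = φ.val x := rfl

theorem val_eq_zero_iff (φ : ArrowRealization V e) (x : PathAlgebra (McKayQuiver V e)) :
    φ.val x = 0 ↔ φ.toHom x = 0 := by
  rw [← coe_toHom]; exact ZeroMemClass.coe_eq_zero

theorem val_mul (φ : ArrowRealization V e) (x y : PathAlgebra (McKayQuiver V e)) :
    φ.val (x * y) = φ.val x * φ.val y := by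
  rw [← coe_toHom, map_mul]; rfl

theorem val_vertex (φ : ArrowRealization V e) (i : McKayQuiver V e) :
    φ.val (vertex i) = groupAlgebraHom V (e i) := φ.map_vertex i

theorem val_arrow_mem (φ : ArrowRealization V e) {i j : McKayQuiver V e} (α : i ⟶ j) :
    φ.val (arrow α) ∈ arrowSpace V e i j := by
  rw [← φ.span_eq i j]
  exact Submodule.subset_span ⟨α, rfl⟩

theorem val_arrow_ne_zero (φ : ArrowRealization V e) {i j : McKayQuiver V e} (α : i ⟶ j) :
    φ.val (arrow α) ≠ 0 := (φ.linearIndependent i j).ne_zero α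

theorem vertex_mul_val (φ : ArrowRealization V e) {i j : McKayQuiver V e}
    {x : PathAlgebra (McKayQuiver V e)} (hx : x ∈ pathSpace fun p => p.src = i ∧ p.tgt = j) :
    groupAlgebraHom V (e j) * φ.val x = φ.val x := by
  rw [← φ.val_vertex, ← φ.val_mul, vertex_mul_of_mem hx]

theorem val_mul_vertex (φ : ArrowRealization V e) {i j : McKayQuiver V e}
    {x : PathAlgebra (McKayQuiver V e)} (hx : x ∈ pathSpace fun p => p.src = i ∧ p.tgt = j) :
    φ.val x * groupAlgebraHom V (e i) = φ.val x := by
  rw [← φ.val_vertex, ← φ.val_mul, mul_vertex_of_mem hx]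

/-- Induction over products of elements of `ℂΓ` and `V`. The factors `a` and `b` in `key` are needed
to cut a product: inserting `1 = ∑ s_m t_m` turns `e_j a x y b e_i` into a sum of products of
elements of the same shape. In degree zero the claim is Schur's lemma, in degree one it is
`span_eq`. -/
theorem surjective [Finite Γ] (he : IsBasicSystem e) (φ : ArrowRealization V e) :
    Function.Surjective φ.toHom := by
  obtain ⟨n, l, s, t, hs, ht, hst⟩ := he.exists_one_eq_sum
  have key : ∀ x : SkewExterior V Γ, ∀ i j : McKayQuiver V e, ∀ a b : MonoidAlgebra ℂ Γ,
      groupAlgebraHom V (e j * a) * x * groupAlgebraHom V (b * e i) ∈ LinearMap.range φ.val := by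
    intro x
    induction x using SkewExterior.induction with
    | group x =>
      intro i j a b
      rw [← map_mul, ← map_mul]
      by_cases hij : j = i
      · subst hij
        obtain ⟨c, hc⟩ := he.exists_mul_mul_eq_smul j (a * x * b)
        refine ⟨c • vertex j, ?_⟩
        rw [map_smul, φ.val_vertex, ← map_smul, ← hc]
        simp only [mul_assoc]
      · refine ⟨0, ?_⟩
        have := he.mul_mul_eq_zero hij (a * x * b)
        simp only [mul_assoc] at this ⊢
        rw [this, map_zero, map_zero]
    | vec v =>
      intro i j a b
      have hm : groupAlgebraHom V (e j * a) * vecHom V Γ v * groupAlgebraHom V (b * e i) ∈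
          arrowSpace V e i j := by
        refine (mem_arrowSpace_iff he).2 ⟨mul_groupAlgebraHom_mem_degreeOne _
          (groupAlgebraHom_mul_mem_degreeOne _ (vecHom_mem_degreeOne v)), ?_, ?_⟩
        · simp only [← mul_assoc, ← map_mul, he.idem j]
        · simp only [mul_assoc, ← map_mul, he.idem i]
      rw [← φ.span_eq i j] at hm
      refine Submodule.span_le.2 ?_ hm
      rintro _ ⟨α, rfl⟩
      exact ⟨arrow α, rfl⟩
    | add x y hx hy =>
      intro i j a b
      rw [mul_add, add_mul]
      exact add_mem (hx i j a b) (hy i j a b)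
    | mul x y hx hy =>
      intro i j a b
      have h1 : groupAlgebraHom V (e j * a) * (x * y) * groupAlgebraHom V (b * e i) =
          ∑ m, (groupAlgebraHom V (e j * a) * x * groupAlgebraHom V (s m * e (l m))) *
            (groupAlgebraHom V (e (l m) * t m) * y * groupAlgebraHom V (b * e i)) := by
        calc _ = groupAlgebraHom V (e j * a) * x * groupAlgebraHom V 1 *
              (y * groupAlgebraHom V (b * e i)) := by rw [map_one, mul_one]; simp only [mul_assoc]
          _ = _ := by
            rw [hst, map_sum, Finset.mul_sum, Finset.sum_mul]
            refine Finset.sum_congr rfl fun m _ => ?_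
            rw [hs, ht]; simp only [mul_assoc, map_mul]
      rw [h1]
      refine sum_mem fun m _ => ?_
      obtain ⟨p, hp⟩ := hx (l m) j a (s m)
      obtain ⟨q, hq⟩ := hy i (l m) (t m) b
      exact ⟨p * q, by rw [φ.val_mul, hp, hq]⟩
  rintro ⟨_, y, rfl⟩
  have h2 : groupAlgebraHom V (∑ i, e i) * y * groupAlgebraHom V (∑ i, e i) ∈
      LinearMap.range φ.val := by
    simp only [map_sum, Finset.sum_mul, Finset.mul_sum]
    refine sum_mem fun i _ => sum_mem fun j _ => ?_
    simpa using key y i j 1 1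
  obtain ⟨x, hx⟩ := h2
  exact ⟨x, Subtype.ext hx⟩

end ArrowRealization
end

/-! ### Quadraticity of the basic algebra. -/

noncomputable section

set_option linter.unusedSectionVars false

theorem LinearIndependent.exists_linearMap_apply_eq {K M M' ι : Type*} [Field K] [AddCommGroup M]
    [Module K M] [AddCommGroup M'] [Module K M'] {v : ι → M} (hv : LinearIndependent K v)
    (w : ι → M') : ∃ T : M →ₗ[K] M', ∀ i, T (v i) = w i := by
  obtain ⟨T, hT⟩ := LinearMap.exists_extend
    (Finsupp.linearCombination K w ∘ₗ (hv.repr : Submodule.span K (Set.range v) →ₗ[K] ι →₀ K))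
  refine ⟨T, fun i => ?_⟩
  have h := LinearMap.congr_fun hT ⟨v i, Submodule.subset_span ⟨i, rfl⟩⟩
  simp only [LinearMap.comp_apply, Submodule.subtype_apply] at h
  rw [h, hv.repr_eq_single i _ rfl, Finsupp.linearCombination_single, one_smul]

namespace PathAlgebra

variable {Q : Type*} [Quiver Q]

theorem eq_smul_vertex_of_mem {i j : Q} {x : PathAlgebra Q}
    (hx : x ∈ pathSpace (IsPathFrom 0 i j)) : ∃ c : ℂ, x = c • vertex i := by
  refine pathSpace_induction (C := fun x => ∃ c : ℂ, x = c • vertex i) hx ⟨0, by simp⟩ ?_ ?_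
  · rintro _ _ ⟨a, rfl⟩ ⟨b, rfl⟩
    exact ⟨a + b, (add_smul _ _ _).symm⟩
  · rintro c ⟨a, b, p⟩ ⟨rfl, h2, h⟩
    dsimp only at h
    obtain rfl := Quiver.Path.eq_of_length_zero p h
    obtain rfl := Quiver.Path.eq_nil_of_length_zero p h
    exact ⟨c, rfl⟩

theorem mem_span_arrow_of_mem {i j : Q} {x : PathAlgebra Q}
    (hx : x ∈ pathSpace (IsPathFrom 1 i j)) :
    x ∈ Submodule.span ℂ (Set.range fun α : i ⟶ j => arrow α) := by
  refine pathSpace_induction (C := fun x => x ∈ Submodule.span ℂ _) hx (zero_mem _)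
    (fun _ _ => add_mem) ?_
  rintro c ⟨a, b, p⟩ ⟨rfl, rfl, h⟩
  refine Submodule.smul_mem _ _ (Submodule.subset_span ?_)
  dsimp only at h
  cases p with
  | nil => simp at h
  | cons p α =>
    rw [Quiver.Path.length_cons, Nat.add_eq_right] at h
    obtain rfl := Quiver.Path.eq_of_length_zero p h
    obtain rfl := Quiver.Path.eq_nil_of_length_zero p h
    exact ⟨α, rfl⟩

end PathAlgebra

namespace ArrowRealization

open PathAlgebra

variable {V : Type*} [AddCommGroup V] [Module ℂ V]
variable {Γ : Type*} [Group Γ] [DistribMulAction Γ V] [SMulCommClass Γ ℂ V]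
variable {I : Type*} [Fintype I] {e : I → MonoidAlgebra ℂ Γ}

theorem eq_zero_of_val_eq_zero_zero (he : IsBasicSystem e) (φ : ArrowRealization V e)
    {i j : McKayQuiver V e} {x : PathAlgebra (McKayQuiver V e)}
    (hx : x ∈ pathSpace (IsPathFrom 0 i j)) (h : φ.val x = 0) : x = 0 := by
  obtain ⟨c, rfl⟩ := eq_smul_vertex_of_mem hx
  rw [map_smul, φ.val_vertex, smul_eq_zero] at h
  rcases h with rfl | h
  · rw [zero_smul]
  · rw [← map_zero (groupAlgebraHom V)] at h
    exact absurd (groupAlgebraHom_injective V h) (he.ne_zero i)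

theorem eq_zero_of_val_eq_zero_one (φ : ArrowRealization V e)
    {i j : McKayQuiver V e} {x : PathAlgebra (McKayQuiver V e)}
    (hx : x ∈ pathSpace (IsPathFrom 1 i j)) (h : φ.val x = 0) : x = 0 := by
  have : Fintype (i ⟶ j) := inferInstanceAs (Fintype (Fin _))
  obtain ⟨c, rfl⟩ := (Submodule.mem_span_range_iff_exists_fun ℂ).1 (mem_span_arrow_of_mem hx)
  rw [map_sum] at h
  simp only [map_smul] at h
  have h0 := Fintype.linearIndependent_iff.1 (φ.linearIndependent i j) c h
  simp [h0]

section Correspondence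

variable {D : Type*} [Ring D] [Algebra ℂ D]
variable (φ : ArrowRealization V e) (l : PathAlgebra (McKayQuiver V e) →ₙₐ[ℂ] D)

/-- `x` and `d` are the images of one and the same combination of paths of length `n`. -/
def Corresponds (n : ℕ) (i j : McKayQuiver V e) (x : SkewExterior V Γ) (d : D) : Prop :=
  ∃ y ∈ pathSpace (IsPathFrom n i j), φ.val y = x ∧ l y = d

variable {φ l}

theorem Corresponds.zero (n : ℕ) (i j : McKayQuiver V e) : Corresponds φ l n i j 0 0 :=
  ⟨0, zero_mem _, map_zero _, map_zero _⟩

theorem Corresponds.add {n : ℕ} {i j : McKayQuiver V e} {x x' : SkewExterior V Γ} {d d' : D}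
    (h : Corresponds φ l n i j x d) (h' : Corresponds φ l n i j x' d') :
    Corresponds φ l n i j (x + x') (d + d') := by
  obtain ⟨y, hy, rfl, rfl⟩ := h
  obtain ⟨y', hy', rfl, rfl⟩ := h'
  exact ⟨y + y', add_mem hy hy', map_add _ _ _, map_add _ _ _⟩

theorem Corresponds.smul {n : ℕ} {i j : McKayQuiver V e} {x : SkewExterior V Γ} {d : D} (c : ℂ)
    (h : Corresponds φ l n i j x d) : Corresponds φ l n i j (c • x) (c • d) := by
  obtain ⟨y, hy, rfl, rfl⟩ := h
  exact ⟨c • y, Submodule.smul_mem _ _ hy, map_smul _ _ _, map_smul _ _ _⟩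

theorem Corresponds.sum {ι : Type*} (s : Finset ι) {n : ℕ} {i j : McKayQuiver V e}
    {x : ι → SkewExterior V Γ} {d : ι → D} (h : ∀ m ∈ s, Corresponds φ l n i j (x m) (d m)) :
    Corresponds φ l n i j (∑ m ∈ s, x m) (∑ m ∈ s, d m) := by
  classical
  induction s using Finset.induction_on with
  | empty => exact .zero _ _ _
  | insert a s ha ih =>
    rw [Finset.sum_insert ha, Finset.sum_insert ha]
    exact (h a (Finset.mem_insert_self _ _)).add
      (ih fun m hm => h m (Finset.mem_insert_of_mem hm))

theorem Corresponds.mul {n n' : ℕ} {i j k : McKayQuiver V e} {x x' : SkewExterior V Γ} {d d' : D}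
    (h : Corresponds φ l n j k x d) (h' : Corresponds φ l n' i j x' d') :
    Corresponds φ l (n + n') i k (x * x') (d * d') := by
  obtain ⟨y, hy, rfl, rfl⟩ := h
  obtain ⟨y', hy', rfl, rfl⟩ := h'
  exact ⟨y * y', mul_mem_isPathFrom hy hy', φ.val_mul _ _, map_mul _ _ _⟩

/-- A realization is injective on combinations of paths of one length `≤ 1` with fixed ends, so
there the correspondence is single-valued. -/
theorem Corresponds.eq (he : IsBasicSystem e) {n : ℕ} (hn : n ≤ 1) {i j : McKayQuiver V e}
    {x : SkewExterior V Γ} {d d' : D}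
    (h : Corresponds φ l n i j x d) (h' : Corresponds φ l n i j x d') : d = d' := by
  obtain ⟨y, hy, rfl, rfl⟩ := h
  obtain ⟨y', hy', h0, rfl⟩ := h'
  have h1 : φ.val (y - y') = 0 := by rw [map_sub, h0, sub_self]
  have h2 : y - y' = 0 := by
    interval_cases n
    · exact φ.eq_zero_of_val_eq_zero_zero he (sub_mem hy hy') h1
    · exact φ.eq_zero_of_val_eq_zero_one (sub_mem hy hy') h1
  rw [sub_eq_zero.1 h2]

/-- In degree two the correspondence need not be single-valued for arbitrary `l`; the assumption on
quadratic relations says that at least `0` corresponds only to `0`. -/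
theorem Corresponds.eq_zero (hl : ∀ x, x.IsUniform → x.IsQuadratic → φ.val x = 0 → l x = 0)
    {i j : McKayQuiver V e} {d : D} (h : Corresponds φ l 2 i j 0 d) : d = 0 := by
  obtain ⟨y, hy, h0, rfl⟩ := h
  exact hl y (isUniform_of_mem hy) (isQuadratic_of_mem hy) h0

theorem corresponds_vertex (i : McKayQuiver V e) :
    Corresponds φ l 0 i i (groupAlgebraHom V (e i)) (l (vertex i)) :=
  ⟨_, vertex_mem i, φ.val_vertex i, rfl⟩

theorem corresponds_arrow {i j : McKayQuiver V e} (α : i ⟶ j) :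
    Corresponds φ l 1 i j (φ.val (arrow α)) (l (arrow α)) :=
  ⟨_, arrow_mem α, rfl, rfl⟩

theorem exists_corresponds_one (φ : ArrowRealization V e)
    (l : PathAlgebra (McKayQuiver V e) →ₙₐ[ℂ] D) (i j : McKayQuiver V e) :
    ∃ T : SkewExterior V Γ →ₗ[ℂ] D, ∀ x ∈ arrowSpace V e i j, Corresponds φ l 1 i j x (T x) := by
  obtain ⟨T, hT⟩ := (φ.linearIndependent i j).exists_linearMap_apply_eq fun α => l (arrow α)
  refine ⟨T, fun x hx => ?_⟩
  rw [← φ.span_eq i j] at hx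
  induction hx using Submodule.span_induction with
  | mem x hx =>
    obtain ⟨α, rfl⟩ := hx
    have h := hT α
    dsimp only at h ⊢
    rw [h]
    exact corresponds_arrow α
  | zero => rw [map_zero]; exact .zero _ _ _
  | add x y _ _ hx hy => rw [map_add]; exact hx.add hy
  | smul c x _ hx => rw [map_smul]; exact hx.smul c

/-- One map `T` serves all `i`: `e_j ℂΓ e_i` is zero for `i ≠ j` and is the line through `e_j` for
`i = j`, so only the value `T (e j)` matters. -/
theorem exists_corresponds_zero [Finite Γ] (he : IsBasicSystem e) (φ : ArrowRealization V e)
    (l : PathAlgebra (McKayQuiver V e) →ₙₐ[ℂ] D) (j : McKayQuiver V e) :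
    ∃ T : MonoidAlgebra ℂ Γ →ₗ[ℂ] D, ∀ (i : McKayQuiver V e) (x : MonoidAlgebra ℂ Γ),
      e j * x = x → x * e i = x → Corresponds φ l 0 i j (groupAlgebraHom V x) (T x) := by
  obtain ⟨T, hT⟩ := (LinearIndependent.of_subsingleton (v := fun _ : Unit => e j) ()
    (he.ne_zero j)).exists_linearMap_apply_eq (K := ℂ) fun _ => l (vertex j)
  refine ⟨T, fun i x h h' => ?_⟩
  by_cases hij : j = i
  · subst hij
    obtain ⟨c, hc⟩ := he.exists_mul_mul_eq_smul j x
    rw [h, h'] at hc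
    rw [hc, map_smul, map_smul, hT ()]
    exact (corresponds_vertex j).smul c
  · have h0 := he.mul_mul_eq_zero hij x
    rw [h, h'] at h0
    rw [h0, map_zero, map_zero]
    exact .zero _ _ _

variable (φ l) in
/-- The matrix `A` over `D` corresponds entrywise to the matrix `(t_m x s_m')`. -/
def MatrixCorresponds {N : ℕ} (v : Fin N → McKayQuiver V e) (s t : Fin N → MonoidAlgebra ℂ Γ)
    (n : ℕ) (x : SkewExterior V Γ) (A : Matrix (Fin N) (Fin N) D) : Prop :=
  ∀ m m', Corresponds φ l n (v m') (v m)
    (groupAlgebraHom V (t m) * x * groupAlgebraHom V (s m')) (A m m')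

section Matrix

variable {N : ℕ} {v : Fin N → McKayQuiver V e} {s t : Fin N → MonoidAlgebra ℂ Γ}

/-- Inserting `1 = ∑ s_k t_k` between the factors turns the product in `⋀V * Γ` into a product of
matrices. -/
theorem MatrixCorresponds.mul (hst : 1 = ∑ m, s m * t m) {n n' : ℕ} {x x' : SkewExterior V Γ}
    {A A' : Matrix (Fin N) (Fin N) D} (h : MatrixCorresponds φ l v s t n x A)
    (h' : MatrixCorresponds φ l v s t n' x' A') :
    MatrixCorresponds φ l v s t (n + n') (x * x') (A * A') := by
  intro m m'
  rw [Matrix.mul_apply]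
  have h1 : groupAlgebraHom V (t m) * (x * x') * groupAlgebraHom V (s m') =
      ∑ k, (groupAlgebraHom V (t m) * x * groupAlgebraHom V (s k)) *
        (groupAlgebraHom V (t k) * x' * groupAlgebraHom V (s m')) := by
    calc _ = groupAlgebraHom V (t m) * x * groupAlgebraHom V 1 *
          (x' * groupAlgebraHom V (s m')) := by rw [map_one, mul_one]; simp only [mul_assoc]
      _ = _ := by
        rw [hst, map_sum, Finset.mul_sum, Finset.sum_mul]
        refine Finset.sum_congr rfl fun k _ => ?_
        simp only [mul_assoc, map_mul]
  rw [h1]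
  exact .sum _ fun k _ => (h m k).mul (h' k m')

theorem MatrixCorresponds.eq (he : IsBasicSystem e) {n : ℕ} (hn : n ≤ 1) {x : SkewExterior V Γ}
    {A A' : Matrix (Fin N) (Fin N) D} (h : MatrixCorresponds φ l v s t n x A)
    (h' : MatrixCorresponds φ l v s t n x A') : A = A' := by
  ext m m'
  exact (h m m').eq he hn (h' m m')

theorem MatrixCorresponds.eq_zero
    (hl : ∀ x, x.IsUniform → x.IsQuadratic → φ.val x = 0 → l x = 0)
    {A : Matrix (Fin N) (Fin N) D} (h : MatrixCorresponds φ l v s t 2 0 A) : A = 0 := by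
  ext m m'
  refine Corresponds.eq_zero hl (φ := φ) (i := v m') (j := v m) ?_
  have := h m m'
  rwa [mul_zero, zero_mul] at this

/-- `⋀V * Γ` maps to matrices over any algebra in which the quadratic relations hold. -/
theorem exists_matrix_hom [Finite Γ] (he : IsBasicSystem e)
    (hl : ∀ x, x.IsUniform → x.IsQuadratic → φ.val x = 0 → l x = 0)
    (hs : ∀ m, s m * e (v m) = s m) (ht : ∀ m, e (v m) * t m = t m) (hst : 1 = ∑ m, s m * t m) :
    ∃ Θ : SkewExterior V Γ →ₗ[ℂ] Matrix (Fin N) (Fin N) D,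
      (∀ x y, Θ (x * y) = Θ x * Θ y) ∧
      (∀ r, MatrixCorresponds φ l v s t 0 (groupAlgebraHom V r) (Θ (groupAlgebraHom V r))) ∧
      ∀ x ∈ degreeOne V Γ, MatrixCorresponds φ l v s t 1 x (Θ x) := by
  choose T₁ hT₁ using exists_corresponds_one φ l
  choose T₀ hT₀ using exists_corresponds_zero he φ l
  let θ₁ : SkewExterior V Γ →ₗ[ℂ] Matrix (Fin N) (Fin N) D :=
    { toFun := fun x => Matrix.of fun m m' => T₁ (v m') (v m)
        (groupAlgebraHom V (t m) * x * groupAlgebraHom V (s m'))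
      map_add' := fun x y => by ext; simp [mul_add, add_mul]
      map_smul' := fun c x => by ext; simp }
  let θ₀ : MonoidAlgebra ℂ Γ →ₗ[ℂ] Matrix (Fin N) (Fin N) D :=
    { toFun := fun x => Matrix.of fun m m' => T₀ (v m) (t m * x * s m')
      map_add' := fun x y => by ext; simp [mul_add, add_mul]
      map_smul' := fun c x => by ext; simp }
  have h₁ : ∀ x ∈ degreeOne V Γ, MatrixCorresponds φ l v s t 1 x (θ₁ x) := by
    intro x hx m m'
    refine hT₁ (v m') (v m) _ ((mem_arrowSpace_iff he).2 ⟨mul_groupAlgebraHom_mem_degreeOne _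
      (groupAlgebraHom_mul_mem_degreeOne _ hx), ?_, ?_⟩)
    · rw [← mul_assoc, ← mul_assoc, ← map_mul, ht]
    · rw [mul_assoc, ← map_mul, hs]
  have h₀ : ∀ r, MatrixCorresponds φ l v s t 0 (groupAlgebraHom V r) (θ₀ r) := by
    intro r m m'
    rw [← map_mul, ← map_mul]
    refine hT₀ (v m) (v m') _ ?_ ?_
    · rw [← mul_assoc, ← mul_assoc, ht]
    · rw [mul_assoc, hs]
  -- Both sides of each of the next three identities correspond to the same element of degree `≤ 1`,
  -- hence agree.
  have h00 : ∀ r r', θ₀ r * θ₀ r' = θ₀ (r * r') := fun r r' =>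
    ((h₀ r).mul hst (h₀ r')).eq he (by norm_num) (by rw [← map_mul]; exact h₀ _)
  have h01 : ∀ r, ∀ x ∈ degreeOne V Γ, θ₀ r * θ₁ x = θ₁ (groupAlgebraHom V r * x) :=
    fun r x hx => ((h₀ r).mul hst (h₁ x hx)).eq he (by norm_num)
      (h₁ _ (groupAlgebraHom_mul_mem_degreeOne _ hx))
  have h10 : ∀ r, ∀ x ∈ degreeOne V Γ, θ₁ x * θ₀ r = θ₁ (x * groupAlgebraHom V r) :=
    fun r x hx => ((h₁ x hx).mul hst (h₀ r)).eq he (by norm_num)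
      (h₁ _ (mul_groupAlgebraHom_mem_degreeOne _ hx))
  -- The square corresponds to `w ∧ w = 0` in degree two, so its entries are values of `l` at
  -- quadratic relations. This is what the universal property of `⋀V` requires.
  have hsq : ∀ w : V, (θ₁ ∘ₗ vecHom V Γ) w * (θ₁ ∘ₗ vecHom V Γ) w = 0 := by
    intro w
    have h := (h₁ _ (vecHom_mem_degreeOne (Γ := Γ) w)).mul hst (h₁ _ (vecHom_mem_degreeOne w))
    rw [vecHom_mul_self] at h
    exact h.eq_zero hl
  let L : ExteriorAlgebra ℂ V →ₐ[ℂ] Matrix (Fin N) (Fin N) D :=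
    ExteriorAlgebra.lift ℂ ⟨θ₁ ∘ₗ vecHom V Γ, hsq⟩
  have hL : ∀ w, L (ExteriorAlgebra.ι ℂ w) = θ₁ (vecHom V Γ w) := fun w =>
    ExteriorAlgebra.lift_ι_apply ℂ _ hsq w
  -- The commutation rule of the skew group algebra, which makes `x g ↦ L x * θ₀ g` multiplicative.
  have hcomm : ∀ (g : Γ) (w : ExteriorAlgebra ℂ V),
      θ₀ (MonoidAlgebra.single g 1) * L w = L (g • w) * θ₀ (MonoidAlgebra.single g 1) := by
    intro g w
    induction w using ExteriorAlgebra.induction with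
    | algebraMap r => rw [smul_algebraMap, AlgHom.commutes, Algebra.commutes]
    | ι w =>
      rw [smul_ι, hL, hL, h01 _ _ (vecHom_mem_degreeOne _), h10 _ _ (vecHom_mem_degreeOne _),
        single_mul_vecHom]
    | mul a b ha hb =>
      rw [smul_mul', map_mul, map_mul, ← mul_assoc, ha, mul_assoc, hb, mul_assoc]
    | add a b ha hb => rw [smul_add, map_add, map_add, mul_add, add_mul, ha, hb]
  let Θ : SkewExterior V Γ →ₗ[ℂ] Matrix (Fin N) (Fin N) D :=
    (Finsupp.lsum ℂ fun g : Γ =>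
      LinearMap.mulRight ℂ (θ₀ (MonoidAlgebra.single g 1)) ∘ₗ L.toLinearMap) ∘ₗ
      (SkewMonoidAlgebra.coeffLinearEquiv (S := ℂ)).toLinearMap
  have hΘ : ∀ g w, Θ (SkewMonoidAlgebra.single g w) = L w * θ₀ (MonoidAlgebra.single g 1) := by
    intro g w
    change (Finsupp.lsum ℂ fun g : Γ =>
      LinearMap.mulRight ℂ (θ₀ (MonoidAlgebra.single g 1)) ∘ₗ L.toLinearMap) (Finsupp.single g w) = _
    rw [Finsupp.lsum_single]
    rfl
  have hmul : ∀ x y, Θ (x * y) = Θ x * Θ y := by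
    intro x y
    induction x using SkewMonoidAlgebra.induction_on with
    | zero => simp
    | add a b ha hb => rw [add_mul, map_add, map_add, add_mul, ha, hb]
    | single g w =>
      induction y using SkewMonoidAlgebra.induction_on with
      | zero => simp
      | add a b ha hb => rw [mul_add, map_add, map_add, mul_add, ha, hb]
      | single g' w' =>
        rw [SkewMonoidAlgebra.single_mul_single, hΘ, hΘ, hΘ, map_mul, mul_assoc (L w), mul_assoc (L w),
          ← mul_assoc (θ₀ _), hcomm, mul_assoc (L (g • w')), h00, MonoidAlgebra.single_mul_single,
          mul_one]
  have hgrp : ∀ r, Θ (groupAlgebraHom V r) = θ₀ r := by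
    intro r
    induction r using MonoidAlgebra.induction_linear with
    | zero => simp
    | add a b ha hb => simp only [map_add, ha, hb]
    | single g c =>
      rw [show (MonoidAlgebra.single g c : MonoidAlgebra ℂ Γ) = c • MonoidAlgebra.single g 1 by simp,
        map_smul, map_smul, map_smul, groupAlgebraHom_single_one, hΘ, map_one, one_mul]
  refine ⟨Θ, hmul, fun r => ?_, fun x hx => ?_⟩
  · rw [hgrp]
    exact h₀ r
  · suffices h : Θ x = θ₁ x by rw [h]; exact h₁ x hx
    refine degreeOne_induction (C := fun x => Θ x = θ₁ x) hx (by simp) ?_ ?_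
    · intro a b ha hb
      rw [map_add, map_add, ha, hb]
    · intro w r
      have hw := vecHom_mem_degreeOne (Γ := Γ) w
      rw [hmul, hgrp, vecHom_apply, hΘ, hL, mul_assoc, h00, h10 _ _ hw]
      rw [show (MonoidAlgebra.single (1 : Γ) (1 : ℂ)) = 1 from rfl, one_mul]
      rfl

end Matrix

end Correspondence

end ArrowRealization
end

noncomputable section

set_option linter.unusedSectionVars false

namespace ArrowRealization

open PathAlgebra

variable {V : Type*} [AddCommGroup V] [Module ℂ V]
variable {Γ : Type*} [Group Γ] [DistribMulAction Γ V] [SMulCommClass Γ ℂ V]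
variable {I : Type*} [Fintype I] {e : I → MonoidAlgebra ℂ Γ}

/-- A homomorphism that kills the quadratic relations kills the kernel of the realization. -/
theorem map_eq_zero_of_val_eq_zero [Finite Γ] (he : IsBasicSystem e) (φ : ArrowRealization V e)
    {D : Type*} [Ring D] [Algebra ℂ D] (l : PathAlgebra (McKayQuiver V e) →ₙₐ[ℂ] D)
    (hl : ∀ x, x.IsUniform → x.IsQuadratic → φ.val x = 0 → l x = 0)
    (y : PathAlgebra (McKayQuiver V e)) (hy : φ.val y = 0) : l y = 0 := by
  have : Fintype (McKayQuiver V e) := inferInstanceAs (Fintype I)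
  obtain ⟨N, v, s, t, hs, ht, hst⟩ : ∃ (N : ℕ) (v : Fin N → McKayQuiver V e)
      (s t : Fin N → MonoidAlgebra ℂ Γ), (∀ m, s m * e (v m) = s m) ∧
      (∀ m, e (v m) * t m = t m) ∧ 1 = ∑ m, s m * t m := he.exists_one_eq_sum
  obtain ⟨Θ, hmul, h0, h1⟩ := exists_matrix_hom he hl hs ht hst
  -- By Schur's lemma `t_m e_k` and `e_k s_m` vanish unless `v m = k`, and then they are multiples
  -- of `e_k`. The scalars `lam` and `mu` describe how `e_k ⋀V * Γ e_i` sits inside the matrices.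
  have hlam : ∀ (k : McKayQuiver V e) (m : Fin N), ∃ c : ℂ, t m * e k = c • e k ∧
      (c ≠ 0 → v m = k) := by
    intro k m
    by_cases h : v m = k
    · obtain ⟨c, hc⟩ := he.exists_mul_mul_eq_smul k (t m)
      refine ⟨c, ?_, fun _ => h⟩
      rw [← hc, ← h, ht]
    · refine ⟨0, ?_, fun h => absurd rfl h⟩
      rw [← ht, he.mul_mul_eq_zero h, zero_smul]
  have hmu : ∀ (k : McKayQuiver V e) (m : Fin N), ∃ c : ℂ, e k * s m = c • e k ∧
      (c ≠ 0 → v m = k) := by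
    intro k m
    by_cases h : v m = k
    · obtain ⟨c, hc⟩ := he.exists_mul_mul_eq_smul k (s m)
      refine ⟨c, ?_, fun _ => h⟩
      rw [← hc, ← h, mul_assoc, hs]
    · refine ⟨0, ?_, fun h => absurd rfl h⟩
      rw [← hs, ← mul_assoc, he.mul_mul_eq_zero (Ne.symm h), zero_smul]
  choose lam hlam1 hlam2 using hlam
  choose mu hmu1 hmu2 using hmu
  have hsum : ∀ k, ∑ m, mu k m * lam k m = 1 := by
    intro k
    have h : e k = (∑ m, mu k m * lam k m) • e k := by
      calc e k = e k * 1 * e k := by rw [mul_one, he.idem k]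
        _ = ∑ m, (e k * s m) * (t m * e k) := by
          rw [hst, Finset.mul_sum, Finset.sum_mul]; simp only [mul_assoc]
        _ = _ := by
          rw [Finset.sum_smul]
          refine Finset.sum_congr rfl fun m _ => ?_
          rw [hlam1, hmu1, smul_mul_smul_comm, he.idem k]
    have h' : ((∑ m, mu k m * lam k m) - 1) • e k = 0 := by rw [sub_smul, one_smul, ← h, sub_self]
    rcases smul_eq_zero.1 h' with h' | h'
    · exact sub_eq_zero.1 h'
    · exact absurd h' (he.ne_zero k)
  -- In degree `≤ 1` the matrix of an element from `i` to `k` is its value `d` times the scalar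
  -- matrix with entries `lam k m * mu i m'`.
  have entry : ∀ (n : ℕ), n ≤ 1 → ∀ (i k : McKayQuiver V e) (x : SkewExterior V Γ) (d : D),
      groupAlgebraHom V (e k) * x = x → x * groupAlgebraHom V (e i) = x →
      Corresponds φ l n i k x d → MatrixCorresponds φ l v s t n x (Θ x) →
      ∀ m m', Θ x m m' = (lam k m * mu i m') • d := by
    intro n hn i k x d hk hi hx hX m m'
    have hX' := hX m m'
    have hent : groupAlgebraHom V (t m) * x * groupAlgebraHom V (s m') =
        (lam k m * mu i m') • x := by
      calc _ = groupAlgebraHom V (t m * e k) * x * groupAlgebraHom V (e i * s m') := by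
            rw [map_mul, map_mul]
            nth_rw 1 [← hk, ← hi]
            simp only [mul_assoc]
        _ = _ := by
            rw [hlam1, hmu1, map_smul, map_smul, smul_mul_assoc, hk, smul_mul_smul_comm, hi]
    rw [hent] at hX'
    by_cases hc : lam k m * mu i m' = 0
    · rw [hc, zero_smul] at hX' ⊢
      exact hX'.eq he hn (.zero _ _ _)
    · have hm := hlam2 k m (left_ne_zero_of_mul hc)
      have hm' := hmu2 i m' (right_ne_zero_of_mul hc)
      rw [hm, hm'] at hX'
      exact hX'.eq he hn (hx.smul _)
  have hpath : ∀ (i k : McKayQuiver V e) (p : Quiver.Path i k) m m',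
      Θ (φ.val (ofPath ⟨i, k, p⟩)) m m' = (lam k m * mu i m') • l (ofPath ⟨i, k, p⟩) := by
    intro i k p
    induction p with
    -- The formula of `entry` extends to all paths: in a product of two such matrices the inner sum
    -- is `∑ mu j x * lam j x = 1`.
    | nil =>
      refine entry 0 (by norm_num) i i _ _ ?_ ?_ ⟨_, vertex_mem i, rfl, rfl⟩ ?_
      · exact φ.vertex_mul_val (ofPath_mem_pathSpace ⟨rfl, rfl⟩)
      · exact φ.val_mul_vertex (ofPath_mem_pathSpace ⟨rfl, rfl⟩)
      · have h := h0 (e i)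
        rw [← φ.val_vertex] at h
        exact h
    | @cons j k p α ih =>
      intro m m'
      have hα := entry 1 le_rfl j k (φ.val (arrow α)) _
        (φ.vertex_mul_val (ofPath_mem_pathSpace ⟨rfl, rfl⟩))
        (φ.val_mul_vertex (ofPath_mem_pathSpace ⟨rfl, rfl⟩)) (corresponds_arrow α)
        (h1 _ ((mem_arrowSpace_iff he).1 (φ.val_arrow_mem α)).1)
      rw [ofPath_cons, φ.val_mul, hmul, Matrix.mul_apply, map_mul]
      simp only [hα, ih, smul_mul_smul_comm]
      rw [← Finset.sum_smul]
      congr 1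
      calc _ = lam k m * mu i m' * ∑ x, mu j x * lam j x := by
            rw [Finset.mul_sum]
            exact Finset.sum_congr rfl fun _ _ => by ring
        _ = _ := by rw [hsum, mul_one]
  have hcomp : ∀ (i k : McKayQuiver V e) (x : PathAlgebra (McKayQuiver V e)),
      (x ∈ pathSpace fun p => p.src = i ∧ p.tgt = k) → ∀ m m',
      Θ (φ.val x) m m' = (lam k m * mu i m') • l x := by
    intro i k x hx m m'
    refine pathSpace_induction (C := fun x => Θ (φ.val x) m m' = (lam k m * mu i m') • l x) hx
      (by simp) ?_ ?_
    · intro a b ha hb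
      rw [map_add, map_add, map_add, Matrix.add_apply, ha, hb, smul_add]
    · rintro c ⟨_, _, p⟩ ⟨rfl, rfl⟩
      rw [map_smul, map_smul, map_smul, Matrix.smul_apply, hpath, smul_comm]
  rw [← sum_vertex_mul_mul_vertex y, map_sum]
  refine Finset.sum_eq_zero fun i _ => ?_
  rw [map_sum]
  refine Finset.sum_eq_zero fun k _ => ?_
  -- Some entry has a nonzero coefficient, so that `l` of the component of `y` from `i` to `k` can
  -- be read off from `Θ (φ.val _)`, which is zero.
  obtain ⟨m, -, hm⟩ := Finset.exists_ne_zero_of_sum_ne_zero ((hsum k).trans_ne one_ne_zero)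
  obtain ⟨m', -, hm'⟩ := Finset.exists_ne_zero_of_sum_ne_zero ((hsum i).trans_ne one_ne_zero)
  have h := hcomp i k _ (vertex_mul_mul_vertex_mem i k y) m m'
  rw [φ.val_mul, φ.val_mul, hy, mul_zero, zero_mul, map_zero, Matrix.zero_apply] at h
  exact (smul_eq_zero.1 h.symm).resolve_left
    (mul_ne_zero (right_ne_zero_of_mul hm) (left_ne_zero_of_mul hm'))

/-- `Λ(Γ)` is quadratic. -/
theorem mem_span_of_val_eq_zero [Finite Γ] (he : IsBasicSystem e) (φ : ArrowRealization V e)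
    {x : PathAlgebra (McKayQuiver V e)} (hx : φ.val x = 0) :
    x ∈ TwoSidedIdeal.span {x | x.IsUniform ∧ x.IsQuadratic ∧ φ.val x = 0} := by
  have : Fintype (McKayQuiver V e) := inferInstanceAs (Fintype I)
  rw [← quotientAction_eq_zero_iff]
  -- The target algebra is `End (ℂQ / I)` with `I` the ideal of quadratic relations; by construction
  -- the quadratic relations act on it as zero.
  refine φ.map_eq_zero_of_val_eq_zero he _ (fun y h1 h2 h3 => ?_) x hx
  rw [quotientAction_eq_zero_iff]
  exact TwoSidedIdeal.subset_span ⟨h1, h2, h3⟩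

end ArrowRealization
end

/-! ### Twisting by characters of `G / N`, and restriction to `N`. -/

noncomputable section

set_option linter.unusedSectionVars false

/-- Right-handed counterpart of `exists_mul_eq`. Some `x * s m` is nonzero; it lies in `e_j ℂΓ e_{l
m}`, so Schur's lemma forces `l m = j` and makes it a nonzero multiple of `e j`. -/
theorem IsBasicSystem.exists_mul_eq_right {Γ : Type*} [Group Γ] [Finite Γ] {I : Type*}
    {e : I → MonoidAlgebra ℂ Γ} (he : IsBasicSystem e) {j : I} {x : MonoidAlgebra ℂ Γ}
    (hx : e j * x = x) (hx0 : x ≠ 0) : ∃ y, x * y = e j := by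
  obtain ⟨n, l, s, t, hs, ht, hst⟩ := he.exists_one_eq_sum
  have h1 : ∑ m, x * s m * t m ≠ 0 := by
    simp only [mul_assoc]
    rw [← Finset.mul_sum, ← hst, mul_one]
    exact hx0
  obtain ⟨m, -, hm⟩ := Finset.exists_ne_zero_of_sum_ne_zero h1
  have hm' : x * s m ≠ 0 := left_ne_zero_of_mul hm
  have h2 : x * s m = e j * (x * s m) * e (l m) := by rw [mul_assoc, mul_assoc, hs, ← mul_assoc, hx]
  have hj : j = l m := by
    by_contra h
    exact hm' (h2.trans (he.mul_mul_eq_zero h _))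
  obtain ⟨c, hc⟩ := he.exists_mul_mul_eq_smul j (x * s m)
  rw [← hj, hc] at h2
  have hc0 : c ≠ 0 := by
    rintro rfl
    exact hm' (by rw [h2, zero_smul])
  exact ⟨c⁻¹ • s m, by rw [mul_smul_comm, h2, smul_smul, inv_mul_cancel₀ hc0, one_smul]⟩

section Twist

variable {G : Type*} [Group G] (N : Subgroup G) [N.Normal]

/-- There are finitely many characters of `G / N`, and they separate its elements. -/
structure HasEnoughCharacters : Prop where
  finite : Finite (G ⧸ N →* ℂˣ)
  separates : ∀ g : G, g ∉ N → ∃ χ : G ⧸ N →* ℂˣ, χ g ≠ 1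

/-- The inclusion `ℂN → ℂG`. -/
abbrev subgroupHom : MonoidAlgebra ℂ N →+* MonoidAlgebra ℂ G :=
  MonoidAlgebra.mapDomainRingHom ℂ N.subtype

theorem subgroupHom_single (g : N) (c : ℂ) :
    subgroupHom N (MonoidAlgebra.single g c) = MonoidAlgebra.single (g : G) c := by
  simp [subgroupHom]

theorem subgroupHom_injective : Function.Injective (subgroupHom N) :=
  MonoidAlgebra.mapDomain_injective N.subtype_injective

theorem subgroupHom_smul (c : ℂ) (x : MonoidAlgebra ℂ N) :
    subgroupHom N (c • x) = c • subgroupHom N x :=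
  map_smul (MonoidAlgebra.mapDomainAlgHom ℂ ℂ N.subtype) c x

variable {N}

/-- The automorphism of `ℂG` given by a character of `G / N`. -/
def twist (χ : G ⧸ N →* ℂˣ) : MonoidAlgebra ℂ G →ₐ[ℂ] MonoidAlgebra ℂ G :=
  MonoidAlgebra.lift ℂ _ G
    { toFun := fun g => MonoidAlgebra.single g (χ g : ℂ)
      map_one' := by simp [MonoidAlgebra.one_def]
      map_mul' := fun g h => by simp [MonoidAlgebra.single_mul_single] }

theorem twist_single (χ : G ⧸ N →* ℂˣ) (g : G) (c : ℂ) :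
    twist χ (MonoidAlgebra.single g c) = MonoidAlgebra.single g (χ g * c) := by
  rw [twist, MonoidAlgebra.lift_single]
  simp [mul_comm]

theorem twist_one (x : MonoidAlgebra ℂ G) : twist (1 : G ⧸ N →* ℂˣ) x = x := by
  induction x using MonoidAlgebra.induction_linear with
  | zero => simp
  | add a b ha hb => rw [map_add, ha, hb]
  | single g c => simp [twist_single]

theorem twist_mul (χ χ' : G ⧸ N →* ℂˣ) (x : MonoidAlgebra ℂ G) :
    twist (χ * χ') x = twist χ (twist χ' x) := by
  induction x using MonoidAlgebra.induction_linear with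
  | zero => simp
  | add a b ha hb => simp only [map_add, ha, hb]
  | single g c => simp [twist_single, mul_assoc]

theorem twist_twist_inv (χ : G ⧸ N →* ℂˣ) (x : MonoidAlgebra ℂ G) :
    twist χ (twist χ⁻¹ x) = x := by
  rw [← twist_mul, show χ * χ⁻¹ = 1 from mul_inv_cancel χ, twist_one]

theorem twist_inv_twist (χ : G ⧸ N →* ℂˣ) (x : MonoidAlgebra ℂ G) :
    twist χ⁻¹ (twist χ x) = x := by
  rw [← twist_mul, show χ⁻¹ * χ = 1 from inv_mul_cancel χ, twist_one]

theorem twist_ne_zero (χ : G ⧸ N →* ℂˣ) {x : MonoidAlgebra ℂ G} (hx : x ≠ 0) : twist χ x ≠ 0 := by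
  intro h
  apply hx
  rw [← twist_inv_twist χ x, h, map_zero]

theorem twist_subgroupHom (χ : G ⧸ N →* ℂˣ) (x : MonoidAlgebra ℂ N) :
    twist χ (subgroupHom N x) = subgroupHom N x := by
  induction x using MonoidAlgebra.induction_linear with
  | zero => simp
  | add a b ha hb => simp only [map_add, ha, hb]
  | single g c =>
    rw [subgroupHom_single, twist_single, (QuotientGroup.eq_one_iff (g : G)).2 g.2]
    simp

/-- Orthogonality: multiplication by a character with `χ₀ g ≠ 1` permutes the summands. -/
theorem sum_character [Fintype (G ⧸ N →* ℂˣ)] (hN : HasEnoughCharacters N) {g : G} (hg : g ∉ N) :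
    ∑ χ : G ⧸ N →* ℂˣ, (χ g : ℂ) = 0 := by
  obtain ⟨χ₀, h0⟩ := hN.separates g hg
  have h1 : (χ₀ g : ℂ) * ∑ χ : G ⧸ N →* ℂˣ, (χ g : ℂ) = ∑ χ : G ⧸ N →* ℂˣ, (χ g : ℂ) := by
    rw [Finset.mul_sum]
    exact Fintype.sum_equiv (Equiv.mulLeft χ₀) _ _ fun χ => by simp
  have h2 : ((χ₀ g : ℂ) - 1) * ∑ χ : G ⧸ N →* ℂˣ, (χ g : ℂ) = 0 := by
    rw [sub_mul, h1, one_mul, sub_self]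
  refine (mul_eq_zero.1 h2).resolve_left fun h => h0 ?_
  exact Units.ext (sub_eq_zero.1 h)

/-- Averaging over all twists projects `ℂG` onto `ℂN`: coefficients outside `N` cancel by
orthogonality, those on `N` are fixed by each twist. -/
theorem sum_twist [Fintype (G ⧸ N →* ℂˣ)] (hN : HasEnoughCharacters N) (x : MonoidAlgebra ℂ G) :
    ∑ χ : G ⧸ N →* ℂˣ, twist χ x = (Fintype.card (G ⧸ N →* ℂˣ) : ℂ) •
      subgroupHom N (MonoidAlgebra.comapDomain N.subtype N.subtype_injective x) := by
  induction x using MonoidAlgebra.induction_linear with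
  | zero => simp
  | add a b ha hb =>
    simp only [map_add, Finset.sum_add_distrib, ha, hb, MonoidAlgebra.comapDomain_add, smul_add]
  | single g c =>
    simp only [twist_single]
    by_cases hg : g ∈ N
    · have h := MonoidAlgebra.comapDomain_single_map N.subtype N.subtype_injective ⟨g, hg⟩ c
      rw [Subgroup.subtype_apply] at h
      rw [h, subgroupHom_single, (QuotientGroup.eq_one_iff g).2 hg]
      simp
    · rw [MonoidAlgebra.comapDomain_single_of_not_mem_range (by simpa using hg), map_zero, smul_zero]
      have h : ∀ χ : G ⧸ N →* ℂˣ, MonoidAlgebra.single g ((χ g : ℂ) * c) =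
          (χ g : ℂ) • MonoidAlgebra.single g c := fun χ => by simp
      simp only [h]
      rw [← Finset.sum_smul, sum_character hN hg, zero_smul]

end Twist

section Restriction

variable {G : Type*} [Group G] {N : Subgroup G} [N.Normal]
variable {I J : Type*} {e : I → MonoidAlgebra ℂ G} {f : J → MonoidAlgebra ℂ N}

variable (e f) in
/-- Right multiplication by `u` is an isomorphism `ℂN f_j → ℂG e_a` of representations of `N`. -/
structure IsRestriction (a : I) (j : J) (u : MonoidAlgebra ℂ G) : Prop where
  left : subgroupHom N (f j) * u = u
  right : u * e a = u
  injective : ∀ x, x * f j = x → subgroupHom N x * u = 0 → x = 0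
  surjective : ∀ y, y * e a = y → ∃ x, x * f j = x ∧ subgroupHom N x * u = y

namespace IsRestriction

variable {a : I} {j : J} {u : MonoidAlgebra ℂ G}

theorem of_bijOn (he : IsBasicSystem e) (hf : IsBasicSystem f)
    (h : subgroupHom N (f j) * u = u)
    (hb : Set.BijOn (fun x => subgroupHom N x * u)
      (Submodule.span (MonoidAlgebra ℂ N) {f j} : Set (MonoidAlgebra ℂ N))
      (Submodule.span (MonoidAlgebra ℂ G) {e a} : Set (MonoidAlgebra ℂ G))) :
    IsRestriction e f a j u where
  left := h
  right := by
    rw [← mem_span_idempotent_iff (he.idem a), ← h]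
    exact hb.mapsTo (Submodule.mem_span_singleton_self _)
  injective x hx h0 := hb.injOn ((mem_span_idempotent_iff (hf.idem j)).2 hx)
    (Submodule.zero_mem _) (by simpa using h0)
  surjective y hy := by
    obtain ⟨x, hx, hxy⟩ := hb.surjOn ((mem_span_idempotent_iff (he.idem a)).2 hy)
    exact ⟨x, (mem_span_idempotent_iff (hf.idem j)).1 hx, hxy⟩

theorem bijOn (he : IsBasicSystem e) (hf : IsBasicSystem f) (h : IsRestriction e f a j u) :
    Set.BijOn (fun x => subgroupHom N x * u)
      (Submodule.span (MonoidAlgebra ℂ N) {f j} : Set (MonoidAlgebra ℂ N))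
      (Submodule.span (MonoidAlgebra ℂ G) {e a} : Set (MonoidAlgebra ℂ G)) := by
  refine ⟨fun x _ => ?_, fun x hx y hy hxy => ?_, fun y hy => ?_⟩
  · refine (mem_span_idempotent_iff (he.idem a)).2 ?_
    dsimp only
    rw [mul_assoc, h.right]
  · refine sub_eq_zero.1 (h.injective _ ?_ ?_)
    · rw [sub_mul, (mem_span_idempotent_iff (hf.idem j)).1 hx,
        (mem_span_idempotent_iff (hf.idem j)).1 hy]
    · rw [map_sub, sub_mul, sub_eq_zero]
      exact hxy
  · obtain ⟨x, hx, hxy⟩ := h.surjective y ((mem_span_idempotent_iff (he.idem a)).1 hy)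
    exact ⟨x, (mem_span_idempotent_iff (hf.idem j)).2 hx, hxy⟩

theorem exists_mul_eq (he : IsBasicSystem e) (h : IsRestriction e f a j u) :
    ∃ x, subgroupHom N x * u = e a := by
  obtain ⟨x, -, hx⟩ := h.surjective (e a) (he.idem a)
  exact ⟨x, hx⟩

theorem ne_zero (he : IsBasicSystem e) (h : IsRestriction e f a j u) : u ≠ 0 := by
  rintro rfl
  obtain ⟨x, hx⟩ := h.exists_mul_eq he
  exact he.ne_zero a (by rw [← hx, mul_zero])

theorem mul_mul_eq_zero (hf : IsBasicSystem f) (h : IsRestriction e f a j u) {j' : J}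
    (hj : j' ≠ j) (z : MonoidAlgebra ℂ G) (hz : z * e a = z) : subgroupHom N (f j') * z = 0 := by
  obtain ⟨x, hx, hxz⟩ := h.surjective z hz
  rw [← hxz, ← hx, ← mul_assoc, ← map_mul, ← mul_assoc, hf.mul_mul_eq_zero hj, map_zero, zero_mul]

/-- The space `f_j ℂG e_a` represents `Hom_N(S_j, S_a)`; as `S_a` restricts to `S_j`, it is the line
through `u`. -/
theorem exists_mul_eq_smul [Finite G] (hf : IsBasicSystem f) (h : IsRestriction e f a j u)
    (z : MonoidAlgebra ℂ G) (hz : z * e a = z) : ∃ c : ℂ, subgroupHom N (f j) * z = c • u := by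
  obtain ⟨x, hx, hxz⟩ := h.surjective z hz
  obtain ⟨c, hc⟩ := hf.exists_mul_mul_eq_smul j x
  refine ⟨c, ?_⟩
  rw [← hxz, ← hx, ← mul_assoc, ← map_mul, ← mul_assoc, hc, subgroupHom_smul, smul_mul_assoc, h.left]

/-- The twists of a suitable right multiple of `u` add up to `f_j`. -/
theorem exists_sum_twist_eq [Finite G] [Fintype (G ⧸ N →* ℂˣ)] (hN : HasEnoughCharacters N)
    (hf : IsBasicSystem f) (hu : subgroupHom N (f j) * u = u) (hu0 : u ≠ 0) :
    ∃ q, ∑ χ : G ⧸ N →* ℂˣ, twist χ (u * q) = subgroupHom N (f j) := by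
  obtain ⟨g, hg⟩ : ∃ g, u.coeff g ≠ 0 := by
    by_contra! h
    exact hu0 (MonoidAlgebra.ext (Finsupp.ext h))
  -- A translate with a nonzero coefficient at `1` has a nonzero component in `ℂN`.
  set n := MonoidAlgebra.comapDomain N.subtype N.subtype_injective
    (u * MonoidAlgebra.single g⁻¹ 1) with hn
  have hs := sum_twist hN (u * MonoidAlgebra.single g⁻¹ 1)
  rw [← hn] at hs
  have hc0 : (Fintype.card (G ⧸ N →* ℂˣ) : ℂ) ≠ 0 := Nat.cast_ne_zero.2 Fintype.card_ne_zero
  have hn0 : n ≠ 0 := by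
    intro h
    have h1 : n.coeff 1 = u.coeff g := by
      rw [hn, MonoidAlgebra.coeff_comapDomain, Finsupp.comapDomain_apply]
      simp
    rw [h] at h1
    exact hg (by rw [← h1]; simp)
  -- The projection onto `ℂN` commutes with left multiplication by `ℂN`, so `n` inherits `f_j u =
  -- u`.
  have hfn : f j * n = n := by
    apply subgroupHom_injective N
    have h1 : (Fintype.card (G ⧸ N →* ℂˣ) : ℂ) • subgroupHom N (f j * n) =
        (Fintype.card (G ⧸ N →* ℂˣ) : ℂ) • subgroupHom N n := by
      rw [map_mul, ← mul_smul_comm, ← hs, Finset.mul_sum]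
      refine Finset.sum_congr rfl fun χ _ => ?_
      rw [← twist_subgroupHom χ (f j), ← map_mul, ← mul_assoc, hu]
    exact smul_right_injective _ hc0 h1
  obtain ⟨m, hm⟩ := hf.exists_mul_eq_right hfn hn0
  -- The twists of `u g⁻¹` add up to `n` times the number of characters; `m` turns `n` into `f_j`,
  -- and the last factor cancels the number. Both are fixed by twists.
  refine ⟨MonoidAlgebra.single g⁻¹ 1 * subgroupHom N m *
    algebraMap ℂ _ (Fintype.card (G ⧸ N →* ℂˣ) : ℂ)⁻¹, ?_⟩
  simp only [← mul_assoc]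
  simp only [map_mul (twist _) (_ * _), twist_subgroupHom, AlgHom.commutes]
  rw [← Finset.sum_mul, ← Finset.sum_mul, hs, smul_mul_assoc, ← map_mul, hm,
    ← Algebra.commutes, ← Algebra.smul_def, smul_smul, inv_mul_cancel₀ hc0, one_smul]

/-- If `ℂG e_c` restricts to `ℂN f_j` and `ℂG e_a` contains `ℂN f_j`, then `ℂG e_a` is a twist of
`ℂG e_c` by a character of `G / N`. -/
theorem exists_twist [Finite G] (hN : HasEnoughCharacters N) (he : IsBasicSystem e)
    (hf : IsBasicSystem f) (h : IsRestriction e f a j u) {b : I} {y : MonoidAlgebra ℂ G}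
    (hy : subgroupHom N (f j) * y = y) (hyb : y * e b = y) (hy0 : y ≠ 0) :
    ∃ (χ : G ⧸ N →* ℂˣ) (w : MonoidAlgebra ℂ G), IsRestriction e f b j (twist χ u * w) := by
  have := hN.finite
  have := Fintype.ofFinite (G ⧸ N →* ℂˣ)
  obtain ⟨q, hq⟩ := exists_sum_twist_eq hN hf h.left (h.ne_zero he)
  obtain ⟨z, hz⟩ := he.exists_mul_eq hyb hy0
  have h1 : ∑ χ : G ⧸ N →* ℂˣ, e b * z * twist χ (u * q) ≠ 0 := by
    rw [← Finset.mul_sum, hq]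
    intro h0
    apply he.ne_zero b
    calc e b = e b * (z * (subgroupHom N (f j) * y)) := by rw [hy, hz, he.idem]
      _ = e b * z * subgroupHom N (f j) * y := by simp only [mul_assoc]
      _ = 0 := by rw [h0, zero_mul]
  obtain ⟨χ, -, hχ⟩ := Finset.exists_ne_zero_of_sum_ne_zero h1
  rw [map_mul, ← mul_assoc] at hχ
  -- Right multiplication by `Y` is a nonzero `G`-map from `ℂG e_b` to the twist of `ℂG e_a`. Both
  -- are simple, so it is invertible, and `w` below is its inverse.
  set Y := e b * z * twist χ u with hY
  have hY0 : Y ≠ 0 := left_ne_zero_of_mul hχ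
  have hbY : e b * Y = Y := by rw [hY, ← mul_assoc, ← mul_assoc, he.idem]
  have hYa : twist χ⁻¹ Y * e a = twist χ⁻¹ Y := by
    rw [hY, map_mul, twist_inv_twist, mul_assoc, h.right]
  have hYa' : Y * twist χ (e a) = Y := by
    have := congrArg (twist χ) hYa
    rwa [map_mul, twist_twist_inv] at this
  obtain ⟨r, hr⟩ := he.exists_mul_eq hYa (twist_ne_zero χ⁻¹ hY0)
  have hwY : twist χ r * e b * Y = twist χ (e a) := by
    rw [mul_assoc, hbY, ← hr, map_mul, twist_twist_inv]
  have hwb : twist χ r * e b * e b = twist χ r * e b := by rw [mul_assoc, he.idem]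
  set w := twist χ r * e b with hw
  -- Schur's lemma gives `Y w = c e_b`, and `(Y w) Y = Y (w Y) = Y` forces `c = 1`.
  have hYw : Y * w = e b := by
    obtain ⟨c, hc⟩ := he.exists_mul_mul_eq_smul b (Y * w)
    have hc' : Y * w = c • e b := by
      rw [← hc, ← mul_assoc (e b) Y w, hbY, mul_assoc Y w (e b), hwb]
    have h2 : c • Y = Y := by
      calc c • Y = (Y * w) * Y := by rw [hc', smul_mul_assoc, hbY]
        _ = Y := by rw [mul_assoc, hwY, hYa']
    have h3 : (c - 1) • Y = 0 := by rw [sub_smul, one_smul, h2, sub_self]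
    rw [hc', sub_eq_zero.1 ((smul_eq_zero.1 h3).resolve_right hY0), one_smul]
  refine ⟨χ, w, ?_, ?_, fun x hx h0 => h.injective x hx ?_, fun y hy => ?_⟩
  · rw [← twist_subgroupHom χ (f j), ← mul_assoc, ← map_mul, h.left]
  · rw [mul_assoc, hwb]
  · have h2 : twist χ (subgroupHom N x * u) = 0 := by
      calc twist χ (subgroupHom N x * u) = twist χ (subgroupHom N x * (u * e a)) := by rw [h.right]
        _ = subgroupHom N x * (twist χ u * w) * Y := by
          rw [map_mul, map_mul, twist_subgroupHom, ← hwY]; simp only [mul_assoc]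
        _ = 0 := by rw [h0, zero_mul]
    by_contra h3
    exact twist_ne_zero χ h3 h2
  · obtain ⟨x, hx, hxy⟩ := h.surjective (twist χ⁻¹ (y * Y)) (by
      rw [map_mul, mul_assoc, hYa])
    refine ⟨x, hx, ?_⟩
    have h2 := congrArg (twist χ) hxy
    rw [map_mul, twist_twist_inv, twist_subgroupHom] at h2
    rw [← mul_assoc, h2, mul_assoc, hYw, hy]

end IsRestriction

end Restriction

section Fibres

variable {G : Type*} [Group G] {N : Subgroup G} [N.Normal]
variable {I J : Type*} {e : I → MonoidAlgebra ℂ G} {f : J → MonoidAlgebra ℂ N}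
variable {p : I → J} {u : I → MonoidAlgebra ℂ G}

variable (u) in
/-- `ℂG e_b` is the twist of `ℂG e_a` by `χ`. -/
def IsTwist (χ : G ⧸ N →* ℂˣ) (a b : I) : Prop := ∃ w, twist χ (u a) * w = u b

theorem isTwist_one (a : I) : IsTwist (N := N) u 1 a a := ⟨1, by rw [twist_one, mul_one]⟩

theorem IsTwist.mul {χ χ' : G ⧸ N →* ℂˣ} {a b c : I} (h : IsTwist u χ a b)
    (h' : IsTwist u χ' b c) : IsTwist u (χ' * χ) a c := by
  obtain ⟨w, hw⟩ := h
  obtain ⟨w', hw'⟩ := h'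
  exact ⟨twist χ' w * w', by rw [twist_mul, ← mul_assoc, ← map_mul, hw, hw']⟩

/-- An element of `ℂG` that picks out the vertex `a`. -/
theorem exists_dual (he : IsBasicSystem e) (h : ∀ a, IsRestriction e f a (p a) (u a)) (a : I) :
    ∃ z, z * u a = e a ∧ ∀ b, b ≠ a → z * u b = 0 := by
  obtain ⟨x, hx⟩ := (h a).exists_mul_eq he
  refine ⟨e a * subgroupHom N x, by rw [mul_assoc, hx, he.idem], fun b hb => ?_⟩
  rw [← (h b).right, ← mul_assoc, mul_assoc (e a), mul_assoc (e a), ← mul_assoc, he.mul_mul_eq_zero hb.symm]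

/-- Twists fix `f_j`, so a twist of `u a` is still fixed by `f_{p a}` on the left, whereas `f_{p a}`
kills `u b` if `p a ≠ p b`. -/
theorem IsTwist.fibre_eq (he : IsBasicSystem e) (hf : IsBasicSystem f)
    (h : ∀ a, IsRestriction e f a (p a) (u a)) {χ : G ⧸ N →* ℂˣ} {a b : I}
    (hab : IsTwist u χ a b) : p a = p b := by
  by_contra hne
  apply (h b).ne_zero he
  obtain ⟨w, hw⟩ := hab
  rw [← (h b).mul_mul_eq_zero hf hne (u b) (h b).right]
  rw [← hw, ← mul_assoc, ← twist_subgroupHom χ, ← map_mul, (h a).left]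

/-- Some `twist χ (u a) * s m` is nonzero. It lies in the line `f_j ℂG e_{l m}` spanned by `u (l
m)`, so rescaling `s m` suffices. -/
theorem exists_isTwist [Finite G] (he : IsBasicSystem e) (hf : IsBasicSystem f)
    (h : ∀ a, IsRestriction e f a (p a) (u a)) (χ : G ⧸ N →* ℂˣ) (a : I) :
    ∃ b, IsTwist u χ a b := by
  obtain ⟨n, l, s, t, hs, ht, hst⟩ := he.exists_one_eq_sum
  have h1 : ∑ m, twist χ (u a) * s m * t m ≠ 0 := by
    simp only [mul_assoc]
    rw [← Finset.mul_sum, ← hst, mul_one]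
    exact twist_ne_zero χ ((h a).ne_zero he)
  obtain ⟨m, -, hm⟩ := Finset.exists_ne_zero_of_sum_ne_zero h1
  have hm0 := left_ne_zero_of_mul hm
  have hr : twist χ (u a) * s m * e (l m) = twist χ (u a) * s m := by rw [mul_assoc, hs]
  have hl : subgroupHom N (f (p a)) * (twist χ (u a) * s m) = twist χ (u a) * s m := by
    rw [← mul_assoc, ← twist_subgroupHom χ, ← map_mul, (h a).left]
  have hp : p a = p (l m) := by
    by_contra hne
    exact hm0 (hl.symm.trans ((h (l m)).mul_mul_eq_zero hf hne _ hr))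
  obtain ⟨c, hc⟩ := (h (l m)).exists_mul_eq_smul hf _ hr
  rw [← hp, hl] at hc
  have hc0 : c ≠ 0 := by
    rintro rfl
    exact hm0 (by rw [hc, zero_smul])
  exact ⟨l m, c⁻¹ • s m, by rw [mul_smul_comm, hc, smul_smul, inv_mul_cancel₀ hc0, one_smul]⟩

theorem exists_isTwist_of_fibre_eq [Finite G] (hN : HasEnoughCharacters N) (he : IsBasicSystem e)
    (hf : IsBasicSystem f) (h : ∀ a, IsRestriction e f a (p a) (u a)) {a b : I} (hab : p a = p b) :
    ∃ χ : G ⧸ N →* ℂˣ, IsTwist u χ a b := by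
  obtain ⟨χ, w, hw⟩ := (h a).exists_twist hN he hf (b := b) (y := u b)
    (by rw [hab]; exact (h b).left) (h b).right ((h b).ne_zero he)
  obtain ⟨c, hc⟩ := (h b).exists_mul_eq_smul hf _ hw.right
  rw [← hab, hw.left] at hc
  have hc0 : c ≠ 0 := by
    rintro rfl
    exact hw.ne_zero he (by rw [hc, zero_smul])
  exact ⟨χ, c⁻¹ • w, by rw [mul_smul_comm, hc, smul_smul, inv_mul_cancel₀ hc0, one_smul]⟩

/-- The twist of `S_a` is simple, so it cannot map nontrivially to two different vertices.
Concretely, a dual element for `b` pulls back to a nonzero `y` in `ℂG e_a`; `y` generates `e_a`,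
while its twist kills `u c`. -/
theorem IsTwist.unique (he : IsBasicSystem e) (h : ∀ a, IsRestriction e f a (p a) (u a))
    {χ : G ⧸ N →* ℂˣ} {a b c : I} (hab : IsTwist u χ a b) (hac : IsTwist u χ a c) : b = c := by
  by_contra hbc
  obtain ⟨w, hw⟩ := hab
  obtain ⟨w', hw'⟩ := hac
  obtain ⟨z, hz, hz0⟩ := exists_dual he h b
  set y := twist χ⁻¹ z * u a with hy
  have hy1 : twist χ y = z * twist χ (u a) := by rw [hy, map_mul, twist_twist_inv]
  have hy0 : y ≠ 0 := by
    intro h0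
    rw [h0, map_zero] at hy1
    apply he.ne_zero b
    rw [← hz, ← hw, ← mul_assoc, ← hy1, zero_mul]
  obtain ⟨r, hr⟩ := he.exists_mul_eq (i := a) (y := y) (by rw [hy, mul_assoc, (h a).right]) hy0
  apply (h c).ne_zero he
  have h1 : twist χ y * w' = 0 := by
    rw [hy1, mul_assoc, hw', hz0 c (Ne.symm hbc)]
  rw [← hw', ← (h a).right, ← hr, map_mul, map_mul, mul_assoc, mul_assoc, h1, mul_zero, mul_zero]

/-- This is the freeness of the action, and it rests on irreducibility over `N`: `g u_a = x u_a` for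
some `x` in `ℂN`. Twisting fixes `x` and scales `g`, so `χ g • (g u_a) = x u_a = g u_a`. -/
theorem IsTwist.eq_one (he : IsBasicSystem e) (h : ∀ a, IsRestriction e f a (p a) (u a))
    {χ : G ⧸ N →* ℂˣ} {a : I} (ha : IsTwist u χ a a) : χ = 1 := by
  obtain ⟨w, hw⟩ := ha
  ext g
  obtain ⟨x, -, hx⟩ := (h a).surjective (MonoidAlgebra.single g 1 * u a)
    (by rw [mul_assoc, (h a).right])
  have h1 := congrArg (fun y => twist χ y * w) hx
  simp only [map_mul, twist_subgroupHom, mul_assoc, hw, twist_single] at h1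
  rw [hx] at h1
  have h2 : ((χ g : ℂ) - 1) • (MonoidAlgebra.single g 1 * u a) = 0 := by
    rw [sub_smul, one_smul, sub_eq_zero]
    nth_rw 2 [h1]
    rw [← smul_mul_assoc]
    simp
  have h3 : MonoidAlgebra.single g 1 * u a ≠ 0 := by
    intro h0
    apply (h a).ne_zero he
    have := congrArg (MonoidAlgebra.single g⁻¹ 1 * ·) h0
    simpa [← mul_assoc, MonoidAlgebra.single_mul_single, ← MonoidAlgebra.one_def] using this
  exact sub_eq_zero.1 ((smul_eq_zero.1 h2).resolve_right h3)

end Fibres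
end

/-! ### Inclusion and twists on the skew group algebra. -/

noncomputable section

set_option linter.unusedSectionVars false

/-- The action of `Γ` on `⋀V`; for a subgroup it takes precedence over the restricted action. -/
abbrev exteriorDistribMulAction (V : Type*) [AddCommGroup V] [Module ℂ V] (Γ : Type*) [Group Γ]
    [DistribMulAction Γ V] [SMulCommClass Γ ℂ V] : DistribMulAction Γ (ExteriorAlgebra ℂ V) :=
  (exteriorAction V Γ).toDistribMulAction

attribute [local instance 2000] exteriorAction exteriorDistribMulAction

section SkewRestriction

variable {V : Type*} [AddCommGroup V] [Module ℂ V]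
variable {G : Type*} [Group G] [DistribMulAction G V] [SMulCommClass G ℂ V]
variable {N : Subgroup G}

theorem skewInclusion_single (g : N) (w : ExteriorAlgebra ℂ V) :
    skewInclusion N (SkewMonoidAlgebra.single g w) = SkewMonoidAlgebra.single (g : G) w :=
  SkewMonoidAlgebra.mapDomain_single

theorem skewInclusion_injective : Function.Injective (skewInclusion (V := V) N) := by
  intro x y h
  apply SkewMonoidAlgebra.coeff_injective
  have h' := congrArg SkewMonoidAlgebra.coeff h
  change (SkewMonoidAlgebra.mapDomain N.subtype x).coeff =
    (SkewMonoidAlgebra.mapDomain N.subtype y).coeff at h'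
  rw [SkewMonoidAlgebra.coeff_mapDomain, SkewMonoidAlgebra.coeff_mapDomain] at h'
  exact Finsupp.mapDomain_injective N.subtype_injective h'

theorem skewInclusion_smul (c : ℂ) (x : SkewExterior V N) :
    skewInclusion N (c • x) = c • skewInclusion N x := by
  induction x using SkewMonoidAlgebra.induction_on with
  | zero => simp
  | add a b ha hb => simp only [smul_add, map_add, ha, hb]
  | single g w => rw [SkewMonoidAlgebra.smul_single, skewInclusion_single, skewInclusion_single,
      SkewMonoidAlgebra.smul_single]

theorem skewInclusion_mul (x y : SkewExterior V N) :
    skewInclusion N (x * y) = skewInclusion N x * skewInclusion N y := map_mul _ x y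

theorem skewInclusion_groupAlgebraHom [N.Normal] (x : MonoidAlgebra ℂ N) :
    skewInclusion N (groupAlgebraHom V x) = groupAlgebraHom V (subgroupHom N x) := by
  induction x using MonoidAlgebra.induction_linear with
  | zero => simp
  | add a b ha hb => simp only [map_add, ha, hb]
  | single g c =>
    rw [groupAlgebraHom_single, skewInclusion_single, subgroupHom_single, groupAlgebraHom_single]

theorem skewInclusion_mem_degreeOne {x : SkewExterior V N} (hx : x ∈ degreeOne V N) :
    skewInclusion N x ∈ degreeOne V G := by
  induction hx using Submodule.span_induction with
  | mem x hx =>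
    obtain ⟨k, v, rfl⟩ := hx
    rw [skewInclusion_single]
    exact Submodule.subset_span ⟨k, v, rfl⟩
  | zero => rw [map_zero]; exact zero_mem _
  | add x y _ _ hx hy => rw [map_add]; exact add_mem hx hy
  | smul c x _ hx => rw [skewInclusion_smul]; exact Submodule.smul_mem _ _ hx

variable [N.Normal]

/-- The automorphism of `⋀V * G` given by a character of `G / N`. -/
def skewTwist (χ : G ⧸ N →* ℂˣ) : SkewExterior V G →+* SkewExterior V G :=
  SkewMonoidAlgebra.liftNCRingHom SkewMonoidAlgebra.singleOneRingHom
    ((groupAlgebraHom V).toMonoidHom.comp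
      ((twist χ).toMonoidHom.comp (MonoidAlgebra.of ℂ G))) fun {x y} => by
    change SkewMonoidAlgebra.single 1 (y • x) *
        groupAlgebraHom V (twist χ (MonoidAlgebra.single y 1)) =
      groupAlgebraHom V (twist χ (MonoidAlgebra.single y 1)) * SkewMonoidAlgebra.single 1 x
    rw [twist_single, groupAlgebraHom_single, SkewMonoidAlgebra.single_mul_single,
      SkewMonoidAlgebra.single_mul_single, one_mul, mul_one, one_smul, mul_one, Algebra.commutes]

theorem skewTwist_single (χ : G ⧸ N →* ℂˣ) (g : G) (w : ExteriorAlgebra ℂ V) :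
    skewTwist χ (SkewMonoidAlgebra.single g w) = SkewMonoidAlgebra.single g ((χ g : ℂ) • w) := by
  change SkewMonoidAlgebra.liftNC _ _ (SkewMonoidAlgebra.single g w) = _
  rw [SkewMonoidAlgebra.liftNC_single]
  change SkewMonoidAlgebra.single 1 w * groupAlgebraHom V (twist χ (MonoidAlgebra.single g 1)) = _
  rw [twist_single, groupAlgebraHom_single, SkewMonoidAlgebra.single_mul_single, one_mul, one_smul,
    mul_one, ← Algebra.commutes, ← Algebra.smul_def]

theorem skewTwist_groupAlgebraHom (χ : G ⧸ N →* ℂˣ) (x : MonoidAlgebra ℂ G) :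
    skewTwist χ (groupAlgebraHom V x) = groupAlgebraHom V (twist χ x) := by
  induction x using MonoidAlgebra.induction_linear with
  | zero => simp
  | add a b ha hb => simp only [map_add, ha, hb]
  | single g c =>
    rw [groupAlgebraHom_single, skewTwist_single, twist_single, groupAlgebraHom_single, map_mul,
      Algebra.smul_def]

theorem skewTwist_skewInclusion (χ : G ⧸ N →* ℂˣ) (x : SkewExterior V N) :
    skewTwist χ (skewInclusion N x) = skewInclusion N x := by
  induction x using SkewMonoidAlgebra.induction_on with
  | zero => simp
  | add a b ha hb => simp only [map_add, ha, hb]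
  | single g w =>
    rw [skewInclusion_single, skewTwist_single, (QuotientGroup.eq_one_iff (g : G)).2 g.2]
    simp

variable {I J : Type*} {e : I → MonoidAlgebra ℂ G} {f : J → MonoidAlgebra ℂ N}

/-- With `f_j = ∑ twist χ (u q)`, one has `z = z f_j = ∑ skewTwist χ (z u q)`, because twists fix
`z`. Thus identities over `N` may be checked after multiplication by `u`. -/
theorem IsRestriction.eq_zero_of_skewInclusion_mul_eq_zero [Finite G]
    (hN : HasEnoughCharacters N) (he : IsBasicSystem e) (hf : IsBasicSystem f)
    {a : I} {j : J} {u : MonoidAlgebra ℂ G} (h : IsRestriction e f a j u) {z : SkewExterior V N}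
    (hz : z * groupAlgebraHom V (f j) = z)
    (h0 : skewInclusion N z * groupAlgebraHom V u = 0) : z = 0 := by
  have := hN.finite
  have := Fintype.ofFinite (G ⧸ N →* ℂˣ)
  obtain ⟨q, hq⟩ := IsRestriction.exists_sum_twist_eq hN hf h.left (h.ne_zero he)
  apply skewInclusion_injective (N := N)
  rw [map_zero, ← hz, skewInclusion_mul, skewInclusion_groupAlgebraHom, ← hq, map_sum, Finset.mul_sum]
  refine Finset.sum_eq_zero fun χ _ => ?_
  rw [← skewTwist_groupAlgebraHom, ← skewTwist_skewInclusion χ, ← map_mul, map_mul _ u q,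
    ← mul_assoc, h0, zero_mul, map_zero]

/-- The counterpart of `Ind S_j` being the sum of the `S_c` over the fibre of `j`: in `f_j = ∑ f_j
s_m t_m` each `f_j s_m` is either zero or a multiple of `u (l m)`. -/
theorem subgroupHom_mem_span [Finite G] (he : IsBasicSystem e) (hf : IsBasicSystem f)
    {p : I → J} {u : I → MonoidAlgebra ℂ G}
    (h : ∀ a, IsRestriction e f a (p a) (u a)) (j : J) :
    subgroupHom N (f j) ∈ Submodule.span ℂ {x | ∃ c t, p c = j ∧ e c * t = t ∧ x = u c * t} := by
  obtain ⟨n, l, s, t, hs, ht, hst⟩ := he.exists_one_eq_sum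
  rw [← mul_one (subgroupHom N (f j)), hst, Finset.mul_sum]
  refine sum_mem fun m _ => ?_
  rw [← mul_assoc]
  by_cases hj : p (l m) = j
  · obtain ⟨c, hc⟩ := (h (l m)).exists_mul_eq_smul hf (s m) (hs m)
    rw [← hj, hc, smul_mul_assoc]
    exact Submodule.smul_mem _ _ (Submodule.subset_span ⟨l m, t m, rfl, ht m, rfl⟩)
  · rw [(h (l m)).mul_mul_eq_zero hf (Ne.symm hj) (s m) (hs m), zero_mul]
    exact zero_mem _

/-- `(V * G) e_a = (V * N) f_j u`. -/
theorem IsRestriction.exists_degreeOne (he : IsBasicSystem e) {a : I} {j : J}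
    {u : MonoidAlgebra ℂ G} (h : IsRestriction e f a j u) {x : SkewExterior V G}
    (hx : x ∈ degreeOne V G) (hxa : x * groupAlgebraHom V (e a) = x) :
    ∃ z ∈ degreeOne V N, z * groupAlgebraHom V (f j) = z ∧
      skewInclusion N z * groupAlgebraHom V u = x := by
  rw [← hxa]
  clear hxa
  refine degreeOne_induction (C := fun x => ∃ z ∈ degreeOne V N, z * groupAlgebraHom V (f j) = z ∧
      skewInclusion N z * groupAlgebraHom V u = x * groupAlgebraHom V (e a)) hx
      ⟨0, zero_mem _, by simp, by simp⟩ ?_ ?_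
  · rintro x y ⟨z, hz, hz1, hz2⟩ ⟨z', hz', hz1', hz2'⟩
    exact ⟨z + z', add_mem hz hz', by rw [add_mul, hz1, hz1'],
      by rw [map_add, add_mul, hz2, hz2', add_mul]⟩
  · intro v r
    obtain ⟨x, hx, hxr⟩ := h.surjective (r * e a) (by rw [mul_assoc, he.idem])
    refine ⟨vecHom V N v * groupAlgebraHom V x,
      mul_groupAlgebraHom_mem_degreeOne _ (vecHom_mem_degreeOne v), ?_, ?_⟩
    · rw [mul_assoc, ← map_mul, hx]
    · have h1 : skewInclusion N (vecHom V N v) = vecHom V G v := skewInclusion_single 1 _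
      rw [skewInclusion_mul, skewInclusion_groupAlgebraHom, mul_assoc, mul_assoc, ← map_mul, ← map_mul, hxr, h1]

/-- The isomorphism behind `IsTwist` is inverted by twisting `b` back with `χ⁻¹`, which by
uniqueness leads to `a`. -/
theorem IsTwist.exists_mul_eq [Finite G] {u : I → MonoidAlgebra ℂ G} {p : I → J} (he : IsBasicSystem e)
    (hf : IsBasicSystem f) (h : ∀ a, IsRestriction e f a (p a) (u a)) {χ : G ⧸ N →* ℂˣ} {a b : I}
    (hab : IsTwist u χ a b) : ∃ w, u b * w = twist χ (u a) := by
  obtain ⟨c, hc⟩ := exists_isTwist he hf h χ⁻¹ b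
  have h1 := hab.mul hc
  rw [show χ⁻¹ * χ = 1 from inv_mul_cancel χ] at h1
  obtain rfl := IsTwist.unique he h h1 (isTwist_one a)
  obtain ⟨w, hw⟩ := hc
  exact ⟨twist χ w, by rw [← hw, map_mul, twist_twist_inv]⟩

theorem surjective_of_isRestriction [Finite G] {u : I → MonoidAlgebra ℂ G} {p : I → J}
    (he : IsBasicSystem e) (hf : IsBasicSystem f)
    (h : ∀ a, IsRestriction e f a (p a) (u a)) : Function.Surjective p := by
  intro j
  by_contra hj
  have h1 := subgroupHom_mem_span he hf h j
  have h2 : {x | ∃ c t, p c = j ∧ e c * t = t ∧ x = u c * t} = ∅ := by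
    ext x
    simp only [Set.mem_ofPred_eq, Set.mem_empty_iff_false, iff_false]
    rintro ⟨c, t, hc, -⟩
    exact hj ⟨c, hc⟩
  rw [h2, Submodule.span_empty, Submodule.mem_bot] at h1
  exact hf.ne_zero j (subgroupHom_injective N (h1.trans (map_zero _).symm))

end SkewRestriction
end

/-! ### Unique path lifting and deck transformations. -/

noncomputable section

set_option linter.unusedSectionVars false

namespace QuiverPath

variable {Q Q' : Type*} [Quiver Q] [Quiver Q']

/-- An arrow as a path. -/
def ofArrow {a b : Q} (α : a ⟶ b) : QuiverPath Q := ⟨a, b, α.toPath⟩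

theorem mk_eq_mk_iff {a b b' : Q} {p : Quiver.Path a b} {p' : Quiver.Path a b'} :
    QuiverPath.mk a b p = ⟨a, b', p'⟩ ↔ (⟨b, p⟩ : Quiver.PathStar a) = ⟨b', p'⟩ := by
  constructor
  · intro h
    injection h with _ h₂ h₃
    subst h₂
    rw [eq_of_heq h₃]
  · intro h
    cases h
    rfl

theorem toPath_injective {a b : Q} {α β : a ⟶ b} (h : α.toPath = β.toPath) : α = β := by
  injection h

theorem ofArrow_eq_iff_star {a b b' : Q} {α : a ⟶ b} {α' : a ⟶ b'} :
    ofArrow α = ofArrow α' ↔ (⟨b, α⟩ : Quiver.Star a) = ⟨b', α'⟩ := by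
  constructor
  · intro h
    injection h with _ h₂ h₃
    subst h₂
    rw [toPath_injective (eq_of_heq h₃)]
  · intro h
    cases h
    rfl

theorem ofArrow_eq_iff_costar {a a' b : Q} {α : a ⟶ b} {α' : a' ⟶ b} :
    ofArrow α = ofArrow α' ↔ (⟨a, α⟩ : Quiver.Costar b) = ⟨a', α'⟩ := by
  constructor
  · intro h
    injection h with h₂ _ h₃
    subst h₂
    rw [toPath_injective (eq_of_heq h₃)]
  · intro h
    cases h
    rfl

/-- Arrows and paths over a given one have end points that agree only propositionally. Comparing
them bundled with their end points, as `QuiverPath`, avoids transport along these equalities. -/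
theorem cons_congr {a b c a' b' c' : Q} {p : Quiver.Path a b} {α : b ⟶ c} {p' : Quiver.Path a' b'}
    {α' : b' ⟶ c'} (h : QuiverPath.mk a b p = ⟨a', b', p'⟩) (hα : ofArrow α = ofArrow α') :
    QuiverPath.mk a c (p.cons α) = ⟨a', c', p'.cons α'⟩ := by
  injection hα with h₁ h₂ h₃
  subst h₁ h₂
  injection h with h₁ _ h₂
  subst h₁
  rw [toPath_injective (eq_of_heq h₃), eq_of_heq h₂]

theorem prefunctor_ext {F G : Q ⥤q Q'} (hobj : ∀ a, F.obj a = G.obj a)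
    (h : ∀ {a b : Q} (α : a ⟶ b), ofArrow (F.map α) = ofArrow (G.map α)) : F = G := by
  obtain ⟨Fobj, Fmap⟩ := F
  obtain ⟨Gobj, Gmap⟩ := G
  obtain rfl : Fobj = Gobj := funext hobj
  congr 1
  funext a b α
  have h' := h α
  injection h' with _ _ h₃
  exact toPath_injective h₃

theorem length_map (π : Q ⥤q Q') (p : QuiverPath Q) :
    (p.map π).path.length = p.path.length := by
  obtain ⟨a, b, p⟩ := p
  change (π.mapPath p).length = p.length
  induction p with
  | nil => rfl
  | cons p α ih => rw [Prefunctor.mapPath_cons, Quiver.Path.length_cons, ih, Quiver.Path.length_cons]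

theorem map_after (π : Q ⥤q Q') (p q : QuiverPath Q) (h : p.src = q.tgt) :
    (p.after q h).map π = (p.map π).after (q.map π) (congrArg π.obj h) := by
  obtain ⟨a, b, p⟩ := p
  obtain ⟨c, d, q⟩ := q
  dsimp only at h
  subst h
  simp only [after, map, Quiver.Path.cast_rfl_rfl]
  rw [Prefunctor.mapPath_comp]

variable {π : Q ⥤q Q'}

theorem eq_of_map_eq (hπ : ∀ a, Function.Bijective (π.star a)) {p q : QuiverPath Q}
    (h : p.src = q.src) (hm : p.map π = q.map π) : p = q := by
  obtain ⟨a, b, p⟩ := p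
  obtain ⟨c, d, q⟩ := q
  dsimp only at h
  subst h
  exact mk_eq_mk_iff.2 ((π.pathStar_bijective hπ a).1 (mk_eq_mk_iff.1 hm))

theorem exists_lift (hπ : ∀ a, Function.Bijective (π.star a)) (p : QuiverPath Q') (a : Q)
    (ha : π.obj a = p.src) : ∃ q : QuiverPath Q, q.src = a ∧ q.map π = p := by
  obtain ⟨i, j, p⟩ := p
  dsimp only at ha
  subst ha
  obtain ⟨⟨b, q⟩, hq⟩ := (π.pathStar_bijective hπ a).2 ⟨j, p⟩
  exact ⟨⟨a, b, q⟩, rfl, mk_eq_mk_iff.2 hq⟩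

theorem exists_lift_arrow (hπ : ∀ a, Function.Bijective (π.star a)) {i j : Q'} (β : i ⟶ j) (a : Q)
    (ha : π.obj a = i) : ∃ (b : Q) (α : a ⟶ b), ofArrow (π.map α) = ofArrow β := by
  subst ha
  obtain ⟨⟨b, α⟩, h⟩ := (hπ a).2 ⟨j, β⟩
  exact ⟨b, α, ofArrow_eq_iff_star.2 h⟩

theorem eq_of_map_arrow_eq (hπ : ∀ a, Function.Bijective (π.star a)) {a b a' b' : Q}
    {α : a ⟶ b} {α' : a' ⟶ b'} (h : a = a')
    (hm : ofArrow (π.map α) = ofArrow (π.map α')) : ofArrow α = ofArrow α' :=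
  eq_of_map_eq hπ h hm

end QuiverPath

section DeckTransformations

open QuiverPath

variable {Q Q' : Type*} [Quiver Q] [Quiver Q'] {π : Q ⥤q Q'} {K : Type*} [Group K]

/-- `K` acts on the vertices of `Q`, freely and transitively on the fibres of `π`, so that the
arrows over a given arrow are permuted. -/
structure IsDeckAction (π : Q ⥤q Q') (act : K → Q → Q) : Prop where
  one : ∀ a, act 1 a = a
  mul : ∀ x y a, act (x * y) a = act x (act y a)
  obj : ∀ x a, π.obj (act x a) = π.obj a
  transitive : ∀ a b, π.obj a = π.obj b → ∃ x, act x a = b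
  free : ∀ x a, act x a = a → x = 1
  arrow : ∀ x {a b : Q} (α : a ⟶ b), ∃ α' : act x a ⟶ act x b,
    ofArrow (π.map α') = ofArrow (π.map α)

namespace IsDeckAction

variable {act : K → Q → Q}

theorem path (h : IsDeckAction π act) (x : K) (p : QuiverPath Q) :
    ∃ q : QuiverPath Q, q.src = act x p.src ∧ q.tgt = act x p.tgt ∧ q.map π = p.map π := by
  obtain ⟨a, b, p⟩ := p
  induction p with
  | nil =>
    refine ⟨⟨act x a, act x a, Quiver.Path.nil⟩, rfl, rfl, ?_⟩
    simp only [QuiverPath.map, Prefunctor.mapPath_nil]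
    rw [h.obj]
  | @cons b c p α ih =>
    obtain ⟨⟨a', b', q⟩, h₁, h₂, h₃⟩ := ih
    dsimp only at h₁ h₂
    subst h₁ h₂
    obtain ⟨α', hα⟩ := h.arrow x α
    exact ⟨⟨act x a, act x c, q.cons α'⟩, rfl, rfl, cons_congr h₃ hα⟩

/-- Bijectivity on incoming arrows follows from that on outgoing ones. A lift ending elsewhere in
the fibre is moved to `c` by a deck transformation; and if two lifts both end at `c`, the
transformation relating their sources fixes `c`, hence is `1`. -/
theorem isCovering (h : IsDeckAction π act) (hs : Function.Surjective π.obj)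
    (hπ : ∀ a, Function.Bijective (π.star a)) : π.IsCovering := by
  refine ⟨hπ, fun c => ⟨?_, ?_⟩⟩
  · rintro ⟨a, α⟩ ⟨a', α'⟩ hαα
    have h1 : ofArrow (π.map α) = ofArrow (π.map α') := ofArrow_eq_iff_costar.2 hαα
    obtain ⟨x, rfl⟩ := h.transitive a a' (congrArg QuiverPath.src h1)
    obtain ⟨α'', h2⟩ := h.arrow x α
    have h3 := eq_of_map_arrow_eq hπ rfl (h2.trans h1)
    have h4 := h.free x c (congrArg QuiverPath.tgt h3)
    exact ofArrow_eq_iff_costar.1 (eq_of_map_arrow_eq hπ (by rw [h4, h.one]) h1)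
  · rintro ⟨j, β⟩
    obtain ⟨a, ha⟩ := hs j
    obtain ⟨c', α, hα⟩ := exists_lift_arrow hπ β a ha
    obtain ⟨x, rfl⟩ := h.transitive c' c (congrArg QuiverPath.tgt hα)
    obtain ⟨α', hα'⟩ := h.arrow x α
    exact ⟨⟨act x a, α'⟩, ofArrow_eq_iff_costar.1 (hα'.trans hα)⟩

/-- The arrow maps are chosen separately for each element of `K`; unique lifting makes the choices
compatible with composition. -/
theorem isRegularCovering (h : IsDeckAction π act) (hs : Function.Surjective π.obj)
    (hπ : ∀ a, Function.Bijective (π.star a)) : IsRegularCovering K π := by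
  refine ⟨h.isCovering hs hπ, hs, ?_⟩
  choose T hT using fun x a b α => h.arrow x (a := a) (b := b) α
  refine ⟨fun x => ⟨act x, fun {a b} α => T x a b α⟩, ?_, ?_, ?_, ?_⟩
  · exact prefunctor_ext h.one fun α => eq_of_map_arrow_eq hπ (h.one _) (hT _ _ _ _)
  · intro x y
    refine prefunctor_ext (h.mul x y) fun {a b} α => eq_of_map_arrow_eq hπ (h.mul x y a) ?_
    exact (hT _ _ _ _).trans ((hT x _ _ (T y a b α)).trans (hT y _ _ _)).symm
  · intro x
    exact prefunctor_ext (h.obj x) fun α => hT x _ _ α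
  · intro a b hab
    obtain ⟨x, hx⟩ := h.transitive a b hab
    refine ⟨x, hx, fun y hy => ?_⟩
    have h1 : act (x⁻¹ * y) a = a := by
      change act y a = b at hy
      rw [h.mul, hy, ← hx, ← h.mul, inv_mul_cancel, h.one]
    exact (inv_mul_eq_one.1 (h.free _ _ h1)).symm

theorem congr {K' : Type*} [Group K'] (h : IsDeckAction π act) (ε : K' ≃* K) :
    IsDeckAction π fun x => act (ε x) where
  one a := by rw [map_one, h.one]
  mul x y a := by rw [map_mul, h.mul]
  obj x a := h.obj _ a
  transitive a b hab := by
    obtain ⟨x, hx⟩ := h.transitive a b hab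
    exact ⟨ε.symm x, by rw [ε.apply_symm_apply, hx]⟩
  free x a ha := (map_eq_one_iff ε ε.injective).1 (h.free _ _ ha)
  arrow x _ _ α := h.arrow (ε x) α

end IsDeckAction

end DeckTransformations
end

/-! ### The morphism given by restriction is a covering. -/

noncomputable section

set_option linter.unusedSectionVars false

attribute [local instance 2000] exteriorAction exteriorDistribMulAction

open QuiverPath PathAlgebra

section RestrictionCovering

variable {V : Type*} [AddCommGroup V] [Module ℂ V]
variable {G : Type*} [Group G] [Finite G] [DistribMulAction G V] [SMulCommClass G ℂ V]
variable {N : Subgroup G} [N.Normal]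
variable {I J : Type*} [Fintype I] [Fintype J]
variable {e : I → MonoidAlgebra ℂ G} {f : J → MonoidAlgebra ℂ N}

/-- `π` is given by restriction, by means of the isomorphisms `x ↦ x u_a`. -/
structure IsRestrictionAlong (φ : ArrowRealization V e) (ψ : ArrowRealization V f)
    (π : McKayQuiver V e ⥤q McKayQuiver V f) (u : McKayQuiver V e → MonoidAlgebra ℂ G) : Prop where
  restriction : ∀ a : McKayQuiver V e, IsRestriction e f a (π.obj a) (u a)
  arrow : ∀ {a b : McKayQuiver V e} (α : a ⟶ b),
    skewInclusion N (ψ.val (PathAlgebra.arrow (π.map α))) * groupAlgebraHom V (u a) =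
      groupAlgebraHom V (u b) * φ.val (PathAlgebra.arrow α)

theorem IsRestrictionMap.exists_along {φ : ArrowRealization V e} {ψ : ArrowRealization V f}
    {π : McKayQuiver V e ⥤q McKayQuiver V f} (he : IsBasicSystem e) (hf : IsBasicSystem f)
    (h : IsRestrictionMap φ ψ π) : ∃ u, IsRestrictionAlong φ ψ π u := by
  obtain ⟨u, h₁, h₂, h₃⟩ := h
  exact ⟨u, fun a => IsRestriction.of_bijOn he hf (h₁ a) (h₂ a), fun {a b} α => h₃ a b α⟩

theorem IsRestrictionAlong.isRestrictionMap {φ : ArrowRealization V e} {ψ : ArrowRealization V f}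
    {π : McKayQuiver V e ⥤q McKayQuiver V f} {u : McKayQuiver V e → MonoidAlgebra ℂ G}
    (he : IsBasicSystem e) (hf : IsBasicSystem f)
    (h : IsRestrictionAlong φ ψ π u) : IsRestrictionMap φ ψ π :=
  ⟨u, fun a => (h.restriction a).left, fun a => (h.restriction a).bijOn he hf,
    fun _ _ α => h.arrow α⟩

namespace IsRestrictionAlong

variable {φ : ArrowRealization V e} {ψ : ArrowRealization V f}
variable {π : McKayQuiver V e ⥤q McKayQuiver V f} {u : McKayQuiver V e → MonoidAlgebra ℂ G}

theorem surjective_obj (he : IsBasicSystem e) (hf : IsBasicSystem f)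
    (h : IsRestrictionAlong φ ψ π u) : Function.Surjective π.obj :=
  surjective_of_isRestriction he hf h.restriction

/-- Arrows over the same arrow that start at vertices related by a twist end at vertices related by
this twist. -/
theorem isTwist_tgt (he : IsBasicSystem e) (hf : IsBasicSystem f)
    (h : IsRestrictionAlong φ ψ π u) {χ : G ⧸ N →* ℂˣ} {a a' b b' : McKayQuiver V e}
    {α : a ⟶ b} {α' : a' ⟶ b'} (ha : IsTwist u χ a a')
    (hα : ofArrow (π.map α) = ofArrow (π.map α')) : IsTwist u χ b b' := by
  obtain ⟨w, hw⟩ := ha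
  obtain ⟨b₁, hb₁⟩ := exists_isTwist he hf h.restriction χ b
  obtain ⟨w', h1⟩ := hb₁.exists_mul_eq he hf h.restriction
  have hψ : ψ.val (PathAlgebra.arrow (π.map α)) = ψ.val (PathAlgebra.arrow (π.map α')) :=
    congrArg (fun p => ψ.val (ofPath p)) hα
  -- Apply `skewTwist χ` to the identity for `α`: it fixes the common image in `V * N` and turns `u
  -- a`, `u b` into multiples of `u a'`, `u b₁`.
  have h2 : groupAlgebraHom V (u b') * φ.val (PathAlgebra.arrow α') = groupAlgebraHom V (u b₁) *
      (groupAlgebraHom V w' * skewTwist χ (φ.val (PathAlgebra.arrow α)) *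
        groupAlgebraHom V w) := by
    rw [← h.arrow α', ← hψ, ← hw, map_mul, ← mul_assoc, ← skewTwist_groupAlgebraHom,
      ← skewTwist_skewInclusion χ (ψ.val _), ← map_mul, h.arrow α, map_mul,
      skewTwist_groupAlgebraHom, ← h1, map_mul]
    simp only [mul_assoc]
  by_cases hb : b' = b₁
  · rw [hb]; exact hb₁
  exfalso
  -- If `b' ≠ b₁`, the dual element at `b'` kills the right side of `h2` and leaves `φ.val (arrow
  -- α')` on the left, which is nonzero.
  obtain ⟨z, hz, hz0⟩ := exists_dual he h.restriction b'
  apply φ.val_arrow_ne_zero α'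
  have h3 := congrArg (fun y => groupAlgebraHom V z * y) h2
  rw [← mul_assoc, ← mul_assoc, ← map_mul, ← map_mul, hz, hz0 b₁ (Ne.symm hb), map_zero,
    zero_mul] at h3
  rw [← h3]
  exact (φ.vertex_mul_val (ofPath_mem_pathSpace ⟨rfl, rfl⟩)).symm

/-- Two arrows from `a` with the same image have the same target, by the twist with the trivial
character. A dual element cancels `u b`, so they have the same realization, and linear independence
applies. -/
theorem star_injective (he : IsBasicSystem e) (hf : IsBasicSystem f)
    (h : IsRestrictionAlong φ ψ π u) (a : McKayQuiver V e) :
    Function.Injective (π.star a) := by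
  rintro ⟨b, α⟩ ⟨b', α'⟩ hαα
  have h1 : ofArrow (π.map α) = ofArrow (π.map α') := ofArrow_eq_iff_star.2 hαα
  obtain rfl : b = b' := IsTwist.unique he h.restriction (isTwist_one (N := N) b)
    (h.isTwist_tgt he hf (isTwist_one a) h1)
  have hψ : ψ.val (PathAlgebra.arrow (π.map α)) = ψ.val (PathAlgebra.arrow (π.map α')) :=
    congrArg (fun p => ψ.val (ofPath p)) h1
  obtain ⟨z, hz, -⟩ := exists_dual he h.restriction b
  have h2 := (h.arrow α).symm.trans ((congrArg (fun y => skewInclusion N y *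
    groupAlgebraHom V (u a)) hψ).trans (h.arrow α'))
  have h3 := congrArg (fun y => groupAlgebraHom V z * y) h2
  rw [← mul_assoc, ← mul_assoc, ← map_mul, hz] at h3
  have h4 := fun α : a ⟶ b => φ.vertex_mul_val (x := PathAlgebra.arrow α) (i := a) (j := b)
    (ofPath_mem_pathSpace ⟨rfl, rfl⟩)
  rw [(φ.linearIndependent a b).injective ((h4 α).symm.trans (h3.trans (h4 α')))]

theorem star_surjective (hN : HasEnoughCharacters N) (he : IsBasicSystem e) (hf : IsBasicSystem f)
    (h : IsRestrictionAlong φ ψ π u) (a : McKayQuiver V e) :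
    Function.Surjective (π.star a) := by
  rintro ⟨j, β⟩
  -- `S` consists of the arrows that lift. Since the realizations of arrows are independent, it
  -- suffices that `ψ.val (arrow β)` lies in the span `M` of those in `S`. This is checked after
  -- multiplication by `u a`.
  set S : Set (π.obj a ⟶ j) := {β | ∃ (b : McKayQuiver V e) (α : a ⟶ b),
    ofArrow (π.map α) = ofArrow β} with hS
  have hβS : β ∈ S := by
    by_contra hβ
    refine (ψ.linearIndependent (π.obj a) j).notMem_span_image hβ ?_
    set M := Submodule.span ℂ ((fun β : π.obj a ⟶ j => (ψ.toHom (PathAlgebra.arrow β) :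
      SkewExterior V N)) '' S) with hM
    change ψ.val (PathAlgebra.arrow β) ∈ M
    set x := skewInclusion N (ψ.val (PathAlgebra.arrow β)) * groupAlgebraHom V (u a) with hx
    have hxd : x ∈ degreeOne V G :=
      mul_groupAlgebraHom_mem_degreeOne _ (skewInclusion_mem_degreeOne
        ((mem_arrowSpace_iff hf).1 (ψ.val_arrow_mem β)).1)
    have hxa : x * groupAlgebraHom V (e a) = x := by
      rw [hx, mul_assoc, ← map_mul, (h.restriction a).right]
    -- Each `t' x`, for `e c * t' = t'`, lies in `e_c (V * G) e_a`, so it is a combination of arrows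
    -- `α : a ⟶ c`; and `u c` times such an arrow is the image of `α` times `u a`. Since `f_j` is a
    -- sum of elements `u c * t'`, this covers `f_j x = x`.
    have key : ∀ t ∈ Submodule.span ℂ {x | ∃ c t, π.obj c = j ∧ e c * t = t ∧ x = u c * t},
        ∃ y ∈ M, skewInclusion N y * groupAlgebraHom V (u a) = groupAlgebraHom V t * x := by
      intro t ht
      induction ht using Submodule.span_induction with
      | zero => exact ⟨0, zero_mem _, by rw [map_zero, zero_mul, map_zero, zero_mul]⟩
      | add t t' _ _ ht ht' =>
        obtain ⟨y, hy, hyt⟩ := ht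
        obtain ⟨y', hy', hyt'⟩ := ht'
        exact ⟨y + y', add_mem hy hy', by rw [map_add, add_mul, hyt, hyt', map_add, add_mul]⟩
      | smul r t _ ht =>
        obtain ⟨y, hy, hyt⟩ := ht
        exact ⟨r • y, Submodule.smul_mem _ _ hy, by
          rw [skewInclusion_smul, smul_mul_assoc, hyt, map_smul, smul_mul_assoc]⟩
      | mem t ht =>
        obtain ⟨c, t, rfl, hct, rfl⟩ := ht
        have h1 : groupAlgebraHom V t * x ∈ arrowSpace V e a c := by
          refine (mem_arrowSpace_iff he).2 ⟨groupAlgebraHom_mul_mem_degreeOne _ hxd, ?_, ?_⟩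
          · rw [← mul_assoc, ← map_mul, hct]
          · rw [mul_assoc, hxa]
        rw [map_mul, mul_assoc]
        have h2 := (φ.span_eq a c).symm ▸ h1
        clear h1
        generalize groupAlgebraHom V t * x = s at h2
        induction h2 using Submodule.span_induction with
        | zero => exact ⟨0, zero_mem _, by rw [map_zero, zero_mul, mul_zero]⟩
        | add t t' _ _ ht ht' =>
          obtain ⟨y, hy, hyt⟩ := ht
          obtain ⟨y', hy', hyt'⟩ := ht'
          exact ⟨y + y', add_mem hy hy', by rw [map_add, add_mul, hyt, hyt', mul_add]⟩
        | smul r t _ ht =>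
          obtain ⟨y, hy, hyt⟩ := ht
          exact ⟨r • y, Submodule.smul_mem _ _ hy, by
            rw [skewInclusion_smul, smul_mul_assoc, hyt, mul_smul_comm]⟩
        | mem t ht =>
          obtain ⟨α, rfl⟩ := ht
          exact ⟨ψ.val (PathAlgebra.arrow (π.map α)),
            Submodule.subset_span ⟨π.map α, ⟨c, α, rfl⟩, rfl⟩, h.arrow α⟩
    obtain ⟨y, hy, hyx⟩ := key _ (subgroupHom_mem_span he hf h.restriction j)
    have hβ1 := (mem_arrowSpace_iff hf).1 (ψ.val_arrow_mem β)
    have hya : y * groupAlgebraHom V (f (π.obj a)) = y := by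
      have h1 : M ≤ arrowSpace V f (π.obj a) j := by
        rw [hM, ← ψ.span_eq]
        exact Submodule.span_mono (Set.image_subset_range _ _)
      exact ((mem_arrowSpace_iff hf).1 (h1 hy)).2.2
    have h0 : ψ.val (PathAlgebra.arrow β) - y = 0 := by
      refine (h.restriction a).eq_zero_of_skewInclusion_mul_eq_zero hN he hf ?_ ?_
      · rw [sub_mul, hya, hβ1.2.2]
      · rw [map_sub, sub_mul, hyx, ← skewInclusion_groupAlgebraHom, ← hx, hx, ← mul_assoc,
          ← skewInclusion_mul, hβ1.2.1, sub_self]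
    rw [sub_eq_zero.1 h0]
    exact hy
  obtain ⟨b, α, hα⟩ := hβS
  exact ⟨⟨b, α⟩, ofArrow_eq_iff_star.1 hα⟩

theorem exists_isDeckAction (hN : HasEnoughCharacters N) (he : IsBasicSystem e)
    (hf : IsBasicSystem f) (h : IsRestrictionAlong φ ψ π u) :
    ∃ act : (G ⧸ N →* ℂˣ) → McKayQuiver V e → McKayQuiver V e, IsDeckAction π act := by
  choose act hact using fun (χ : G ⧸ N →* ℂˣ) (a : McKayQuiver V e) =>
    exists_isTwist he hf h.restriction χ a
  have huniq : ∀ {χ : G ⧸ N →* ℂˣ} {a b : McKayQuiver V e}, IsTwist u χ a b → act χ a = b :=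
    fun hab => IsTwist.unique he h.restriction (hact _ _) hab
  refine ⟨act, fun a => huniq (isTwist_one a), fun x y a => huniq ((hact y a).mul (hact x _)),
    fun x a => (IsTwist.fibre_eq he hf h.restriction (hact x a)).symm, fun a b hab => ?_,
    fun x a ha => ?_, fun x a b α => ?_⟩
  · obtain ⟨χ, hχ⟩ := exists_isTwist_of_fibre_eq hN he hf h.restriction hab
    exact ⟨χ, huniq hχ⟩
  · have h1 := hact x a
    rw [ha] at h1
    exact IsTwist.eq_one he h.restriction h1
  · obtain ⟨b', α', hα'⟩ := exists_lift_arrow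
      (fun a => ⟨h.star_injective he hf a, h.star_surjective hN he hf a⟩) (π.map α) (act x a)
      (IsTwist.fibre_eq he hf h.restriction (hact x a)).symm
    obtain rfl := huniq (h.isTwist_tgt he hf (hact x a) hα'.symm)
    exact ⟨α', hα'⟩

/-- The identity between an arrow and its image, for arbitrary combinations of paths. -/
theorem val_map (h : IsRestrictionAlong φ ψ π u) {a c : McKayQuiver V e}
    {x : PathAlgebra (McKayQuiver V e)} (hx : x ∈ pathSpace fun p => p.src = a ∧ p.tgt = c) :
    skewInclusion N (ψ.val (PathAlgebra.map π x)) * groupAlgebraHom V (u a) =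
      groupAlgebraHom V (u c) * φ.val x := by
  refine pathSpace_induction (C := fun x => skewInclusion N (ψ.val (PathAlgebra.map π x)) *
    groupAlgebraHom V (u a) = groupAlgebraHom V (u c) * φ.val x) hx ?_ ?_ ?_
  · simp only [map_zero, zero_mul, mul_zero]
  · intro x y hx hy
    simp only [map_add, add_mul, mul_add, hx, hy]
  · rintro r ⟨a', c', p⟩ ⟨rfl, rfl⟩
    have h0 : ∀ p : QuiverPath (McKayQuiver V e), PathAlgebra.map π (ofPath p) = ofPath (p.map π) :=
      fun p => Finsupp.mapDomain_single
    rw [map_smul, map_smul, skewInclusion_smul, map_smul, smul_mul_assoc, mul_smul_comm]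
    congr 1
    dsimp only
    rw [h0]
    clear hx
    induction p with
    | nil =>
      have h1 : ψ.val (ofPath (QuiverPath.map π ⟨a', a', Quiver.Path.nil⟩)) =
        groupAlgebraHom V (f (π.obj a')) := ψ.val_vertex _
      have h2 : φ.val (ofPath ⟨a', a', Quiver.Path.nil⟩) = groupAlgebraHom V (e a') :=
        φ.val_vertex _
      rw [h1, h2, skewInclusion_groupAlgebraHom, ← map_mul, ← map_mul, (h.restriction a').left,
        (h.restriction a').right]
    | @cons b c p α ih =>
      have h1 : ofPath (QuiverPath.map π ⟨a', c, p.cons α⟩) =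
        PathAlgebra.arrow (π.map α) * ofPath (QuiverPath.map π ⟨a', b, p⟩) := ofPath_cons _ _
      rw [h1, ofPath_cons, ψ.val_mul, φ.val_mul, skewInclusion_mul, mul_assoc, ih, ← mul_assoc, h.arrow α, mul_assoc]

end IsRestrictionAlong

end RestrictionCovering
end

/-! ### Liftings along a covering. -/

noncomputable section

set_option linter.unusedSectionVars false

open QuiverPath PathAlgebra

section Liftings

variable {Q Q' : Type*} [Quiver Q] [Quiver Q'] {π : Q ⥤q Q'}

theorem PathAlgebra.map_ofPath (π : Q ⥤q Q') (p : QuiverPath Q) :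
    PathAlgebra.map π (ofPath p) = ofPath (p.map π) :=
  Finsupp.mapDomain_single

theorem PathAlgebra.map_mem_pathSpace {P : QuiverPath Q → Prop} {P' : QuiverPath Q' → Prop}
    (h : ∀ p, P p → P' (p.map π)) {x : PathAlgebra Q} (hx : x ∈ pathSpace P) :
    PathAlgebra.map π x ∈ pathSpace P' := by
  refine pathSpace_induction (C := fun x => PathAlgebra.map π x ∈ pathSpace P') hx ?_ ?_ ?_
  · rw [map_zero]; exact zero_mem _
  · intro x y hx hy
    rw [map_add]; exact add_mem hx hy
  · intro c p hp
    rw [map_smul, map_ofPath]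
    exact Submodule.smul_mem _ _ (ofPath_mem_pathSpace (h p hp))

theorem PathAlgebra.vertex_mul_of_mem_ne {i j k : Q} {x : PathAlgebra Q}
    (hx : x ∈ pathSpace fun p => p.src = i ∧ p.tgt = j) (hk : j ≠ k) : vertex k * x = 0 := by
  refine pathSpace_induction (C := fun x => vertex k * x = 0) hx (mul_zero _) ?_ ?_
  · intro a b ha hb
    rw [mul_add, ha, hb, add_zero]
  · rintro c p ⟨-, rfl⟩
    rw [PathAlgebra.mul_smul, vertex_mul_ofPath_of_ne hk, smul_zero]

theorem PathAlgebra.mul_vertex_of_mem_ne {i j k : Q} {x : PathAlgebra Q}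
    (hx : x ∈ pathSpace fun p => p.src = i ∧ p.tgt = j) (hk : i ≠ k) : x * vertex k = 0 := by
  refine pathSpace_induction (C := fun x => x * vertex k = 0) hx (zero_mul _) ?_ ?_
  · intro a b ha hb
    rw [add_mul, ha, hb, add_zero]
  · rintro c p ⟨rfl, -⟩
    rw [smul_mul, ofPath_mul_vertex_of_ne hk, smul_zero]

/-- `L` is the lifting given by the section `s`. -/
structure IsLiftingAlong (π : Q ⥤q Q') (s : Q' → Q) (L : PathAlgebra Q' →ₗ[ℂ] PathAlgebra Q) :
    Prop where
  section_apply : ∀ i, π.obj (s i) = i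
  apply_map : ∀ q : QuiverPath Q, q.src = s (π.obj q.src) → L (ofPath (q.map π)) = ofPath q

theorem IsLifting.exists_along (hπ : ∀ a, Function.Bijective (π.star a))
    {L : PathAlgebra Q' →ₗ[ℂ] PathAlgebra Q} (h : IsLifting π L) : ∃ s, IsLiftingAlong π s L := by
  obtain ⟨s, hs, hL⟩ := h
  refine ⟨s, hs, fun q hq => ?_⟩
  obtain ⟨q', h₁, h₂, h₃⟩ := hL (q.map π)
  rw [h₃, eq_of_map_eq hπ (h₁.trans hq.symm) h₂]

theorem exists_isLiftingAlong (hπ : ∀ a, Function.Bijective (π.star a)) {s : Q' → Q}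
    (hs : ∀ i, π.obj (s i) = i) : ∃ L, IsLiftingAlong π s L := by
  choose l hl using fun p : QuiverPath Q' => exists_lift hπ p (s p.src) (hs _)
  refine ⟨Finsupp.lmapDomain ℂ ℂ l, hs, fun q hq => ?_⟩
  refine Finsupp.mapDomain_single.trans ?_
  change ofPath (l (q.map π)) = ofPath q
  rw [eq_of_map_eq hπ ((hl (q.map π)).1.trans hq.symm) (hl (q.map π)).2]

theorem exists_isLiftingAlong_apply (hπ : ∀ a, Function.Bijective (π.star a))
    (hs : Function.Surjective π.obj) (a : Q) :
    ∃ s L, IsLiftingAlong π s L ∧ s (π.obj a) = a := by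
  classical
  choose s hs using hs
  have hs' : ∀ i, π.obj (Function.update s (π.obj a) a i) = i := by
    intro i
    by_cases hi : i = π.obj a
    · subst hi
      rw [Function.update_self]
    · rw [Function.update_of_ne hi, hs]
  obtain ⟨L, hL⟩ := exists_isLiftingAlong hπ hs'
  exact ⟨_, L, hL, Function.update_self _ _ _⟩

namespace IsLiftingAlong

variable {s : Q' → Q} {L : PathAlgebra Q' →ₗ[ℂ] PathAlgebra Q}

theorem exists_lift (hπ : ∀ a, Function.Bijective (π.star a)) (h : IsLiftingAlong π s L)
    (p : QuiverPath Q') :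
    ∃ q : QuiverPath Q, q.src = s p.src ∧ q.map π = p ∧ L (ofPath p) = ofPath q := by
  obtain ⟨q, h₁, h₂⟩ := QuiverPath.exists_lift hπ p (s p.src) (h.section_apply _)
  refine ⟨q, h₁, h₂, ?_⟩
  rw [← h₂, h.apply_map]
  rw [h₁]
  exact congrArg s (h.section_apply _).symm

theorem isLifting (hπ : ∀ a, Function.Bijective (π.star a)) (h : IsLiftingAlong π s L) :
    IsLifting π L :=
  ⟨s, h.section_apply, h.exists_lift hπ⟩

theorem map_apply (hπ : ∀ a, Function.Bijective (π.star a)) (h : IsLiftingAlong π s L)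
    (x : PathAlgebra Q') : PathAlgebra.map π (L x) = x := by
  induction x using PathAlgebra.induction with
  | zero => rw [map_zero, map_zero]
  | add x y hx hy => rw [map_add, map_add, hx, hy]
  | path c p =>
    obtain ⟨q, -, h₂, h₃⟩ := h.exists_lift hπ p
    rw [map_smul, map_smul, h₃, map_ofPath, h₂]

theorem apply_map_of_mem (h : IsLiftingAlong π s L) {a : Q} (ha : s (π.obj a) = a)
    {x : PathAlgebra Q} (hx : x ∈ pathSpace fun p => p.src = a) :
    L (PathAlgebra.map π x) = x := by
  refine pathSpace_induction (C := fun x => L (PathAlgebra.map π x) = x) hx ?_ ?_ ?_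
  · rw [map_zero, map_zero]
  · intro x y hx hy
    rw [map_add, map_add, hx, hy]
  · rintro c p rfl
    rw [map_smul, map_smul, map_ofPath, h.apply_map p ha.symm]

theorem apply_mem (hπ : ∀ a, Function.Bijective (π.star a)) (h : IsLiftingAlong π s L)
    {P : QuiverPath Q' → Prop} {P' : QuiverPath Q → Prop}
    (hP : ∀ q : QuiverPath Q, q.src = s (π.obj q.src) → P (q.map π) → P' q)
    {x : PathAlgebra Q'} (hx : x ∈ pathSpace P) : L x ∈ pathSpace P' := by
  refine pathSpace_induction (C := fun x => L x ∈ pathSpace P') hx ?_ ?_ ?_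
  · rw [map_zero]; exact zero_mem _
  · intro x y hx hy
    rw [map_add]; exact add_mem hx hy
  · intro c p hp
    obtain ⟨q, h₁, h₂, h₃⟩ := h.exists_lift hπ p
    rw [map_smul, h₃]
    subst h₂
    exact Submodule.smul_mem _ _ (ofPath_mem_pathSpace (hP q h₁ hp))

/-- All lifts of an element with a lift that starts and ends at fixed vertices are of this kind. -/
theorem isUniform_apply_map {K : Type*} [Group K] {act : K → Q → Q} (h : IsLiftingAlong π s L)
    (hact : IsDeckAction π act) {a c : Q}
    {x : PathAlgebra Q} (hx : x ∈ pathSpace fun p => p.src = a ∧ p.tgt = c) :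
    (L (PathAlgebra.map π x)).IsUniform := by
  -- The deck transformation carrying `a` to the chosen vertex of its fibre carries each path from
  -- `a` to `c` to its lift, so all lifts end at `act k c`.
  obtain ⟨k, hk⟩ := hact.transitive a (s (π.obj a)) (h.section_apply _).symm
  refine ⟨act k a, act k c, ?_⟩
  refine mem_pathSpace.1 (pathSpace_induction (C := fun x => L (PathAlgebra.map π x) ∈
    pathSpace fun p => p.src = act k a ∧ p.tgt = act k c) hx ?_ ?_ ?_)
  · rw [map_zero, map_zero]; exact zero_mem _
  · intro x y hx hy
    rw [map_add, map_add]; exact add_mem hx hy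
  · rintro r p ⟨rfl, rfl⟩
    obtain ⟨q, h₁, h₂, h₃⟩ := hact.path k p
    rw [map_smul, map_smul, map_ofPath, ← h₃, h.apply_map q]
    · exact Submodule.smul_mem _ _ (ofPath_mem_pathSpace ⟨h₁, h₂⟩)
    · rw [h₁, hact.obj, hk]

/-- Liftings are multiplicative up to a change of the section. -/
theorem apply_mul_ofPath (hπ : ∀ a, Function.Bijective (π.star a))
    (hs : Function.Surjective π.obj) (h : IsLiftingAlong π s L) (q : QuiverPath Q') :
    ∃ s' L', IsLiftingAlong π s' L' ∧ ∀ x, L (x * ofPath q) = L' x * L (ofPath q) := by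
  obtain ⟨q, hq, rfl, hLq⟩ := h.exists_lift hπ q
  -- After the lift of `q`, a path has to be lifted from the end point of that lift, whatever vertex
  -- `s` chooses there.
  obtain ⟨s', L', hL', hs'⟩ := exists_isLiftingAlong_apply hπ hs q.tgt
  refine ⟨s', L', hL', fun x => ?_⟩
  rw [hLq]
  induction x using PathAlgebra.induction with
  | zero => simp only [zero_mul, map_zero]
  | add x y hx hy => rw [add_mul, map_add, hx, hy, map_add, add_mul]
  | path c p =>
    rw [smul_mul, map_smul, map_smul, smul_mul]
    congr 1
    obtain ⟨p, hp, rfl, hLp⟩ := hL'.exists_lift hπ p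
    rw [hLp]
    by_cases hpq : p.src = q.tgt
    · rw [ofPath_mul_of_eq hpq, ofPath_mul_of_eq (p := p.map π) (q := q.map π)
        (congrArg π.obj hpq), ← map_after, h.apply_map]
      exact hq
    · rw [ofPath_mul_of_ne hpq, ofPath_mul_of_ne, map_zero]
      intro h'
      apply hpq
      have h1 : π.obj p.src = π.obj q.tgt := h'
      rw [hp, ← hs', ← h1]
      rfl

/-- The factor `y` is the sum of the lifts of `p` from every vertex above its source. Multiplied by
a lifted path, only the summand that starts where this path ends survives, so one `y` works for all
`x`. -/
theorem apply_ofPath_mul [Fintype Q] (hπ : ∀ a, Function.Bijective (π.star a))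
    (h : IsLiftingAlong π s L) (p : QuiverPath Q') :
    ∃ y, ∀ x, L (ofPath p * x) = y * L x := by
  classical
  have : Nonempty (QuiverPath Q) := ⟨⟨s p.src, s p.src, Quiver.Path.nil⟩⟩
  choose! l hl using fun (b : Q) (hb : π.obj b = p.src) => QuiverPath.exists_lift hπ p b hb
  refine ⟨∑ b with π.obj b = p.src, ofPath (l b), fun x => ?_⟩
  induction x using PathAlgebra.induction with
  | zero => simp only [mul_zero, map_zero]
  | add x y hx hy => rw [mul_add, map_add, hx, hy, map_add, mul_add]
  | path c q =>
    rw [PathAlgebra.mul_smul, map_smul, map_smul, PathAlgebra.mul_smul]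
    congr 1
    obtain ⟨q, hq, rfl, hLq⟩ := h.exists_lift hπ q
    rw [hLq, Finset.sum_mul]
    by_cases hpq : p.src = π.obj q.tgt
    · rw [Finset.sum_eq_single_of_mem q.tgt (by simp [hpq])]
      · obtain ⟨h1, h2⟩ := hl q.tgt hpq.symm
        generalize l q.tgt = p' at h1 h2
        subst h2
        rw [ofPath_mul_of_eq h1, ofPath_mul_of_eq (p := p'.map π) (q := q.map π)
          (congrArg π.obj h1), ← map_after, h.apply_map]
        exact hq
      · intro b hb hb'
        have h1 := (hl b (Finset.mem_filter.1 hb).2).1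
        exact ofPath_mul_of_ne (by rwa [h1])
    · rw [ofPath_mul_of_ne (q := q.map π) hpq, map_zero]
      refine (Finset.sum_eq_zero fun b hb => ?_).symm
      have hb' := (Finset.mem_filter.1 hb).2
      have h1 := (hl b hb').1
      refine ofPath_mul_of_ne ?_
      rw [h1]
      rintro rfl
      exact hpq hb'.symm

end IsLiftingAlong

/-- The elements all of whose lifts lie in a given ideal. -/
theorem lift_mem_of_mem_span [Fintype Q] (hπ : ∀ a, Function.Bijective (π.star a))
    (hs : Function.Surjective π.obj) {ρ : Set (PathAlgebra Q')} (T : TwoSidedIdeal (PathAlgebra Q))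
    (hρ : ∀ x ∈ ρ, ∀ L, IsLifting π L → L x ∈ T) {x : PathAlgebra Q'}
    (hx : x ∈ TwoSidedIdeal.span ρ) {L : PathAlgebra Q' →ₗ[ℂ] PathAlgebra Q}
    (hL : IsLifting π L) : L x ∈ T := by
  -- The condition has to involve all liftings at once: right multiplication by a path changes the
  -- section, so the elements satisfying it for one `L` need not form an ideal.
  let S : TwoSidedIdeal (PathAlgebra Q') :=
    TwoSidedIdeal.mk' {x | ∀ s L, IsLiftingAlong π s L → L x ∈ T}
      (fun s L _ => by rw [map_zero]; exact T.zero_mem)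
      (fun hx hy s L hL => by rw [map_add]; exact T.add_mem (hx s L hL) (hy s L hL))
      (fun hx s L hL => by rw [map_neg]; exact T.neg_mem (hx s L hL))
      (fun {x y} hy s L hL => by
        induction x using PathAlgebra.induction with
        | zero => rw [zero_mul, map_zero]; exact T.zero_mem
        | add x x' hx hx' => rw [add_mul, map_add]; exact T.add_mem hx hx'
        | path c p =>
          obtain ⟨z, hz⟩ := hL.apply_ofPath_mul hπ p
          rw [smul_mul, map_smul, hz]
          exact smul_mem_twoSidedIdeal T c (T.mul_mem_left _ _ (hy s L hL)))
      (fun {x y} hx s L hL => by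
        induction y using PathAlgebra.induction with
        | zero => rw [mul_zero, map_zero]; exact T.zero_mem
        | add y y' hy hy' => rw [mul_add, map_add]; exact T.add_mem hy hy'
        | path c p =>
          obtain ⟨s', L', hL', h'⟩ := hL.apply_mul_ofPath hπ hs p
          rw [PathAlgebra.mul_smul, map_smul, h']
          exact smul_mem_twoSidedIdeal T c (T.mul_mem_right _ _ (hx s' L' hL')))
  have hS : ρ ⊆ S := fun x hx => by
    rw [SetLike.mem_coe, TwoSidedIdeal.mem_mk']
    exact fun s L hL => hρ x hx L (hL.isLifting hπ)
  have h1 : x ∈ S := TwoSidedIdeal.span_le.2 hS hx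
  rw [TwoSidedIdeal.mem_mk'] at h1
  obtain ⟨s, hs⟩ := hL.exists_along hπ
  exact h1 s L hs

end Liftings
end

/-! ### Comparison of the relations of `G` and `N`. -/

noncomputable section

set_option linter.unusedSectionVars false

attribute [local instance 2000] exteriorAction exteriorDistribMulAction

open QuiverPath PathAlgebra

section

variable {V : Type*} [AddCommGroup V] [Module ℂ V]
variable {Γ : Type*} [Group Γ] [DistribMulAction Γ V] [SMulCommClass Γ ℂ V]
variable {I : Type*} [Fintype I] {e : I → MonoidAlgebra ℂ Γ}

theorem ArrowRealization.val_eq_zero_of_mem_span (φ : ArrowRealization V e)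
    {ρ : Set (PathAlgebra (McKayQuiver V e))} (hρ : ∀ x ∈ ρ, φ.val x = 0)
    {x : PathAlgebra (McKayQuiver V e)} (hx : x ∈ TwoSidedIdeal.span ρ) : φ.val x = 0 := by
  have h : ρ ⊆ TwoSidedIdeal.ker φ.toHom := fun x hx =>
    (TwoSidedIdeal.mem_ker _).2 ((φ.val_eq_zero_iff x).1 (hρ x hx))
  exact (φ.val_eq_zero_iff x).2 ((TwoSidedIdeal.mem_ker _).1 (TwoSidedIdeal.span_le.2 h hx))

end

namespace IsRestrictionAlong

variable {V : Type*} [AddCommGroup V] [Module ℂ V]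
variable {G : Type*} [Group G] [Finite G] [DistribMulAction G V] [SMulCommClass G ℂ V]
variable {N : Subgroup G} [N.Normal]
variable {I J : Type*} [Fintype I] [Fintype J]
variable {e : I → MonoidAlgebra ℂ G} {f : J → MonoidAlgebra ℂ N}
variable {φ : ArrowRealization V e} {ψ : ArrowRealization V f}
variable {π : McKayQuiver V e ⥤q McKayQuiver V f} {u : McKayQuiver V e → MonoidAlgebra ℂ G}

/-- In `ψ(π x) u_a = u_c φ(x)` both multiplications can be cancelled: `u_c` by a dual element, `u_a`
by averaging over twists. -/
theorem val_map_eq_zero_iff (hN : HasEnoughCharacters N) (he : IsBasicSystem e)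
    (hf : IsBasicSystem f) (h : IsRestrictionAlong φ ψ π u) {a c : McKayQuiver V e}
    {x : PathAlgebra (McKayQuiver V e)} (hx : x ∈ pathSpace fun p => p.src = a ∧ p.tgt = c) :
    ψ.val (PathAlgebra.map π x) = 0 ↔ φ.val x = 0 := by
  constructor
  · intro h0
    obtain ⟨z, hz, -⟩ := exists_dual he h.restriction c
    rw [← φ.vertex_mul_val hx, ← hz, map_mul, mul_assoc, ← h.val_map hx, h0, map_zero, zero_mul,
      mul_zero]
  · intro h0
    refine (h.restriction a).eq_zero_of_skewInclusion_mul_eq_zero hN he hf ?_ ?_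
    · exact ψ.val_mul_vertex (j := π.obj c) (map_mem_pathSpace
        (fun p hp => ⟨congrArg π.obj hp.1, congrArg π.obj hp.2⟩) hx)
    · rw [h.val_map hx, h0, mul_zero]

/-- The components of a relation along a lift are relations. -/
theorem val_map_vertex_mul_eq_zero (hN : HasEnoughCharacters N) (he : IsBasicSystem e)
    (hf : IsBasicSystem f) (h : IsRestrictionAlong φ ψ π u) {a : McKayQuiver V e}
    {x : PathAlgebra (McKayQuiver V e)} (hx : x * vertex a = x)
    (h0 : ψ.val (PathAlgebra.map π x) = 0) (c : McKayQuiver V e) :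
    ψ.val (PathAlgebra.map π (vertex c * x)) = 0 := by
  have : Fintype (McKayQuiver V e) := inferInstanceAs (Fintype I)
  have hmem : ∀ b : McKayQuiver V e,
      vertex b * x ∈ pathSpace fun p => p.src = a ∧ p.tgt = b := fun b => by
    rw [← hx, ← mul_assoc]
    exact vertex_mul_mul_vertex_mem a b x
  -- The identity for paths turns `ψ(π x) u_a = 0` into this sum over end points; the dual element
  -- for `c` extracts one summand.
  have h1 : ∑ b, groupAlgebraHom V (u b) * φ.val (vertex b * x) = 0 := by
    rw [Finset.sum_congr rfl fun b _ => (h.val_map (hmem b)).symm, ← Finset.sum_mul, ← map_sum,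
      ← map_sum, ← map_sum, sum_vertex_mul, h0, map_zero, zero_mul]
  obtain ⟨z, hz, hz0⟩ := exists_dual he h.restriction c
  have h2 := congrArg (fun y => groupAlgebraHom V z * y) h1
  rw [mul_zero, Finset.mul_sum, Finset.sum_eq_single c, ← mul_assoc, ← map_mul, hz] at h2
  · exact (h.val_map_eq_zero_iff hN he hf (hmem c)).2 ((φ.vertex_mul_val (hmem c)).symm.trans h2)
  · intro b _ hb
    rw [← mul_assoc, ← map_mul, hz0 b hb, map_zero, zero_mul]
  · exact fun hc => absurd (Finset.mem_univ c) hc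

/-- All quadratic relations with uniform lifts are taken. They generate since any quadratic
relation, lifted and split by end points, is a sum of images of uniform elements. These images are
again relations, and their lifts are deck translates of a uniform element. -/
theorem exists_relations (hN : HasEnoughCharacters N) (he : IsBasicSystem e)
    (hf : IsBasicSystem f) (h : IsRestrictionAlong φ ψ π u) :
    ∃ ρN, ψ.IsPresentedBy ρN ∧ LiftsUniformly π ρN := by
  have : Fintype (McKayQuiver V e) := inferInstanceAs (Fintype I)
  have hπ : ∀ a, Function.Bijective (π.star a) := fun a =>
    ⟨h.star_injective he hf a, h.star_surjective hN he hf a⟩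
  have hs := h.surjective_obj he hf
  obtain ⟨act, hact⟩ := h.exists_isDeckAction hN he hf
  refine ⟨{x | x.IsUniform ∧ x.IsQuadratic ∧ ψ.val x = 0 ∧ ∀ L, IsLifting π L → (L x).IsUniform},
    ⟨ψ.surjective hf, fun x hx => ⟨hx.1, hx.2.1⟩, fun x => ?_⟩, fun x hx => hx.2.2.2⟩
  rw [← ψ.val_eq_zero_iff]
  refine ⟨fun hx => ?_, ψ.val_eq_zero_of_mem_span fun x hx => hx.2.2.1⟩
  refine TwoSidedIdeal.span_le.2 ?_ (ψ.mem_span_of_val_eq_zero hf hx)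
  rintro x ⟨⟨i, j, hij⟩, hq, h0⟩
  obtain ⟨a, rfl⟩ := hs i
  obtain ⟨s, L, hL, hsa⟩ := exists_isLiftingAlong_apply hπ hs a
  have hx2 : x ∈ pathSpace (IsPathFrom 2 (π.obj a) j) := fun p hp =>
    ⟨(hij p hp).1, (hij p hp).2, hq p hp⟩
  have hLx : L x ∈ pathSpace fun q => q.src = a ∧ q.path.length = 2 ∧ π.obj q.tgt = j := by
    refine hL.apply_mem hπ (fun q hq hq' => ⟨?_, ?_, hq'.2.1⟩) hx2
    · have h1 : π.obj q.src = π.obj a := hq'.1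
      rw [hq, h1, hsa]
    · rw [← length_map π]
      exact hq'.2.2
  have hLa : L x * vertex a = L x := by
    refine pathSpace_induction (C := fun y => y * vertex a = y) hLx (zero_mul _) ?_ ?_
    · intro y y' hy hy'
      rw [add_mul, hy, hy']
    · rintro r p ⟨rfl, -⟩
      rw [smul_mul, ofPath_mul_vertex]
  rw [SetLike.mem_coe, ← hL.map_apply hπ x, ← sum_vertex_mul (L x), map_sum]
  refine sum_mem fun c _ => TwoSidedIdeal.subset_span ?_
  have h1 : vertex c * L x ∈ pathSpace (IsPathFrom 2 a c) := by
    refine mul_mem_pathSpace ?_ (vertex_mem c) hLx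
    rintro p q ⟨_, hp, hp'⟩ hq hpq
    refine ⟨hq.1, hp, ?_⟩
    obtain ⟨p₁, p₂, p⟩ := p
    obtain ⟨q₁, q₂, q⟩ := q
    dsimp only at hpq hp' hq
    subst hpq
    change (q.comp p).length = 2
    rw [Quiver.Path.length_comp, hq.2.1, hp']
  have h2 : PathAlgebra.map π (vertex c * L x) ∈
      pathSpace (IsPathFrom 2 (π.obj a) (π.obj c)) := map_mem_pathSpace (fun p hp =>
    ⟨congrArg π.obj hp.1, congrArg π.obj hp.2.1, (length_map π p).trans hp.2.2⟩) h1
  refine ⟨isUniform_of_mem h2, isQuadratic_of_mem h2,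
    h.val_map_vertex_mul_eq_zero hN he hf hLa (by rw [hL.map_apply hπ, h0]) c, fun L' hL' => ?_⟩
  obtain ⟨s', hL'⟩ := hL'.exists_along hπ
  exact hL'.isUniform_apply_map hact (fun p hp => ⟨(h1 hp).1, (h1 hp).2.1⟩)

/-- The first condition on morphisms leaves no choice for the set of relations of `G`. The ends of
each lift are uniform by assumption, so `val_map_eq_zero_iff` compares relations in both directions.
-/
theorem exists_lifted_relations {K : Type*} [Group K] (ε : K ≃* (G ⧸ N →* ℂˣ))
    (hN : HasEnoughCharacters N) (he : IsBasicSystem e)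
    (hf : IsBasicSystem f) (h : IsRestrictionAlong φ ψ π u)
    {ρN : Set (PathAlgebra (McKayQuiver V f))} (hρ : ψ.IsPresentedBy ρN)
    (hl : LiftsUniformly π ρN) :
    ∃ ρG, φ.IsPresentedBy ρG ∧ IsMorphismOfQuiversWithRelations K π ρG ρN := by
  have : Fintype (McKayQuiver V e) := inferInstanceAs (Fintype I)
  have hπ : ∀ a, Function.Bijective (π.star a) := fun a =>
    ⟨h.star_injective he hf a, h.star_surjective hN he hf a⟩
  have hs := h.surjective_obj he hf
  obtain ⟨act, hact⟩ := h.exists_isDeckAction hN he hf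
  refine ⟨{y | ∃ L, IsLifting π L ∧ ∃ x ∈ ρN, L x = y}, ⟨φ.surjective he, ?_, fun y => ?_⟩,
    (hact.congr ε).isRegularCovering hs hπ, rfl, ?_⟩
  · rintro _ ⟨L, hL, x, hx, rfl⟩
    refine ⟨hl x hx L hL, ?_⟩
    obtain ⟨s, hL⟩ := hL.exists_along hπ
    exact mem_pathSpace.1 (hL.apply_mem hπ (fun q _ hq => (length_map π q).symm.trans hq)
      (mem_pathSpace.2 (hρ.quadratic x hx).2))
  · rw [← φ.val_eq_zero_iff]
    constructor
    · intro hy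
      rw [← sum_vertex_mul_mul_vertex y]
      refine sum_mem fun a _ => sum_mem fun c _ => ?_
      have hmem := vertex_mul_mul_vertex_mem a c y
      have h0 : φ.val (vertex c * y * vertex a) = 0 := by
        rw [φ.val_mul, φ.val_mul, hy, mul_zero, zero_mul]
      obtain ⟨s, L, hL, hsa⟩ := exists_isLiftingAlong_apply hπ hs a
      -- The component of `y` from `a` to `c` is the lift of its own image, and that image lies in
      -- the ideal of `ρN`.
      rw [← hL.apply_map_of_mem hsa (x := vertex c * y * vertex a) fun p hp => (hmem hp).1]
      refine lift_mem_of_mem_span hπ hs _ (ρ := ρN) ?_ ?_ (hL.isLifting hπ)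
      · exact fun x hx L hL => TwoSidedIdeal.subset_span ⟨L, hL, x, hx, rfl⟩
      rw [← hρ.ker_eq, ← ψ.val_eq_zero_iff]
      exact (h.val_map_eq_zero_iff hN he hf hmem).2 h0
    · refine φ.val_eq_zero_of_mem_span ?_
      rintro _ ⟨L, hL, x, hx, rfl⟩
      obtain ⟨a, c, hac⟩ := hl x hx L hL
      obtain ⟨s, hL⟩ := hL.exists_along hπ
      rw [← h.val_map_eq_zero_iff hN he hf (mem_pathSpace.2 hac), hL.map_apply hπ,
        ψ.val_eq_zero_iff, hρ.ker_eq]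
      exact TwoSidedIdeal.subset_span hx
  · rintro _ ⟨L, hL, x, hx, rfl⟩ i' j'
    obtain ⟨a, c, hac⟩ := hl x hx L hL
    -- If `i'` lies under the source of `L x`, that source is the vertex to take; otherwise both
    -- sides vanish and any vertex of the fibre will do. The same holds for `j` and the target.
    obtain ⟨i, hi, hi'⟩ : ∃ i, π.obj i = i' ∧ (π.obj a = i' → i = a) := by
      by_cases ha : π.obj a = i'
      · exact ⟨a, ha, fun _ => rfl⟩
      · obtain ⟨i, hi⟩ := hs i'
        exact ⟨i, hi, fun h => absurd h ha⟩
    obtain ⟨j, hj, hj'⟩ : ∃ j, π.obj j = j' ∧ (π.obj c = j' → j = c) := by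
      by_cases hc : π.obj c = j'
      · exact ⟨c, hc, fun _ => rfl⟩
      · obtain ⟨j, hj⟩ := hs j'
        exact ⟨j, hj, fun h => absurd h hc⟩
    refine ⟨i, j, hi, hj, ?_⟩
    have h1 : L x ∈ pathSpace fun p => p.src = a ∧ p.tgt = c := mem_pathSpace.2 hac
    have h2 : PathAlgebra.map π (L x) ∈ pathSpace fun p => p.src = π.obj a ∧ p.tgt = π.obj c :=
      map_mem_pathSpace (fun p hp => ⟨congrArg π.obj hp.1, congrArg π.obj hp.2⟩) h1
    by_cases hc : π.obj c = j'
    · by_cases ha : π.obj a = i'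
      · rw [hi' ha, hj' hc, vertex_mul_of_mem h1, mul_vertex_of_mem h1, ← ha, ← hc,
          vertex_mul_of_mem h2, mul_vertex_of_mem h2]
      · rw [mul_assoc, mul_assoc, mul_vertex_of_mem_ne h2 ha, mul_vertex_of_mem_ne h1, mul_zero,
          mul_zero, map_zero]
        rintro rfl
        exact ha hi
    · rw [vertex_mul_of_mem_ne h2 hc, vertex_mul_of_mem_ne h1, zero_mul, zero_mul, map_zero]
      rintro rfl
      exact hc hj

end IsRestrictionAlong
end

/-! ### Characters of the abelian quotient. -/

noncomputable section

section Characters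

variable {G : Type*} [Group G] [Finite G] {N : Subgroup G} [N.Normal]

theorem hasEnoughCharacters_of_comm (h : ∀ x y : G ⧸ N, x * y = y * x) :
    HasEnoughCharacters N := by
  let : CommGroup (G ⧸ N) := { QuotientGroup.Quotient.group N with mul_comm := h }
  refine ⟨?_, fun g hg => ?_⟩
  · exact Finite.of_equiv _
      (CommGroup.monoidHom_mulEquiv_of_hasEnoughRootsOfUnity (G ⧸ N) ℂ).some.symm.toEquiv
  · exact CommGroup.exists_apply_ne_one_of_hasEnoughRootsOfUnity (G ⧸ N) ℂ
      (a := (g : G ⧸ N)) fun h => hg ((QuotientGroup.eq_one_iff g).1 h)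

/-- The group acting naturally on the fibres is the dual of `G / N`. A non-canonical isomorphism
lets `G / N` itself act. -/
theorem nonempty_mulEquiv_characters (h : ∀ x y : G ⧸ N, x * y = y * x) :
    Nonempty (G ⧸ N ≃* (G ⧸ N →* ℂˣ)) := by
  let : CommGroup (G ⧸ N) := { QuotientGroup.Quotient.group N with mul_comm := h }
  exact ⟨(CommGroup.monoidHom_mulEquiv_of_hasEnoughRootsOfUnity (G ⧸ N) ℂ).some.symm⟩

theorem specialSubgroup_quotient_comm {V : Type*} [AddCommGroup V] [Module ℂ V]
    (G : Subgroup (V ≃ₗ[ℂ] V)) (x y : G ⧸ specialSubgroup G) : x * y = y * x := by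
  induction x using QuotientGroup.induction_on with | _ x
  induction y using QuotientGroup.induction_on with | _ y
  rw [← QuotientGroup.mk_mul, ← QuotientGroup.mk_mul, QuotientGroup.eq]
  change (LinearEquiv.det.comp G.subtype) _ = 1
  simp only [map_mul, map_inv]
  rw [mul_comm ((LinearEquiv.det.comp G.subtype) y), inv_mul_cancel]

end Characters
end

/-! ### Extension of characters and irreducibility of restrictions. -/

noncomputable section

set_option linter.unusedSectionVars false

section

variable {Γ : Type*} [Group Γ]

theorem Representation.Equiv.asAlgebraHom_apply {k W W' : Type*} [CommRing k] [AddCommGroup W]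
    [Module k W] [AddCommGroup W'] [Module k W'] {ρ : Representation k Γ W}
    {ρ' : Representation k Γ W'} (E : ρ.Equiv ρ') (x : MonoidAlgebra k Γ) (w : W) :
    E (ρ.asAlgebraHom x w) = ρ'.asAlgebraHom x (E w) := by
  induction x using MonoidAlgebra.induction_linear with
  | zero => simp
  | add x y hx hy => simp only [map_add, LinearMap.add_apply, hx, hy]
  | single g c =>
    rw [Representation.asAlgebraHom_single, Representation.asAlgebraHom_single,
      LinearMap.smul_apply, LinearMap.smul_apply, map_smul]
    congr 1
    exact Representation.IntertwiningMap.isIntertwining _ _ E.toIntertwiningMap g w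

theorem leftIdealRep_asAlgebraHom_coe (a x : MonoidAlgebra ℂ Γ)
    (y : Submodule.span (MonoidAlgebra ℂ Γ) {a}) :
    (((leftIdealRep a).asAlgebraHom x y : Submodule.span (MonoidAlgebra ℂ Γ) {a}) :
      MonoidAlgebra ℂ Γ) = x * y := by
  induction x using MonoidAlgebra.induction_linear with
  | zero => simp
  | add x x' hx hx' => simp only [map_add, LinearMap.add_apply, Submodule.coe_add, hx, hx', add_mul]
  | single g c =>
    rw [Representation.asAlgebraHom_single, LinearMap.smul_apply, Submodule.coe_smul_of_tower,
      leftIdealRep_apply_coe, ← smul_mul_assoc, MonoidAlgebra.smul_single, smul_eq_mul, mul_one]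

theorem asAlgebraHom_eq_zero_iff {W : Type*} [AddCommGroup W] [Module ℂ W]
    {ρ : Representation ℂ Γ W} {a : MonoidAlgebra ℂ Γ} (E : ρ.Equiv (leftIdealRep a))
    (x : MonoidAlgebra ℂ Γ) :
    ρ.asAlgebraHom x = 0 ↔ ∀ y ∈ Submodule.span (MonoidAlgebra ℂ Γ) {a}, x * y = 0 := by
  constructor
  · intro h y hy
    have h1 := E.asAlgebraHom_apply x (E.symm ⟨y, hy⟩)
    rw [h, LinearMap.zero_apply, map_zero, Representation.Equiv.apply_symm_apply] at h1
    rw [← leftIdealRep_asAlgebraHom_coe a x ⟨y, hy⟩, ← h1, Submodule.coe_zero]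
  · intro h
    refine LinearMap.ext fun w => E.injective (Subtype.ext ?_)
    change ((E (ρ.asAlgebraHom x w) : Submodule.span (MonoidAlgebra ℂ Γ) {a}) :
      MonoidAlgebra ℂ Γ) = (E ((0 : W →ₗ[ℂ] W) w) : Submodule.span (MonoidAlgebra ℂ Γ) {a})
    rw [E.asAlgebraHom_apply, leftIdealRep_asAlgebraHom_coe, h _ (E w).2, LinearMap.zero_apply,
      map_zero, Submodule.coe_zero]

end

section Extension

variable {G : Type*} [Group G] [Finite G] {N : Subgroup G} [N.Normal]
variable {I J : Type*} {e : I → MonoidAlgebra ℂ G} {f : J → MonoidAlgebra ℂ N}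

/-- An extension of the representation `ℂN f_j` to `G` is isomorphic to some `ℂG e_c`. -/
theorem exists_isRestriction_of_extends
    (hext : ∀ χ : N → ℂ, IsIrreducibleCharacter χ →
      ∃ χ' : G → ℂ, IsIrreducibleCharacter χ' ∧ ∀ n : N, χ' n = χ n)
    (he : IsBasicSystem e) (hf : IsBasicSystem f) (j : J) :
    ∃ c u, IsRestriction e f c j u := by
  have := hf.isSimpleModule j
  have : FiniteDimensional ℂ (MonoidAlgebra ℂ N) := inferInstance
  have : FiniteDimensional ℂ (Submodule.span (MonoidAlgebra ℂ N) {f j}) :=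
    inferInstanceAs (FiniteDimensional ℂ
      ((Submodule.span (MonoidAlgebra ℂ N) {f j}).restrictScalars ℂ))
  obtain ⟨n, σ, hσ, ⟨E⟩⟩ : ∃ (n : ℕ) (σ : Representation ℂ N (Fin n → ℂ)), σ.IsIrreducible ∧
      Nonempty (σ.Equiv (leftIdealRep (f j))) := exists_irreducible_equiv_ofModule' (Γ := N)
    (Submodule.span (MonoidAlgebra ℂ N) {f j})
  obtain ⟨_, ⟨m, ρ, hρ, rfl⟩, hχ⟩ := hext σ.character ⟨n, σ, hσ, rfl⟩
  obtain ⟨c, ⟨E'⟩⟩ := he.complete m ρ hρ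
  have htrace : ∀ x : MonoidAlgebra ℂ N, LinearMap.trace ℂ _ (ρ.asAlgebraHom (subgroupHom N x)) =
      LinearMap.trace ℂ _ (σ.asAlgebraHom x) := by
    intro x
    induction x using MonoidAlgebra.induction_linear with
    | zero => simp
    | add x y hx hy => simp only [map_add, hx, hy]
    | single g r =>
      rw [subgroupHom_single, Representation.asAlgebraHom_single,
        Representation.asAlgebraHom_single, map_smul, map_smul]
      exact congrArg _ (hχ g)
  have hmn : m = n := by
    have h1 := hχ 1
    rw [OneMemClass.coe_one, Representation.char_one, Representation.char_one] at h1
    simpa using h1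
  have hσ0 : σ.asAlgebraHom (f j) ≠ 0 := fun h0 => hf.ne_zero j <| by
    rw [← hf.idem j]
    exact (asAlgebraHom_eq_zero_iff E _).1 h0 _ (Submodule.mem_span_singleton_self _)
  -- Equal characters give `f j` the same trace on both representations, and a nonzero idempotent
  -- over `ℂ` has nonzero trace. So `f j` acts nontrivially on `ℂG e_c`, which provides `u`.
  have hρ0 : ρ.asAlgebraHom (subgroupHom N (f j)) ≠ 0 := by
    intro h0
    apply hσ0
    have h1 := htrace (f j)
    rw [h0, map_zero] at h1
    refine LinearMap.IsIdempotentElem.eq_zero_of_trace_eq_zero ?_ h1.symm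
    exact (show IsIdempotentElem (f j) from hf.idem j).map σ.asAlgebraHom
  obtain ⟨w, hwc, hw⟩ : ∃ w ∈ Submodule.span (MonoidAlgebra ℂ G) {e c},
      subgroupHom N (f j) * w ≠ 0 := by
    by_contra! h
    exact hρ0 ((asAlgebraHom_eq_zero_iff E' _).2 h)
  obtain ⟨u, hu⟩ : ∃ u, u = subgroupHom N (f j) * w := ⟨_, rfl⟩
  have hu0 : u ≠ 0 := by rwa [hu]
  have huc : u * e c = u := by
    rw [hu, mul_assoc, (mem_span_idempotent_iff (he.idem c)).1 hwc]
  have huf : subgroupHom N (f j) * u = u := by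
    rw [hu, ← mul_assoc, ← map_mul, hf.idem j]
  have hinj : ∀ x, x * f j = x → subgroupHom N x * u = 0 → x = 0 := by
    intro x hx h0
    by_contra hx0
    obtain ⟨z, hz⟩ := hf.exists_mul_eq hx hx0
    apply hu0
    rw [← huf, ← hz, map_mul, mul_assoc, h0, mul_zero]
  refine ⟨c, u, huf, huc, hinj, fun y hy => ?_⟩
  let R : Submodule.span (MonoidAlgebra ℂ N) {f j} →ₗ[ℂ] Submodule.span (MonoidAlgebra ℂ G) {e c} :=
    { toFun := fun x => ⟨subgroupHom N x * u,
        (mem_span_idempotent_iff (he.idem c)).2 (by rw [mul_assoc, huc])⟩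
      map_add' := fun x y => Subtype.ext (by
        simp only [Submodule.coe_add, map_add, add_mul])
      map_smul' := fun r x => Subtype.ext (by
        simp only [Submodule.coe_smul_of_tower, subgroupHom_smul, smul_mul_assoc,
          RingHom.id_apply]) }
  have hRinj : Function.Injective R := by
    rw [← LinearMap.ker_eq_bot, LinearMap.ker_eq_bot']
    intro x hx
    exact Subtype.ext (hinj x ((mem_span_idempotent_iff (hf.idem j)).1 x.2)
      (congrArg Subtype.val hx))
  -- The dimensions agree because the characters agree at `1`, so the injective map `x ↦ x u` is
  -- onto.
  have hdim : Module.finrank ℂ (Submodule.span (MonoidAlgebra ℂ N) {f j}) =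
      Module.finrank ℂ (Submodule.span (MonoidAlgebra ℂ G) {e c}) := by
    rw [← E.toLinearEquiv.finrank_eq, ← E'.toLinearEquiv.finrank_eq]
    simp [hmn]
  obtain ⟨x, hx⟩ := (LinearMap.injective_iff_surjective_of_finrank_eq_finrank hdim).1 hRinj
    ⟨y, (mem_span_idempotent_iff (he.idem c)).2 hy⟩
  exact ⟨x, (mem_span_idempotent_iff (hf.idem j)).1 x.2, congrArg Subtype.val hx⟩

/-- If irreducible characters extend from `N` to `G`, then all `ℂG e_a` are irreducible over `N`. -/
theorem exists_isRestriction (hN : HasEnoughCharacters N)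
    (hext : ∀ χ : N → ℂ, IsIrreducibleCharacter χ →
      ∃ χ' : G → ℂ, IsIrreducibleCharacter χ' ∧ ∀ n : N, χ' n = χ n)
    (he : IsBasicSystem e) (hf : IsBasicSystem f) (a : I) :
    ∃ j u, IsRestriction e f a j u := by
  obtain ⟨n, l, s, t, hs, ht, hst⟩ := hf.exists_one_eq_sum
  have h1 : ∑ m, subgroupHom N (s m) * (subgroupHom N (t m) * e a) ≠ 0 := by
    have h2 : ∑ m, subgroupHom N (s m) * (subgroupHom N (t m) * e a) = e a := by
      simp only [← mul_assoc, ← Finset.sum_mul, ← map_mul, ← map_sum, ← hst, map_one, one_mul]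
    rw [h2]
    exact he.ne_zero a
  obtain ⟨m, -, hm⟩ := Finset.exists_ne_zero_of_sum_ne_zero h1
  -- The representation `ℂN f_{l m}` occurs in `ℂG e_a` and extends to `G`, so `ℂG e_a` is a twist
  -- of this extension.
  obtain ⟨c, u, hu⟩ := exists_isRestriction_of_extends hext he hf (l m)
  obtain ⟨χ, w, h⟩ := hu.exists_twist hN he hf (b := a) (y := subgroupHom N (t m) * e a)
    (by rw [← mul_assoc, ← map_mul, ht]) (by rw [mul_assoc, he.idem a])
    (right_ne_zero_of_mul hm)
  exact ⟨l m, _, h⟩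

end Extension
end

/-! ### Arrow spaces and McKay multiplicities. -/

noncomputable section

set_option linter.unusedSectionVars false

open TensorProduct

section Multiplicity

variable {V : Type*} [AddCommGroup V] [Module ℂ V]
variable {Γ : Type*} [Group Γ] [DistribMulAction Γ V] [SMulCommClass Γ ℂ V]

variable (V) in
/-- The map `V ⊗ ℂΓ a → V * Γ`. -/
def tensorToSkew (a : MonoidAlgebra ℂ Γ) :
    V ⊗[ℂ] Submodule.span (MonoidAlgebra ℂ Γ) {a} →ₗ[ℂ] SkewExterior V Γ :=
  TensorProduct.lift (LinearMap.mk₂ ℂ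
    (fun v (x : Submodule.span (MonoidAlgebra ℂ Γ) {a}) => vecHom V Γ v * groupAlgebraHom V x)
    (fun v w x => by rw [map_add, add_mul])
    (fun c v x => by rw [map_smul, smul_mul_assoc])
    (fun v x y => by rw [Submodule.coe_add, map_add, mul_add])
    (fun c v x => by rw [Submodule.coe_smul_of_tower, map_smul, mul_smul_comm]))

theorem tensorToSkew_tmul (a : MonoidAlgebra ℂ Γ) (v : V)
    (x : Submodule.span (MonoidAlgebra ℂ Γ) {a}) :
    tensorToSkew V a (v ⊗ₜ x) = vecHom V Γ v * groupAlgebraHom V (x : MonoidAlgebra ℂ Γ) :=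
  TensorProduct.lift.tmul _ _

variable (V) in
/-- A map `⋀V * Γ → V ⊗ ℂΓ a`. -/
def skewToTensor (a : MonoidAlgebra ℂ Γ) :
    SkewExterior V Γ →+ V ⊗[ℂ] Submodule.span (MonoidAlgebra ℂ Γ) {a} :=
  (Finsupp.liftAddHom fun g : Γ => (((TensorProduct.mk ℂ V _).flip
    ((MonoidAlgebra.single g 1 : MonoidAlgebra ℂ Γ) •
      (⟨a, Submodule.mem_span_singleton_self a⟩ : Submodule.span (MonoidAlgebra ℂ Γ) {a}))) ∘ₗ
      ExteriorAlgebra.ιInv).toAddMonoidHom).comp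
    (SkewMonoidAlgebra.coeffAddEquiv (k := ExteriorAlgebra ℂ V) (G := Γ)).toAddMonoidHom

theorem skewToTensor_single (a : MonoidAlgebra ℂ Γ) (g : Γ) (w : ExteriorAlgebra ℂ V) :
    skewToTensor V a (SkewMonoidAlgebra.single g w) = ExteriorAlgebra.ιInv w ⊗ₜ
      ((MonoidAlgebra.single g 1 : MonoidAlgebra ℂ Γ) •
      (⟨a, Submodule.mem_span_singleton_self a⟩ : Submodule.span (MonoidAlgebra ℂ Γ) {a})) :=
  Finsupp.liftAddHom_apply_single _ _ _

theorem skewToTensor_vecHom_mul (a : MonoidAlgebra ℂ Γ) (v : V) (x : MonoidAlgebra ℂ Γ) :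
    skewToTensor V a (vecHom V Γ v * groupAlgebraHom V x) = v ⊗ₜ (x •
      (⟨a, Submodule.mem_span_singleton_self a⟩ : Submodule.span (MonoidAlgebra ℂ Γ) {a})) := by
  induction x using MonoidAlgebra.induction_linear with
  | zero => rw [map_zero, mul_zero, map_zero, zero_smul, TensorProduct.tmul_zero]
  | add x y hx hy => rw [map_add, mul_add, map_add, hx, hy, add_smul, TensorProduct.tmul_add]
  | single g c =>
    have h1 : (MonoidAlgebra.single g c : MonoidAlgebra ℂ Γ) = c • MonoidAlgebra.single g 1 := by
      simp
    rw [h1, map_smul, mul_smul_comm, ← smul_mul_assoc, ← map_smul, vecHom_mul_single,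
      skewToTensor_single, ExteriorAlgebra.ι_leftInverse, TensorProduct.smul_tmul, smul_assoc]

/-- `skewToTensor` is a left inverse: it reads off the degree-one part of each coefficient and
multiplies the group element into `a`, which does nothing on `ℂΓ a`. -/
theorem tensorToSkew_injective {a : MonoidAlgebra ℂ Γ} (ha : IsIdempotentElem a) :
    Function.Injective (tensorToSkew V a) := by
  have h : ∀ m, skewToTensor V a (tensorToSkew V a m) = m := by
    intro m
    induction m using TensorProduct.induction_on with
    | zero => rw [map_zero, map_zero]
    | add x y hx hy => rw [map_add, map_add, hx, hy]
    | tmul v x =>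
      rw [tensorToSkew_tmul, skewToTensor_vecHom_mul]
      congr 1
      exact Subtype.ext ((mem_span_idempotent_iff ha).1 x.2)
  exact Function.LeftInverse.injective h

theorem exists_tensorToSkew_eq {a : MonoidAlgebra ℂ Γ} {x : SkewExterior V Γ}
    (hx : x ∈ degreeOne V Γ) (hxa : x * groupAlgebraHom V a = x) : ∃ m, tensorToSkew V a m = x := by
  rw [← hxa]
  clear hxa
  refine degreeOne_induction (C := fun x => ∃ m, tensorToSkew V a m = x * groupAlgebraHom V a) hx
    ⟨0, by rw [map_zero, zero_mul]⟩ ?_ ?_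
  · rintro x y ⟨m, hm⟩ ⟨n, hn⟩
    exact ⟨m + n, by rw [map_add, hm, hn, add_mul]⟩
  · intro v r
    refine ⟨v ⊗ₜ ⟨r * a, Submodule.mem_span_singleton.2 ⟨r, rfl⟩⟩, ?_⟩
    rw [tensorToSkew_tmul, mul_assoc, ← map_mul]

theorem tensorToSkew_mem (a : MonoidAlgebra ℂ Γ)
    (m : V ⊗[ℂ] Submodule.span (MonoidAlgebra ℂ Γ) {a}) :
    tensorToSkew V a m ∈ degreeOne V Γ := by
  induction m using TensorProduct.induction_on with
  | zero => rw [map_zero]; exact zero_mem _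
  | add x y hx hy => rw [map_add]; exact add_mem hx hy
  | tmul v x =>
    rw [tensorToSkew_tmul]
    exact mul_groupAlgebraHom_mem_degreeOne _ (vecHom_mem_degreeOne v)

theorem tensorToSkew_mul {a : MonoidAlgebra ℂ Γ} (ha : IsIdempotentElem a)
    (m : V ⊗[ℂ] Submodule.span (MonoidAlgebra ℂ Γ) {a}) :
    tensorToSkew V a m * groupAlgebraHom V a = tensorToSkew V a m := by
  induction m using TensorProduct.induction_on with
  | zero => rw [map_zero, zero_mul]
  | add x y hx hy => rw [map_add, add_mul, hx, hy]
  | tmul v x =>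
    rw [tensorToSkew_tmul, mul_assoc, ← map_mul, (mem_span_idempotent_iff ha).1 x.2]

theorem tensorToSkew_asAlgebraHom (a x : MonoidAlgebra ℂ Γ)
    (m : V ⊗[ℂ] Submodule.span (MonoidAlgebra ℂ Γ) {a}) :
    tensorToSkew V a (((Representation.ofDistribMulAction ℂ Γ V).tprod
      (leftIdealRep a)).asAlgebraHom x m) = groupAlgebraHom V x * tensorToSkew V a m := by
  induction x using MonoidAlgebra.induction_linear with
  | zero => rw [map_zero, map_zero, LinearMap.zero_apply, map_zero, zero_mul]
  | add x y hx hy => rw [map_add, map_add, LinearMap.add_apply, map_add, hx, hy, add_mul]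
  | single g c =>
    have h1 : (MonoidAlgebra.single g c : MonoidAlgebra ℂ Γ) = c • MonoidAlgebra.single g 1 := by
      simp
    rw [h1, map_smul, map_smul, LinearMap.smul_apply, map_smul, smul_mul_assoc]
    congr 1
    rw [Representation.asAlgebraHom_single_one]
    induction m using TensorProduct.induction_on with
    | zero => rw [map_zero, map_zero, mul_zero]
    | add x y hx hy => rw [map_add, map_add, hx, hy, map_add, mul_add]
    | tmul v x =>
      rw [Representation.tprod_apply, TensorProduct.map_tmul, tensorToSkew_tmul, tensorToSkew_tmul,
        Representation.ofDistribMulAction_apply_apply, leftIdealRep_apply_coe, map_mul,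
        ← mul_assoc, ← mul_assoc, single_mul_vecHom]

variable {I : Type*} {e : I → MonoidAlgebra ℂ Γ}

/-- An intertwining map out of the cyclic module `ℂΓ e_j` is determined by the image of `e_j`, which
may be any vector fixed by `e_j`. Inside `V * Γ` these vectors of `V ⊗ ℂΓ e_i` form `e_j (V * Γ)
e_i`. -/
theorem finrank_arrowSpace (he : IsBasicSystem e) (i j : I) :
    Module.finrank ℂ (arrowSpace V e i j) = mcKayMultiplicity V e i j := by
  set τ := (Representation.ofDistribMulAction ℂ Γ V).tprod (leftIdealRep (e i)) with hτ
  set ej : Submodule.span (MonoidAlgebra ℂ Γ) {e j} :=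
    ⟨e j, Submodule.mem_span_singleton_self _⟩ with hej
  have hx : ∀ x : Submodule.span (MonoidAlgebra ℂ Γ) {e j},
      (leftIdealRep (e j)).asAlgebraHom (x : MonoidAlgebra ℂ Γ) ej = x := fun x => Subtype.ext (by
    rw [leftIdealRep_asAlgebraHom_coe]
    exact (mem_span_idempotent_iff (he.idem j)).1 x.2)
  have hF : ∀ (F : Representation.IntertwiningMap (leftIdealRep (e j)) τ) x y,
      F ((leftIdealRep (e j)).asAlgebraHom x y) = τ.asAlgebraHom x (F y) := by
    intro F x y
    induction x using MonoidAlgebra.induction_linear with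
    | zero => simp
    | add x y hx hy => simp only [map_add, LinearMap.add_apply, hx, hy]
    | single g c =>
      rw [Representation.asAlgebraHom_single, Representation.asAlgebraHom_single,
        LinearMap.smul_apply, LinearMap.smul_apply, map_smul, F.isIntertwining]
  let Φ : Representation.IntertwiningMap (leftIdealRep (e j)) τ →ₗ[ℂ] SkewExterior V Γ :=
    { toFun := fun F => tensorToSkew V (e i) (F ej)
      map_add' := fun F F' => by
        rw [← map_add]; rfl
      map_smul' := fun c F => by
        rw [← map_smul]; rfl }
  have hinj : Function.Injective Φ := by
    intro F F' h
    have h1 : F ej = F' ej := tensorToSkew_injective (he.idem i) h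
    refine Representation.IntertwiningMap.ext (LinearMap.ext fun x => ?_)
    change F x = F' x
    rw [← hx x, hF, hF, h1]
  have hrange : LinearMap.range Φ = arrowSpace V e i j := by
    ext x
    rw [LinearMap.mem_range, mem_arrowSpace_iff he]
    constructor
    · rintro ⟨F, rfl⟩
      refine ⟨tensorToSkew_mem _ _, ?_, tensorToSkew_mul (he.idem i) _⟩
      change groupAlgebraHom V (e j) * tensorToSkew V (e i) (F ej) = tensorToSkew V (e i) (F ej)
      rw [← tensorToSkew_asAlgebraHom, ← hF]
      exact congrArg (fun y => tensorToSkew V (e i) (F y)) (hx ej)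
    · rintro ⟨h1, h2, h3⟩
      obtain ⟨m, rfl⟩ := exists_tensorToSkew_eq h1 h3
      have hm : τ.asAlgebraHom (e j) m = m := by
        apply tensorToSkew_injective (he.idem i)
        rw [hτ, tensorToSkew_asAlgebraHom, h2]
      let L : Submodule.span (MonoidAlgebra ℂ Γ) {e j} →ₗ[ℂ]
          V ⊗[ℂ] Submodule.span (MonoidAlgebra ℂ Γ) {e i} :=
        { toFun := fun x => τ.asAlgebraHom (x : MonoidAlgebra ℂ Γ) m
          map_add' := fun x y => by rw [Submodule.coe_add, map_add, LinearMap.add_apply]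
          map_smul' := fun c x => by
            rw [Submodule.coe_smul_of_tower, map_smul, LinearMap.smul_apply, RingHom.id_apply] }
      refine ⟨⟨L, fun g => LinearMap.ext fun x => ?_⟩, ?_⟩
      · change τ.asAlgebraHom (MonoidAlgebra.single g 1 * (x : MonoidAlgebra ℂ Γ)) m =
          τ g (τ.asAlgebraHom (x : MonoidAlgebra ℂ Γ) m)
        rw [map_mul, Representation.asAlgebraHom_single_one]
        rfl
      · exact congrArg (tensorToSkew V (e i)) hm
  rw [← hrange, LinearMap.finrank_range_of_inj hinj]
  rfl

theorem finiteDimensional_arrowSpace [FiniteDimensional ℂ V] [Finite Γ] (he : IsBasicSystem e)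
    (i j : I) :
    FiniteDimensional ℂ (arrowSpace V e i j) := by
  have h : degreeOne V Γ = Submodule.span ℂ {x | ∃ (g : Γ) (v : V),
    x = SkewMonoidAlgebra.single g (ExteriorAlgebra.ι ℂ v)} := rfl
  have h2 : FiniteDimensional ℂ (degreeOne V Γ) := by
    have := Fintype.ofFinite Γ
    have h3 : degreeOne V Γ ≤ ⨆ g : Γ, LinearMap.range
        ((SkewMonoidAlgebra.lsingle ℂ g : ExteriorAlgebra ℂ V →ₗ[ℂ] SkewExterior V Γ) ∘ₗ
          ExteriorAlgebra.ι ℂ) := by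
      rw [h, Submodule.span_le]
      rintro _ ⟨g, v, rfl⟩
      exact Submodule.mem_iSup_of_mem g ⟨v, rfl⟩
    exact Submodule.finiteDimensional_of_le h3
  exact Submodule.finiteDimensional_of_le fun x hx => ((mem_arrowSpace_iff he).1 hx).1

end Multiplicity
end

/-! ### Realizations from bases of the arrow spaces. -/

noncomputable section

set_option linter.unusedSectionVars false

section Evaluation

open PathAlgebra

variable {V : Type*} [AddCommGroup V] [Module ℂ V]
variable {Γ : Type*} [Group Γ] [DistribMulAction Γ V] [SMulCommClass Γ ℂ V]
variable {I : Type*} [Fintype I] {e : I → MonoidAlgebra ℂ Γ}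
variable (Y : ∀ i j : McKayQuiver V e, (i ⟶ j) → SkewExterior V Γ)

/-- The product along a path of given values of the arrows. -/
def pathValue {i : McKayQuiver V e} : ∀ {j : McKayQuiver V e}, Quiver.Path i j → SkewExterior V Γ
  | _, Quiver.Path.nil => groupAlgebraHom V (e i)
  | _, Quiver.Path.cons p α => Y _ _ α * pathValue p

theorem vertex_mul_pathValue (he : IsBasicSystem e) (hY : ∀ i j α, Y i j α ∈ arrowSpace V e i j)
    {i j : McKayQuiver V e} (p : Quiver.Path i j) :
    groupAlgebraHom V (e j) * pathValue Y p = pathValue Y p := by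
  cases p with
  | nil => rw [pathValue, ← map_mul, he.idem i]
  | cons p α =>
    rw [pathValue, ← mul_assoc, ((mem_arrowSpace_iff he).1 (hY _ _ α)).2.1]

theorem pathValue_mul_vertex (he : IsBasicSystem e) {i j : McKayQuiver V e}
    (p : Quiver.Path i j) : pathValue Y p * groupAlgebraHom V (e i) = pathValue Y p := by
  induction p with
  | nil => rw [pathValue, ← map_mul, he.idem i]
  | cons p α ih => rw [pathValue, mul_assoc, ih]

theorem pathValue_comp (he : IsBasicSystem e) (hY : ∀ i j α, Y i j α ∈ arrowSpace V e i j)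
    {i j k : McKayQuiver V e} (p : Quiver.Path i j) (q : Quiver.Path j k) :
    pathValue Y (p.comp q) = pathValue Y q * pathValue Y p := by
  induction q with
  | nil => rw [Quiver.Path.comp_nil, pathValue, vertex_mul_pathValue Y he hY]
  | cons q α ih => rw [Quiver.Path.comp_cons, pathValue, ih, pathValue, mul_assoc]

/-- The linear extension of `pathValue` to the path algebra. -/
def evaluation : PathAlgebra (McKayQuiver V e) →ₗ[ℂ] SkewExterior V Γ :=
  Finsupp.linearCombination ℂ fun p : QuiverPath (McKayQuiver V e) => pathValue Y p.path

theorem evaluation_ofPath (p : QuiverPath (McKayQuiver V e)) :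
    evaluation Y (ofPath p) = pathValue Y p.path := by
  refine (Finsupp.linearCombination_single ℂ _ _).trans (one_smul _ _)

theorem evaluation_mul (he : IsBasicSystem e) (hY : ∀ i j α, Y i j α ∈ arrowSpace V e i j)
    (x y : PathAlgebra (McKayQuiver V e)) :
    evaluation Y (x * y) = evaluation Y x * evaluation Y y := by
  induction x using PathAlgebra.induction with
  | zero => rw [zero_mul, map_zero, zero_mul]
  | add x x' hx hx' => rw [add_mul, map_add, hx, hx', map_add, add_mul]
  | path c p =>
    rw [smul_mul, map_smul, map_smul, smul_mul_assoc]
    congr 1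
    induction y using PathAlgebra.induction with
    | zero => rw [mul_zero, map_zero, mul_zero]
    | add y y' hy hy' => rw [mul_add, map_add, hy, hy', map_add, mul_add]
    | path d q =>
      rw [PathAlgebra.mul_smul, map_smul, map_smul, mul_smul_comm]
      congr 1
      obtain ⟨a, b, p⟩ := p
      obtain ⟨a', b', q⟩ := q
      by_cases h : a = b'
      · subst h
        rw [ofPath_mul_comp, evaluation_ofPath, evaluation_ofPath, evaluation_ofPath]
        exact pathValue_comp Y he hY q p
      · rw [ofPath_mul_of_ne h, map_zero, evaluation_ofPath, evaluation_ofPath,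
          ← pathValue_mul_vertex Y he p, ← vertex_mul_pathValue Y he hY q, mul_assoc,
          ← mul_assoc (groupAlgebraHom V (e a)), ← map_mul,
          show e a * e b' = 0 from he.orthogonal.ortho h, map_zero, zero_mul, mul_zero]

theorem mem_basicAlgebra_of_mul (he : IsBasicSystem e) {i j : I} {x : SkewExterior V Γ}
    (h : groupAlgebraHom V (e j) * x = x) (h' : x * groupAlgebraHom V (e i) = x) :
    x ∈ basicAlgebra V e := by
  classical
  refine ⟨x, ?_⟩
  have h1 : (∑ i, e i) * e j = e j := by
    rw [Finset.sum_mul, Finset.sum_eq_single j (fun k _ hk => he.orthogonal.ortho hk)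
      (fun h => absurd (Finset.mem_univ j) h), he.idem]
  have h2 : e i * (∑ i, e i) = e i := by
    rw [Finset.mul_sum, Finset.sum_eq_single i (fun k _ hk => he.orthogonal.ortho (Ne.symm hk))
      (fun h => absurd (Finset.mem_univ i) h), he.idem]
  rw [← h, ← mul_assoc, ← map_mul, h1, h, ← h', mul_assoc, ← map_mul, h2, h']

theorem evaluation_mem (he : IsBasicSystem e) (hY : ∀ i j α, Y i j α ∈ arrowSpace V e i j)
    (x : PathAlgebra (McKayQuiver V e)) : evaluation Y x ∈ basicAlgebra V e := by
  induction x using PathAlgebra.induction with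
  | zero => rw [map_zero]; exact zero_mem _
  | add x y hx hy => rw [map_add]; exact add_mem hx hy
  | path c p =>
    rw [map_smul, evaluation_ofPath]
    exact SMulMemClass.smul_mem _ (mem_basicAlgebra_of_mul he (vertex_mul_pathValue Y he hY p.path)
      (pathValue_mul_vertex Y he p.path))

/-- Bases of the spaces `e_j (V * Γ) e_i` define a realization. -/
theorem exists_arrowRealization (he : IsBasicSystem e)
    (hli : ∀ i j, LinearIndependent ℂ (Y i j))
    (hspan : ∀ i j, Submodule.span ℂ (Set.range (Y i j)) = arrowSpace V e i j) :
    ∃ φ : ArrowRealization V e, ∀ {i j : McKayQuiver V e} (α : i ⟶ j),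
      φ.val (PathAlgebra.arrow α) = Y i j α := by
  have hY : ∀ i j α, Y i j α ∈ arrowSpace V e i j := fun i j α => by
    rw [← hspan i j]
    exact Submodule.subset_span ⟨α, rfl⟩
  have harr : ∀ {i j : McKayQuiver V e} (α : i ⟶ j),
      evaluation Y (PathAlgebra.arrow α) = Y i j α := by
    intro i j α
    rw [PathAlgebra.arrow, evaluation_ofPath]
    change Y i j α * groupAlgebraHom V (e i) = Y i j α
    exact ((mem_arrowSpace_iff he).1 (hY _ _ α)).2.2
  refine ⟨⟨{ toFun := fun x => ⟨evaluation Y x, evaluation_mem Y he hY x⟩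
             map_smul' := fun c x => Subtype.ext (map_smul (evaluation Y) c x)
             map_zero' := Subtype.ext (map_zero (evaluation Y))
             map_add' := fun x y => Subtype.ext (map_add (evaluation Y) x y)
             map_mul' := fun x y => Subtype.ext (evaluation_mul Y he hY x y) },
    fun i => evaluation_ofPath Y _, fun i j => ?_, fun i j => ?_⟩, harr⟩
  · have h1 : (fun α : i ⟶ j => evaluation Y (PathAlgebra.arrow α)) = Y i j := funext harr
    change LinearIndependent ℂ (fun α : i ⟶ j => evaluation Y (PathAlgebra.arrow α))
    rw [h1]
    exact hli i j
  · have h1 : (fun α : i ⟶ j => evaluation Y (PathAlgebra.arrow α)) = Y i j := funext harr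
    change Submodule.span ℂ (Set.range fun α : i ⟶ j => evaluation Y (PathAlgebra.arrow α)) = _
    rw [h1]
    exact hspan i j

end Evaluation
end

/-! ### Compatible realizations for `G` and `N`. -/

noncomputable section

set_option linter.unusedSectionVars false

attribute [local instance 2000] exteriorAction exteriorDistribMulAction

section Existence

variable {V : Type*} [AddCommGroup V] [Module ℂ V]
variable {G : Type*} [Group G] [Finite G] [DistribMulAction G V] [SMulCommClass G ℂ V]
variable {N : Subgroup G} [N.Normal]
variable {I J : Type*} {e : I → MonoidAlgebra ℂ G} {f : J → MonoidAlgebra ℂ N}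

theorem IsRestriction.groupAlgebraHom_mul_eq (hN : HasEnoughCharacters N) (he : IsBasicSystem e)
    (hf : IsBasicSystem f) {a : I} {i j : J} {u : MonoidAlgebra ℂ G} (h : IsRestriction e f a i u)
    {z : SkewExterior V N} (hz : z * groupAlgebraHom V (f i) = z)
    (hj : groupAlgebraHom V (subgroupHom N (f j)) * (skewInclusion N z * groupAlgebraHom V u) =
      skewInclusion N z * groupAlgebraHom V u) : groupAlgebraHom V (f j) * z = z := by
  refine sub_eq_zero.1 (h.eq_zero_of_skewInclusion_mul_eq_zero hN he hf ?_ ?_)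
  · rw [sub_mul, mul_assoc, hz]
  · rw [map_sub, sub_mul, skewInclusion_mul, skewInclusion_groupAlgebraHom, mul_assoc, hj, sub_self]

variable (e) in
/-- `z` maps `ℂG e_b`, for some `b`, to the representation `ℂG e_a` tensored with `V`. -/
def IsHomogeneousAt (u : I → MonoidAlgebra ℂ G) (z : SkewExterior V N) (a : I) : Prop :=
  ∃ b y, groupAlgebraHom V (e b) * y = y ∧
    skewInclusion N z * groupAlgebraHom V (u a) = groupAlgebraHom V (u b) * y

variable {p : I → J} {u : I → MonoidAlgebra ℂ G}

/-- Apply `skewTwist χ` to `z u_a = u_b y`: it fixes `z` and moves `a` and `b` within their fibres.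
-/
theorem IsHomogeneousAt.of_isTwist (he : IsBasicSystem e) (hf : IsBasicSystem f)
    (h : ∀ a, IsRestriction e f a (p a) (u a)) {χ : G ⧸ N →* ℂˣ} {a a' : I}
    (ha : IsTwist u χ a a') {z : SkewExterior V N} (hz : IsHomogeneousAt e u z a) :
    IsHomogeneousAt e u z a' := by
  obtain ⟨b, y, -, hy⟩ := hz
  obtain ⟨b', hb'⟩ := exists_isTwist he hf h χ b
  obtain ⟨w', hw'⟩ := hb'.exists_mul_eq he hf h
  obtain ⟨w, hw⟩ := ha
  refine ⟨b', groupAlgebraHom V (e b') * (groupAlgebraHom V w' * skewTwist χ y *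
    groupAlgebraHom V w), by rw [← mul_assoc, ← map_mul, he.idem], ?_⟩
  rw [← mul_assoc (groupAlgebraHom V (u b')), ← map_mul, (h b').right, ← hw, map_mul, ← mul_assoc,
    ← skewTwist_groupAlgebraHom, ← skewTwist_skewInclusion χ z, ← map_mul, hy, map_mul,
    skewTwist_groupAlgebraHom, ← hw', map_mul]
  simp only [mul_assoc]

/-- Writing `f_j` as a sum of elements `u c * t` splits `z u_a = f_j z u_a` into parts `u c * y`.
Each part is `z' u_a` with `z'` in `V * N`, and this `z'` is homogeneous. -/
theorem mem_span_isHomogeneousAt (hN : HasEnoughCharacters N) (he : IsBasicSystem e)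
    (hf : IsBasicSystem f) (h : ∀ a, IsRestriction e f a (p a) (u a)) (a : I) {j : J}
    {z : SkewExterior V N} (hz : z ∈ arrowSpace V f (p a) j) :
    z ∈ Submodule.span ℂ {z | z ∈ arrowSpace V f (p a) j ∧ IsHomogeneousAt e u z a} := by
  set M := Submodule.span ℂ {z | z ∈ arrowSpace V f (p a) j ∧ IsHomogeneousAt e u z a} with hM
  obtain ⟨hz1, hz2, hz3⟩ := (mem_arrowSpace_iff hf).1 hz
  set x := skewInclusion N z * groupAlgebraHom V (u a) with hx
  have hxd : x ∈ degreeOne V G :=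
    mul_groupAlgebraHom_mem_degreeOne _ (skewInclusion_mem_degreeOne hz1)
  have hxa : x * groupAlgebraHom V (e a) = x := by
    rw [hx, mul_assoc, ← map_mul, (h a).right]
  have key : ∀ t ∈ Submodule.span ℂ {x | ∃ c t, p c = j ∧ e c * t = t ∧ x = u c * t},
      ∃ y ∈ M, skewInclusion N y * groupAlgebraHom V (u a) = groupAlgebraHom V t * x := by
    intro t ht
    induction ht using Submodule.span_induction with
    | zero => exact ⟨0, zero_mem _, by rw [map_zero, zero_mul, map_zero, zero_mul]⟩
    | add t t' _ _ ht ht' =>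
      obtain ⟨y, hy, hyt⟩ := ht
      obtain ⟨y', hy', hyt'⟩ := ht'
      exact ⟨y + y', add_mem hy hy', by rw [map_add, add_mul, hyt, hyt', map_add, add_mul]⟩
    | smul r t _ ht =>
      obtain ⟨y, hy, hyt⟩ := ht
      exact ⟨r • y, Submodule.smul_mem _ _ hy, by
        rw [skewInclusion_smul, smul_mul_assoc, hyt, map_smul, smul_mul_assoc]⟩
    | mem t ht =>
      obtain ⟨c, t, rfl, hct, rfl⟩ := ht
      obtain ⟨z', hz1', hz2', hz3'⟩ := (h a).exists_degreeOne he
        (x := groupAlgebraHom V (u c * t) * x) (groupAlgebraHom_mul_mem_degreeOne _ hxd)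
        (by rw [mul_assoc, hxa])
      refine ⟨z', Submodule.subset_span ⟨(mem_arrowSpace_iff hf).2 ⟨hz1', ?_, hz2'⟩,
        c, groupAlgebraHom V t * x, ?_, ?_⟩, hz3'⟩
      · refine (h a).groupAlgebraHom_mul_eq hN he hf hz2' ?_
        rw [hz3', ← mul_assoc, ← map_mul, ← mul_assoc (subgroupHom N (f (p c))) (u c) t, (h c).left]
      · rw [← mul_assoc, ← map_mul, hct]
      · rw [hz3', map_mul, mul_assoc]
  obtain ⟨y, hy, hyx⟩ := key _ (subgroupHom_mem_span he hf h j)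
  have hya : y * groupAlgebraHom V (f (p a)) = y := by
    have h1 : M ≤ arrowSpace V f (p a) j := Submodule.span_le.2 fun z hz => hz.1
    exact ((mem_arrowSpace_iff hf).1 (h1 hy)).2.2
  have h0 : z - y = 0 := by
    refine (h a).eq_zero_of_skewInclusion_mul_eq_zero hN he hf ?_ ?_
    · rw [sub_mul, hya, hz3]
    · rw [map_sub, sub_mul, hyx, ← skewInclusion_groupAlgebraHom, hx, ← mul_assoc,
        ← skewInclusion_mul, hz2, sub_self]
  rw [sub_eq_zero.1 h0]
  exact hy

/-- A basis is selected from the homogeneous elements at one vertex `a` of the fibre; twisting makes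
it homogeneous at all the others. -/
theorem exists_homogeneous_basis [FiniteDimensional ℂ V] (hN : HasEnoughCharacters N)
    (he : IsBasicSystem e) (hf : IsBasicSystem f) (h : ∀ a, IsRestriction e f a (p a) (u a))
    (hp : Function.Surjective p) (i j : J) :
    ∃ Z : Fin (mcKayMultiplicity V f i j) → SkewExterior V N, LinearIndependent ℂ Z ∧
      Submodule.span ℂ (Set.range Z) = arrowSpace V f i j ∧
      ∀ β a, p a = i → IsHomogeneousAt e u (Z β) a := by
  obtain ⟨a, rfl⟩ := hp i
  obtain ⟨B, hBS, hspan, hli⟩ := exists_linearIndependent ℂ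
    {z | z ∈ arrowSpace V f (p a) j ∧ IsHomogeneousAt e u z a}
  have hBspan : Submodule.span ℂ B = arrowSpace V f (p a) j := by
    rw [hspan]
    exact le_antisymm (Submodule.span_le.2 fun z hz => hz.1)
      fun z hz => mem_span_isHomogeneousAt hN he hf h a hz
  have hfin : FiniteDimensional ℂ (Submodule.span ℂ (Set.range ((↑) : B → SkewExterior V N))) := by
    rw [Subtype.range_coe, hBspan]
    exact finiteDimensional_arrowSpace hf _ _
  have hfinB : Finite B := Module.Finite.finite_basis (Module.Basis.span hli)
  have := Fintype.ofFinite B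
  have hcard : Fintype.card B = mcKayMultiplicity V f (p a) j := by
    rw [← Module.finrank_eq_card_basis (Module.Basis.span hli), Subtype.range_coe, hBspan,
      finrank_arrowSpace hf]
  let ε := (Fintype.equivFinOfCardEq hcard).symm
  refine ⟨fun β => (ε β : SkewExterior V N), hli.comp ε ε.injective, ?_, fun β a' ha' => ?_⟩
  · rw [← hBspan]
    congr 1
    exact (ε.surjective.range_comp _).trans Subtype.range_coe
  · obtain ⟨χ, hχ⟩ := exists_isTwist_of_fibre_eq hN he hf h (a := a) (b := a') ha'.symm
    exact (hBS (ε β).2).2.of_isTwist he hf h hχ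

variable [Fintype I] [Fintype J]

theorem exists_isRestrictionAlong [FiniteDimensional ℂ V] (hN : HasEnoughCharacters N)
    (he : IsBasicSystem e) (hf : IsBasicSystem f) (h : ∀ a, IsRestriction e f a (p a) (u a)) :
    ∃ (φ : ArrowRealization V e) (ψ : ArrowRealization V f)
      (π : McKayQuiver V e ⥤q McKayQuiver V f), IsRestrictionAlong φ ψ π u := by
  have hp := surjective_of_isRestriction he hf h
  choose Z hZli hZspan hZhom using exists_homogeneous_basis (V := V) hN he hf h hp
  have hZmem : ∀ i j β, Z i j β ∈ arrowSpace V f i j := fun i j β => by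
    rw [← hZspan i j]
    exact Submodule.subset_span ⟨β, rfl⟩
  choose T y hy1 hy2 using fun (a : I) (j : J) (β : Fin (mcKayMultiplicity V f (p a) j)) =>
    hZhom (p a) j β a rfl
  obtain ⟨ψ, hψ⟩ := exists_arrowRealization (V := V) (e := f) Z hf hZli hZspan
  have hymem : ∀ a j β, y a j β ∈ arrowSpace V e a (T a j β) := by
    intro a j β
    obtain ⟨z, hz, -⟩ := exists_dual he h (T a j β)
    have h1 : y a j β = groupAlgebraHom V z *
        (skewInclusion N (Z (p a) j β) * groupAlgebraHom V (u a)) := by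
      rw [hy2, ← mul_assoc, ← map_mul, hz, hy1]
    refine (mem_arrowSpace_iff he).2 ⟨?_, hy1 a j β, ?_⟩
    · rw [h1]
      exact groupAlgebraHom_mul_mem_degreeOne _ (mul_groupAlgebraHom_mem_degreeOne _
        (skewInclusion_mem_degreeOne ((mem_arrowSpace_iff hf).1 (hZmem _ _ _)).1))
    · rw [h1, mul_assoc, mul_assoc, ← map_mul, (h a).right]
  -- The basis elements over `p a` that, read at `a`, lead to `b`. They index the arrows from `a` to
  -- `b`: the corresponding `y` form a basis of `e_b (V * G) e_a`.
  let S : I → I → Type := fun a b => {β : Fin (mcKayMultiplicity V f (p a) (p b)) //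
    T a (p b) β = b}
  have hyS : ∀ a b (β : S a b), skewInclusion N (Z (p a) (p b) β.1) * groupAlgebraHom V (u a) =
      groupAlgebraHom V (u b) * y a (p b) β.1 := fun a b β => by
    rw [hy2, β.2]
  have hSli : ∀ a b, LinearIndependent ℂ fun β : S a b => y a (p b) β.1 := by
    intro a b
    have : Fintype (S a b) := Fintype.ofFinite _
    rw [Fintype.linearIndependent_iff]
    intro g hg
    refine Fintype.linearIndependent_iff.1
      ((hZli (p a) (p b)).comp (Subtype.val : S a b → _) Subtype.val_injective) g ?_
    refine (h a).eq_zero_of_skewInclusion_mul_eq_zero hN he hf ?_ ?_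
    · rw [Finset.sum_mul]
      refine Finset.sum_congr rfl fun β _ => ?_
      rw [smul_mul_assoc]
      exact congrArg _ ((mem_arrowSpace_iff hf).1 (hZmem _ _ _)).2.2
    · rw [map_sum, Finset.sum_mul]
      have h1 : ∀ β : S a b, skewInclusion N (g β • (Z (p a) (p b) ∘ Subtype.val) β) *
          groupAlgebraHom V (u a) = groupAlgebraHom V (u b) * (g β • y a (p b) β.1) := by
        intro β
        rw [skewInclusion_smul, smul_mul_assoc, mul_smul_comm, ← hyS]
        rfl
      rw [Finset.sum_congr rfl fun β _ => h1 β, ← Finset.mul_sum, hg, mul_zero]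
  have hSspan : ∀ a b, Submodule.span ℂ (Set.range fun β : S a b => y a (p b) β.1) =
      arrowSpace V e a b := by
    intro a b
    apply le_antisymm
    · rw [Submodule.span_le]
      rintro _ ⟨β, rfl⟩
      have h1 := hymem a (p b) β.1
      rwa [β.2] at h1
    · intro x hx
      obtain ⟨hx1, hx2, hx3⟩ := (mem_arrowSpace_iff he).1 hx
      obtain ⟨z, hz1, hz2, hz3⟩ := (h a).exists_degreeOne he (x := groupAlgebraHom V (u b) * x)
        (groupAlgebraHom_mul_mem_degreeOne _ hx1) (by rw [mul_assoc, hx3])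
      have hz : z ∈ arrowSpace V f (p a) (p b) := by
        refine (mem_arrowSpace_iff hf).2 ⟨hz1, (h a).groupAlgebraHom_mul_eq hN he hf hz2 ?_, hz2⟩
        rw [hz3, ← mul_assoc, ← map_mul, (h b).left]
      rw [← hZspan, Submodule.mem_span_range_iff_exists_fun] at hz
      obtain ⟨g, hg⟩ := hz
      obtain ⟨d, hd, hd0⟩ := exists_dual he h b
      -- The dual element `d` removes every basis element that does not lead to `b`.
      have h1 : x = ∑ β, g β • (groupAlgebraHom V (d * u (T a (p b) β)) * y a (p b) β) := by
        calc x = groupAlgebraHom V d * (groupAlgebraHom V (u b) * x) := by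
              rw [← mul_assoc, ← map_mul, hd, hx2]
          _ = _ := by
              rw [← hz3, ← hg, map_sum, Finset.sum_mul, Finset.mul_sum]
              refine Finset.sum_congr rfl fun β _ => ?_
              rw [skewInclusion_smul, smul_mul_assoc, mul_smul_comm, hy2, map_mul, mul_assoc]
      rw [h1]
      refine sum_mem fun β _ => Submodule.smul_mem _ _ ?_
      by_cases hβ : T a (p b) β = b
      · have h2 : groupAlgebraHom V (d * u (T a (p b) β)) * y a (p b) β = y a (p b) β := by
          have h3 := hy1 a (p b) β
          rw [hβ] at h3 ⊢
          rw [hd, h3]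
        rw [h2]
        exact Submodule.subset_span ⟨⟨β, hβ⟩, rfl⟩
      · rw [hd0 _ hβ, map_zero, zero_mul]
        exact zero_mem _
  have hScard : ∀ a b, Nonempty (Fin (mcKayMultiplicity V e a b) ≃ S a b) := by
    intro a b
    have : Fintype (S a b) := Fintype.ofFinite _
    refine ⟨(Fintype.equivFinOfCardEq ?_).symm⟩
    rw [← finrank_arrowSpace he, ← hSspan a b, finrank_span_eq_card (hSli a b)]
  have ε := fun a b => (hScard a b).some
  obtain ⟨φ, hφ⟩ := exists_arrowRealization (V := V) (e := e)
    (fun (a b : I) α => y a (p b) (ε a b α).1) he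
    (fun a b => (hSli a b).comp (ε a b) (ε a b).injective)
    (fun a b => ((congrArg (Submodule.span ℂ) ((ε a b).surjective.range_comp
      fun β : S a b => y a (p b) β.1))).trans (hSspan a b))
  refine ⟨φ, ψ, ⟨p, fun {a b} α => (ε a b α).1⟩, h, fun {a b} α => ?_⟩
  rw [hφ]
  refine Eq.trans ?_ (hyS a b (ε a b α))
  exact congrArg (fun z => skewInclusion N z * groupAlgebraHom V (u a)) (hψ _)

end Existence
end

theorem mainTheorem4 {V : Type*} [AddCommGroup V] [Module ℂ V] [FiniteDimensional ℂ V]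
    (G : Subgroup (V ≃ₗ[ℂ] V)) [Finite G]
    (hext : ∀ χ : specialSubgroup G → ℂ, IsIrreducibleCharacter χ →
      ∃ χ' : G → ℂ, IsIrreducibleCharacter χ' ∧ ∀ n : specialSubgroup G, χ' n = χ n)
    {I J : Type*} [Fintype I] [Fintype J]
    (e : I → MonoidAlgebra ℂ G) (he : IsBasicSystem e)
    (f : J → MonoidAlgebra ℂ (specialSubgroup G)) (hf : IsBasicSystem f) :
    (∃ (φ : ArrowRealization V e) (ψ : ArrowRealization V f)
      (π : McKayQuiver V e ⥤q McKayQuiver V f), IsRestrictionMap φ ψ π) ∧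
    ∀ (φ : ArrowRealization V e) (ψ : ArrowRealization V f)
      (π : McKayQuiver V e ⥤q McKayQuiver V f), IsRestrictionMap φ ψ π →
      (∃ ρN, ψ.IsPresentedBy ρN ∧ LiftsUniformly π ρN) ∧
      ∀ ρN, ψ.IsPresentedBy ρN → LiftsUniformly π ρN →
        ∃ ρG, φ.IsPresentedBy ρG ∧
          IsMorphismOfQuiversWithRelations (G ⧸ specialSubgroup G) π ρG ρN := by
  have hcomm := specialSubgroup_quotient_comm G
  have hN := hasEnoughCharacters_of_comm hcomm
  refine ⟨?_, fun φ ψ π h => ?_⟩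
  · choose p u h using exists_isRestriction hN hext he hf
    obtain ⟨φ, ψ, π, h⟩ := exists_isRestrictionAlong (V := V) hN he hf h
    exact ⟨φ, ψ, π, h.isRestrictionMap he hf⟩
  obtain ⟨u, h⟩ := h.exists_along he hf
  obtain ⟨ε⟩ := nonempty_mulEquiv_characters hcomm
  exact ⟨h.exists_relations hN he hf, fun ρN h₁ h₂ => h.exists_lifted_relations ε hN he hf h₁ h₂⟩
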